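/- **Setting.** A shifted lattice is a set $L=u_1+u_2\mathbb Z\subset\mathbb R$ with $u_1\in\mathbb R$, $u_2\in\mathbb R\setminus\{0\}$. Put $L^\vee=\{t\in\mathbb R: (l_1-l_2)t\in\mathbb Z\ \text{for all } l_1,l_2\in L\}$ and $\omega_L(t)=e^{2\pi i l t}$ for $t\in L^\vee$, where $l\in L$ is arbitrary (the value does not depend on $l$). A distribution on $\mathbb R$ is a $\mathbb C$-linear form $T$ on $C_0^\infty(\mathbb R)$ such that for each $u>0$ there are $m\ge 0$ and $c>0$ with $|T(f)|\le c\sum_{i=0}^m\sup|f^{(i)}|$ for all $f$ supported in $[-u,u]$. Let $\mathcal D'(L^\vee\backslash\mathbb R;\omega_L)$ be the space of distributions $T$ with $T(f(\cdot+t))=\omega_L(-t)T(f)$ for all $t\in L^\vee$, $f\in C_0^\infty(\mathbb R)$. Let $\mathfrak M_r(L)$ be the set of $\alpha:L\to\mathbb C$ with $\alpha(l)=O(|l|^r)$ as $|l|\to\infty$, and $\mathfrak M(L)=\bigcup_{r\in\mathbb R}\mathfrak M_r(L)$; put $\alpha(0)=0$ if $0\notin L$. For $\alpha\in\mathfrak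 M(L)$ let $$T_\alpha(f)=\sum_{l\in L}\alpha(l)\int_{\mathbb R}f(x)e^{2\pi i l x}\,dx\qquad(f\in C_0^\infty(\mathbb R)).$$ For $\mu,\nu\in\mathbb C$ and $x\ne0$ let $J_{\mu,\nu}(x)=e^{-\mathrm{sgn}(x)\pi i\mu/2}|x|^{-2\nu-1}$ and, for $f\in C_0^\infty(\mathbb R\setminus\{0\})$, $f_{\mu,\nu,\infty}(x)=J_{\mu,\nu}(x)f(-1/x)$, extended by $0$ at $x=0$. An automorphic pair for $(L_1,L_2)$ with automorphic factor $J_{\mu,\nu}$ is a pair $(T_1,T_2)\in\mathcal D'(L_1^\vee\backslash\mathbb R;\omega_{L_1})\times\mathcal D'(L_2^\vee\backslash\mathbb R;\omega_{L_2})$ with $T_1(f)=T_2(f_{\mu,\nu,\infty})$ for all $f\in C_0^\infty(\mathbb R\setminus\{0\})$. For $\alpha\in\mathfrak M_r(L)$ and $\mathrm{Re}(s)>r+1$ let $$\Xi_\pm(\alpha;s)=(2\pi)^{-s}\Gamma(s)\sum_{l\in L,\ \pm l>0}\frac{\alpha(l)}{|l|^s},\qquad \Xi(\alpha;s)=\begin{pmatrix}\Xi_+(\alpha;s)\\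 \Xi_-(\alpha;s)\end{pmatrix},$$ and put $$E(s)=\begin{pmatrix}e^{\pi i s/2}&e^{-\pi i s/2}\\ e^{-\pi i s/2}&e^{\pi i s/2}\end{pmatrix},\qquad \Sigma_\mu=\begin{pmatrix}0&e^{\pi i\mu/2}\\ e^{-\pi i\mu/2}&0\end{pmatrix}.$$ Consider the following conditions. * [D1] The functions $\Xi_\pm(\alpha_1;s)$ and $\Xi_\pm(\alpha_2;s)$ have meromorphic continuations to $\mathbb C$, the function $$E(s)\,\Xi(\alpha_1;s)+\Bigl(\frac{\alpha_1(0)}{s}1_2-\frac{\alpha_2(0)}{s+2\nu-1}\Sigma_\mu\Bigr)\begin{pmatrix}1\\1\end{pmatrix}$$ is entire, and $E(s)\,\Xi(\alpha_1;s)=\Sigma_\mu\,E(-s-2\nu+1)\,\Xi(\alpha_2;-s-2\nu+1)$. * [D2-1] for $\alpha$: for all real $\sigma_1<\sigma_2$, $\Xi_\pm(\alpha;s)=O\bigl(e^{-\pi|\mathrm{Im}(s)|/2+\sqrt{|\mathrm{Im}(s)|}}\bigr)$ as $|s|\to\infty$, uniformly on $\sigma_1\le\mathrm{Re}(s)\le\sigma_2$.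 * [D2-2] for $\alpha$: for all real $\sigma_1<\sigma_2$ there is $c_0>0$ such that $\Xi_\pm(\alpha;s)=O\bigl(e^{|s|^{c_0}}\bigr)$ as $|s|\to\infty$, uniformly on $\sigma_1\le\mathrm{Re}(s)\le\sigma_2$. **Theorem.** Let $L_1,L_2$ be shifted lattices, $\mu,\nu\in\mathbb C$, $\alpha_1\in\mathfrak M(L_1)$ and $\alpha_2\in\mathfrak M(L_2)$. (i) If $(T_{\alpha_1},T_{\alpha_2})$ is an automorphic pair for $(L_1,L_2)$ with automorphic factor $J_{\mu,\nu}$, then [D1] holds, and [D2-1] holds for $\alpha_1$ and for $\alpha_2$. (ii) Conversely, if [D1] holds and [D2-2] holds for $\alpha_1$, then $(T_{\alpha_1},T_{\alpha_2})$ is an automorphic pair for $(L_1,L_2)$ with automorphic factor $J_{\mu,\nu}$. -/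

import Mathlib

open Complex Filter Topology Asymptotics TopologicalSpace

noncomputable section

namespace AutomorphicDistribution

/-- `C₀^∞(ℝ)`: smooth compactly supported functions `ℝ → ℂ`. -/
abbrev TestR : Type := TestFunction (⊤ : Opens ℝ) ℂ (⊤ : ℕ∞)

/-- The open subset `ℝ^× = ℝ \ {0}` of `ℝ`. -/
def punctured : Opens ℝ := ⟨{0}ᶜ, isOpen_compl_singleton⟩

/-- `C₀^∞(ℝ^×)`: smooth functions whose support is compact and contained in `ℝ \ {0}`,
already extended by `0` at the origin. -/
abbrev TestRx : Type := TestFunction punctured ℂ (⊤ : ℕ∞)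

/-- The inclusion `C₀^∞(ℝ^×) ⊆ C₀^∞(ℝ)`. -/
def TestRx.toTestR (f : TestRx) : TestR where
  toFun := f
  contDiff' := f.contDiff
  hasCompactSupport' := f.hasCompactSupport
  tsupport_subset' := fun _ _ => trivial

/-- The translate `x ↦ f (x + t)`. -/
def shift (t : ℝ) (f : TestR) : TestR where
  toFun := fun x => f (x + t)
  contDiff' := f.contDiff.comp (contDiff_id.add contDiff_const)
  hasCompactSupport' := f.hasCompactSupport.comp_homeomorph (Homeomorph.addRight t)
  tsupport_subset' := fun _ _ => trivial

/-- A distribution on `ℝ`: a `ℂ`-linear form on `C₀^∞(ℝ)` such that for every `u > 0` there are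
`m` and `c > 0` with `|T f| ≤ c ∑_{i ≤ m} sup |f^{(i)}|` for all `f` supported in `[-u, u]`. -/
structure IsDistribution (T : TestR → ℂ) : Prop where
  linear : IsLinearMap ℂ T
  bound : ∀ u : ℝ, 0 < u → ∃ (m : ℕ) (c : ℝ), 0 < c ∧
    ∀ f : TestR, tsupport f ⊆ {x : ℝ | |x| ≤ u} →
      ‖T f‖ ≤ c * ∑ i ∈ Finset.range (m + 1), ⨆ x : ℝ, ‖iteratedDeriv i f x‖

/-- The Fourier transform `∫ f(x) e^{2πixy} dx`. -/
def fourier (f : TestR) (y : ℝ) : ℂ := ∫ x : ℝ, f x * cexp (2 * Real.pi * I * x * y)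

/-- `L = u₁ + u₂ ℤ` with `u₂ ≠ 0`. -/
def IsShiftedLattice (L : Set ℝ) : Prop :=
  ∃ u₁ u₂ : ℝ, u₂ ≠ 0 ∧ L = {x | ∃ n : ℤ, x = u₁ + u₂ * n}

/-- The dual lattice `L^∨`. -/
def dualLattice (L : Set ℝ) : Set ℝ :=
  {t | ∀ l₁ ∈ L, ∀ l₂ ∈ L, ∃ n : ℤ, (l₁ - l₂) * t = n}

/-- The distributions `T` with `T(f(· + t)) = ω_L(-t) T(f)` for `t ∈ L^∨`, where
`ω_L(t) = e^{2πilt}` for any `l ∈ L` (the value does not depend on `l`). -/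
def quasiPeriodic (L : Set ℝ) : Set (TestR → ℂ) :=
  {T | IsDistribution T ∧ ∀ t ∈ dualLattice L, ∀ l ∈ L, ∀ f : TestR,
    T (shift t f) = cexp (2 * Real.pi * I * l * (-t)) * T f}

/-- `α ∈ 𝔐_r(L)`, that is `α(l) = O(|l|^r)` as `|l| → ∞` in `L`. -/
def HasGrowth {L : Set ℝ} (α : L → ℂ) (r : ℝ) : Prop :=
  α =O[comap (fun l : L => |(l : ℝ)|) atTop] fun l : L => |(l : ℝ)| ^ r

/-- `α ∈ 𝔐(L)`. -/
def PolyBounded {L : Set ℝ} (α : L → ℂ) : Prop := ∃ r : ℝ, HasGrowth α r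

open Classical in
/-- `α(0)`, understood as `0` when `0 ∉ L`. -/
def valueAtZero {L : Set ℝ} (α : L → ℂ) : ℂ := if h : (0 : ℝ) ∈ L then α ⟨0, h⟩ else 0

/-- The Fourier series `T_α(f) = ∑_{l ∈ L} α(l) 𝓕f(l)`. -/
def fourierSeries {L : Set ℝ} (α : L → ℂ) : TestR → ℂ :=
  fun f => ∑' l : L, α l * fourier f l

/-- `J_{μ,ν}(x) = e^{-sgn(x)πiμ/2} |x|^{-2ν-1}` for `x ≠ 0`. -/
def J (μ ν : ℂ) (x : ℝ) : ℂ :=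
  cexp (-(Real.sign x : ℂ) * Real.pi * I * μ / 2) * ((|x| : ℝ) : ℂ) ^ (-2 * ν - 1)

theorem contDiffAt_J (μ ν : ℂ) {x : ℝ} (hx : x ≠ 0) :
    ContDiffAt ℝ ((⊤ : ℕ∞) : WithTop ℕ∞) (J μ ν) x := by
  have hsign : ∀ᶠ y : ℝ in 𝓝 x, Real.sign y = Real.sign x := by
    rcases lt_or_gt_of_ne hx with h | h
    · filter_upwards [eventually_lt_nhds h] with y hy
      rw [Real.sign_of_neg hy, Real.sign_of_neg h]
    · filter_upwards [eventually_gt_nhds h] with y hy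
      rw [Real.sign_of_pos hy, Real.sign_of_pos h]
  have hev : J μ ν =ᶠ[𝓝 x] fun y : ℝ => cexp (-(Real.sign x : ℂ) * Real.pi * I * μ / 2) *
      cexp ((Real.log y : ℂ) * (-2 * ν - 1)) := by
    filter_upwards [hsign, eventually_ne_nhds hx] with y hy hy0
    have h0 : ((|y| : ℝ) : ℂ) ≠ 0 := by simpa using hy0
    rw [J, hy, cpow_def_of_ne_zero h0, ← Complex.ofReal_log (abs_nonneg y), Real.log_abs]
  refine ContDiffAt.congr_of_eventuallyEq ?_ hev
  refine contDiffAt_const.mul (ContDiffAt.cexp (ContDiffAt.mul ?_ contDiffAt_const))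
  exact Complex.ofRealCLM.contDiff.contDiffAt.comp x (Real.contDiffAt_log.2 hx)

theorem support_pullback (μ ν : ℂ) (f : TestRx) :
    ∃ a b : ℝ, 0 < a ∧ ∀ x : ℝ, J μ ν x * f (-1 / x) ≠ 0 → a ≤ |x| ∧ |x| ≤ b := by
  obtain ⟨R, hR⟩ := f.hasCompactSupport.isCompact.isBounded.exists_norm_le
  have h0 : (0 : ℝ) ∉ tsupport f := fun h => (f.tsupport_subset h) rfl
  obtain ⟨δ, hδ, hball⟩ := Metric.isOpen_iff.1 (isClosed_tsupport f).isOpen_compl 0 h0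
  have hR' : 0 < max R 1 := lt_max_of_lt_right one_pos
  refine ⟨1 / max R 1, 1 / δ, by positivity, fun x hx => ?_⟩
  have hf : -1 / x ∈ tsupport f := subset_tsupport _ (right_ne_zero_of_mul hx)
  have hx0 : x ≠ 0 := by
    rintro rfl
    exact h0 (by simpa using hf)
  have hxpos : 0 < |x| := abs_pos.2 hx0
  have habs : |-1 / x| = 1 / |x| := by rw [abs_div, abs_neg, abs_one]
  have h1 : 1 / |x| ≤ max R 1 := by
    rw [← habs]
    exact (hR _ hf).trans (le_max_left _ _)
  have h2 : δ ≤ 1 / |x| := by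
    by_contra! hlt
    refine hball (a := -1 / x) ?_ hf
    rw [mem_ball_zero_iff, Real.norm_eq_abs, habs]
    exact hlt
  exact ⟨(one_div_le hR' hxpos).2 h1, (le_one_div hδ hxpos).1 h2⟩

/-- For `f ∈ C₀^∞(ℝ^×)`, the function `f_{μ,ν,∞}(x) = J_{μ,ν}(x) f(-1/x)` in `C₀^∞(ℝ^×)`
(its value at `0` is `0`, because `-1 / 0 = 0` in Lean and `f 0 = 0`). -/
def pullback (μ ν : ℂ) (f : TestRx) : TestRx where
  toFun := fun x => J μ ν x * f (-1 / x)
  contDiff' := by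
    obtain ⟨a, b, ha, hab⟩ := support_pullback μ ν f
    refine contDiff_iff_contDiffAt.2 fun x => ?_
    rcases eq_or_ne x 0 with rfl | hx
    · have hev : (fun x : ℝ => J μ ν x * f (-1 / x)) =ᶠ[𝓝 0] fun _ => (0 : ℂ) := by
        filter_upwards [Metric.ball_mem_nhds (0 : ℝ) ha] with x hx
        by_contra hne
        rw [mem_ball_zero_iff, Real.norm_eq_abs] at hx
        exact absurd (hab x hne).1 (not_le.2 hx)
      exact contDiffAt_const.congr_of_eventuallyEq hev
    · exact (contDiffAt_J μ ν hx).mul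
        (f.contDiff.contDiffAt.comp x (contDiffAt_const.div contDiffAt_id hx))
  hasCompactSupport' := by
    obtain ⟨a, b, ha, hab⟩ := support_pullback μ ν f
    refine HasCompactSupport.intro (isCompact_Icc (a := -b) (b := b)) fun x hx => ?_
    by_contra hne
    exact hx (abs_le.1 (hab x hne).2)
  tsupport_subset' := by
    obtain ⟨a, b, ha, hab⟩ := support_pullback μ ν f
    have hcl : IsClosed {x : ℝ | a ≤ |x|} := isClosed_le continuous_const continuous_abs
    intro x hx
    have hxa : a ≤ |x| := closure_minimal (fun y hy => (hab y hy).1) hcl hx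
    exact fun h0 => by
      have h0' : x = 0 := h0
      rw [h0', abs_zero] at hxa
      exact absurd ha (not_lt.2 hxa)

/-- The pairs of distributions `(T₁, T₂)` with `T₁(f) = T₂(f_{μ,ν,∞})` for `f ∈ C₀^∞(ℝ^×)`. -/
def automorphicPairs (μ ν : ℂ) : Set ((TestR → ℂ) × (TestR → ℂ)) :=
  {T | IsDistribution T.1 ∧ IsDistribution T.2 ∧
    ∀ f : TestRx, T.1 f.toTestR = T.2 (pullback μ ν f).toTestR}

/-- The automorphic pairs of distributions for `(L₁, L₂)` with automorphic factor `J_{μ,ν}`. -/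
def automorphicPairsFor (L₁ L₂ : Set ℝ) (μ ν : ℂ) : Set ((TestR → ℂ) × (TestR → ℂ)) :=
  automorphicPairs μ ν ∩ quasiPeriodic L₁ ×ˢ quasiPeriodic L₂

/-- `ξ_+(α; s) = ∑_{0 < l ∈ L} α(l) / l^s`. -/
def xiPlus {L : Set ℝ} (α : L → ℂ) (s : ℂ) : ℂ :=
  ∑' l : {l : L // 0 < (l : ℝ)}, α l.1 / ((l.1 : ℝ) : ℂ) ^ s

/-- `ξ_-(α; s) = ∑_{0 > l ∈ L} α(l) / |l|^s`. -/
def xiMinus {L : Set ℝ} (α : L → ℂ) (s : ℂ) : ℂ :=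
  ∑' l : {l : L // (l : ℝ) < 0}, α l.1 / ((|(l.1 : ℝ)| : ℝ) : ℂ) ^ s

/-- The column `(Ξ_+(α; s), Ξ_-(α; s))`, with `Ξ_±(α; s) = (2π)^{-s} Γ(s) ξ_±(α; s)`. -/
def completed {L : Set ℝ} (α : L → ℂ) (s : ℂ) : Fin 2 → ℂ :=
  ![(2 * Real.pi : ℂ) ^ (-s) * Complex.Gamma s * xiPlus α s,
    (2 * Real.pi : ℂ) ^ (-s) * Complex.Gamma s * xiMinus α s]

/-- `X` is a meromorphic continuation of `(Ξ_+(α; s), Ξ_-(α; s))` to `ℂ`: both components are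
meromorphic on `ℂ`, and `X` agrees with the defining series on each half-plane
`Re s > r + 1` with `α ∈ 𝔐_r(L)`, away from the poles `0, -1, -2, …` of `Γ`. -/
structure IsMeromorphicContinuation {L : Set ℝ} (α : L → ℂ) (X : ℂ → Fin 2 → ℂ) : Prop where
  meromorphic : ∀ i, Meromorphic fun s => X s i
  eq_completed : ∀ r : ℝ, HasGrowth α r → ∀ s : ℂ, r + 1 < s.re → (∀ n : ℕ, s ≠ -n) →
    X s = completed α s

/-- The matrix `E(s)`. -/
def E (s : ℂ) : Matrix (Fin 2) (Fin 2) ℂ :=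
  !![cexp (Real.pi * I * s / 2), cexp (-Real.pi * I * s / 2);
     cexp (-Real.pi * I * s / 2), cexp (Real.pi * I * s / 2)]

/-- The matrix `Σ_μ`. -/
def Sig (μ : ℂ) : Matrix (Fin 2) (Fin 2) ℂ :=
  !![0, cexp (Real.pi * I * μ / 2); cexp (-Real.pi * I * μ / 2), 0]

open scoped Matrix in
/-- `E(s) X(s) + (a₁ s⁻¹ 1₂ - a₂ (s + 2ν - 1)⁻¹ Σ_μ) (1, 1)ᵗ`. -/
def regularized (μ ν a₁ a₂ : ℂ) (X : ℂ → Fin 2 → ℂ) (s : ℂ) : Fin 2 → ℂ :=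
  E s *ᵥ X s +
    ((a₁ / s) • (1 : Matrix (Fin 2) (Fin 2) ℂ) - (a₂ / (s + 2 * ν - 1)) • Sig μ) *ᵥ ![1, 1]

/-- A function given off a discrete closed set is entire: it coincides there with an entire
function. -/
def IsEntire (F : ℂ → Fin 2 → ℂ) : Prop :=
  ∃ G : ℂ → Fin 2 → ℂ, Differentiable ℂ G ∧ F =ᶠ[codiscrete ℂ] G

open scoped Matrix in
/-- Continuation, polar part and functional equation, where `X₁`, `X₂` are the continued
functions `Ξ_±(α₁; s)`, `Ξ_±(α₂; s)`.
The functional equation is an identity of meromorphic functions, so it is required off a discrete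
closed set. -/
structure AnalyticCondition {L₁ L₂ : Set ℝ} (α₁ : L₁ → ℂ) (α₂ : L₂ → ℂ) (μ ν : ℂ)
    (X₁ X₂ : ℂ → Fin 2 → ℂ) : Prop where
  continuation₁ : IsMeromorphicContinuation α₁ X₁
  continuation₂ : IsMeromorphicContinuation α₂ X₂
  entire : IsEntire (regularized μ ν (valueAtZero α₁) (valueAtZero α₂) X₁)
  functional_equation : (fun s => E s *ᵥ X₁ s) =ᶠ[codiscrete ℂ]
    fun s => Sig μ *ᵥ (E (-s - 2 * ν + 1) *ᵥ X₂ (-s - 2 * ν + 1))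

/-- The filter `|s| → ∞` in the strip `σ₁ ≤ Re s ≤ σ₂`. -/
def stripInfty (σ₁ σ₂ : ℝ) : Filter ℂ :=
  Bornology.cobounded ℂ ⊓ 𝓟 {s : ℂ | σ₁ ≤ s.re ∧ s.re ≤ σ₂}

/-- `X(s) = O(e^{-π|Im s|/2 + √|Im s|})` as `|s| → ∞`, uniformly in every vertical strip. -/
def StripBound (X : ℂ → Fin 2 → ℂ) : Prop :=
  ∀ σ₁ σ₂ : ℝ, σ₁ < σ₂ → ∀ i, (fun s => X s i) =O[stripInfty σ₁ σ₂]
    fun s : ℂ => Real.exp (-Real.pi * |s.im| / 2 + √|s.im|)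

/-- In every vertical strip there is `c₀ > 0` with `X(s) = O(e^{|s|^{c₀}})` as `|s| → ∞`. -/
def WeakStripBound (X : ℂ → Fin 2 → ℂ) : Prop :=
  ∀ σ₁ σ₂ : ℝ, σ₁ < σ₂ → ∃ c₀ : ℝ, 0 < c₀ ∧ ∀ i, (fun s => X s i) =O[stripInfty σ₁ σ₂]
    fun s : ℂ => Real.exp (‖s‖ ^ c₀)

end AutomorphicDistribution

end

/-!
Fourier series that form an automorphic pair correspond to Dirichlet series with a functional
equation.

Everything is tested on `f ∈ C₀^∞(ℝ^×)`. For `t > 0` let `tailSum α f t = ∑_{l ≠ 0} α(l) 𝓕f(l t)`.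
The dilate of `f` by `t` turns the relation `T_{α₁}(f) = T_{α₂}(f_{μ,ν,∞})` into a theta-type
inversion formula between `tailSum α₁ f t` and `tailSum α₂ f_{μ,ν,∞} t⁻¹` (`tailSum_inversion`).
On the other hand the local functional equation of the Fourier transform (`mellin_fourier`) shows
that, for large `Re s`, the Mellin transform of the tail sum is `pair f (1 - s) (E(s) Ξ(α; s))`,
where `pair f w v = v_+ ∫_0^∞ x^{w-1} f(x) dx + v_- ∫_0^∞ x^{w-1} f(-x) dx` (`mellin_tailSum`). The
involution `f ↦ f_{μ,ν,∞}` acts on pairings through `Σ_μ` (`pair_pullback`).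

For the direct part, adding the polar terms on `(0, 1]` makes the tail sum decay rapidly at both
ends, so its Mellin transform is entire and symmetric under `s ↦ 1 - 2ν - s`
(`differentiable_mellin_modTail`, `mellin_modTail_symm`). This holds for every `f`; the coefficients
of the pairing are extracted with the test functions `|x|^s φ(x)`, where `φ` lives on one half-line
and the exponent moves with the argument. They move the point `1 - s` to the point `1`, at which the
Mellin transform of `φ` does not vanish. Hence the coefficients are entire
(`exists_entire_column`), and they have polynomial growth in vertical strips, because the Fourier
transform of `|x|^s φ` is bounded polynomially in `s` (`exists_norm_mellin_modTail_twist_le`).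
Inverting `E(s)`, whose determinant has size `e^{π|Im s|}`, gives the continuation and a bound
stronger than the one asserted (`exists_analyticCondition`).

For the converse, each of the two series converges absolutely on one of two distant vertical lines
`Re s = ± b`, so the pairings with the entire regularization of `E(s) Ξ(α₁; s)` are bounded on these
lines, and the Phragmén–Lindelöf principle bounds them in between
(`norm_pair_le_of_weakStripBound`). Replacing `f` by `(x f)'` multiplies the pairing by `s`, so
boundedness for all `f` is decay for each `f` (`subPolarPairing_decay`). Mellin inversion on the two
lines recovers the two tail sums at `t = 1`. The contour shift between the lines crosses the poles
at `0` and `1 - 2ν`, whose residues are, up to sign, the terms of `T_{α₁}(f)` and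
`T_{α₂}(f_{μ,ν,∞})` at `l = 0` (`integral_vertical_sub_eq`,
`fourierSeries_eq_fourierSeries_pullback`).
-/

noncomputable section

namespace AutomorphicDistribution

open MeasureTheory Set
open scoped Matrix

/-! ### Operations on test functions -/

theorem TestRx.eventually_eq_zero (f : TestRx) : ∀ᶠ x : ℝ in 𝓝 0, f x = 0 := by
  have h0 : (0 : ℝ) ∉ tsupport f := fun h => (f.tsupport_subset h) rfl
  exact notMem_tsupport_iff_eventuallyEq.1 h0

theorem TestRx.apply_zero (f : TestRx) : f 0 = 0 := f.eventually_eq_zero.self_of_nhds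

theorem TestR.integrable (f : TestR) : Integrable f :=
  f.continuous.integrable_of_hasCompactSupport f.hasCompactSupport

theorem TestRx.integrable (f : TestRx) : Integrable f :=
  f.continuous.integrable_of_hasCompactSupport f.hasCompactSupport

/-- The product of `f ∈ C₀^∞(ℝ^×)` with a function that is smooth off the origin. -/
def mulRx (g : ℝ → ℂ) (hg : ∀ x : ℝ, x ≠ 0 → ContDiffAt ℝ ((⊤ : ℕ∞) : WithTop ℕ∞) g x)
    (f : TestRx) : TestRx where
  toFun := fun x => g x * f x
  contDiff' := by
    refine contDiff_iff_contDiffAt.2 fun x => ?_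
    rcases eq_or_ne x 0 with rfl | hx
    · refine (contDiffAt_const (c := (0 : ℂ))).congr_of_eventuallyEq ?_
      filter_upwards [f.eventually_eq_zero] with x hx
      simp [hx]
    · exact (hg x hx).mul f.contDiff.contDiffAt
  hasCompactSupport' := f.hasCompactSupport.mul_left
  tsupport_subset' := (tsupport_mul_subset_right).trans f.tsupport_subset

theorem contDiffAt_ofReal_fun (x : ℝ) :
    ContDiffAt ℝ ((⊤ : ℕ∞) : WithTop ℕ∞) (fun y : ℝ => (y : ℂ)) x :=
  Complex.ofRealCLM.contDiff.contDiffAt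

/-- The product `|x|^s f(x)`. Since `Real.log x = log |x|`, the factor is written
`exp (s log x)`. -/
def twist (s : ℂ) (f : TestRx) : TestRx :=
  mulRx (fun x => cexp ((Real.log x : ℂ) * s)) (fun x hx =>
    ContDiffAt.cexp ((Complex.ofRealCLM.contDiff.contDiffAt.comp x
      (Real.contDiffAt_log.2 hx)).mul contDiffAt_const)) f

theorem twist_apply (s : ℂ) (f : TestRx) (x : ℝ) :
    twist s f x = cexp ((Real.log x : ℂ) * s) * f x := rfl

/-- The product `x⁻¹ f(x)`. -/
def divX (f : TestRx) : TestRx :=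
  mulRx (fun x => (x : ℂ)⁻¹) (fun x hx => (contDiffAt_ofReal_fun x).inv (by simpa using hx)) f

theorem divX_apply (f : TestRx) (x : ℝ) : divX f x = (x : ℂ)⁻¹ * f x := rfl

/-- The product `x f(x)`. -/
def mulX (f : TestRx) : TestRx :=
  mulRx (fun x => (x : ℂ)) (fun x _ => contDiffAt_ofReal_fun x) f

theorem mulX_apply (f : TestRx) (x : ℝ) : mulX f x = (x : ℂ) * f x := rfl

/-- The derivative of a test function on `ℝ`. -/
def derivR (f : TestR) : TestR where
  toFun := deriv f
  contDiff' := ((contDiff_infty_iff_deriv (𝕜 := ℝ)).1 f.contDiff).2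
  hasCompactSupport' := f.hasCompactSupport.deriv
  tsupport_subset' := fun _ _ => trivial

/-- The derivative of a test function on `ℝ^×`. -/
def derivRx (f : TestRx) : TestRx where
  toFun := deriv f
  contDiff' := ((contDiff_infty_iff_deriv (𝕜 := ℝ)).1 f.contDiff).2
  hasCompactSupport' := f.hasCompactSupport.deriv
  tsupport_subset' := (tsupport_deriv_subset).trans f.tsupport_subset

theorem derivRx_apply (f : TestRx) (x : ℝ) : derivRx f x = deriv f x := rfl

theorem TestR.differentiable (f : TestR) : Differentiable ℝ f :=
  f.contDiff.differentiable (by simp)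

theorem TestRx.differentiable (f : TestRx) : Differentiable ℝ f :=
  f.contDiff.differentiable (by simp)

@[simp] theorem toTestR_apply (f : TestRx) (x : ℝ) : f.toTestR x = f x := rfl

/-- The dilate `x ↦ f (x / t)`, where `t ≠ 0`. -/
def dilate (t : ℝ) (ht : t ≠ 0) (f : TestRx) : TestRx where
  toFun := fun x => f (x / t)
  contDiff' := f.contDiff.comp (contDiff_id.div_const t)
  hasCompactSupport' := by
    have := f.hasCompactSupport.comp_homeomorph (Homeomorph.mulRight₀ t⁻¹ (inv_ne_zero ht))
    exact this
  tsupport_subset' := by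
    have h : tsupport (fun x => f (x / t)) ⊆ (fun x => x / t) ⁻¹' tsupport f :=
      tsupport_comp_subset_preimage f (f := fun x : ℝ => x / t) (by fun_prop)
    intro x hx h0
    have h0' : x = 0 := h0
    have := f.tsupport_subset (h hx)
    exact this (by simp [h0'])

theorem dilate_apply (t : ℝ) (ht : t ≠ 0) (f : TestRx) (x : ℝ) : dilate t ht f x = f (x / t) := rfl

/-! ### Fourier transforms of test functions -/

theorem norm_fourier_kernel (x y : ℝ) : ‖cexp (2 * Real.pi * I * x * y)‖ = 1 := by
  have : (2 * Real.pi * I * x * y : ℂ) = ((2 * Real.pi * x * y : ℝ) : ℂ) * I := by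
    push_cast; ring
  rw [this, Complex.norm_exp_ofReal_mul_I]

theorem integrable_fourier (f : TestR) (y : ℝ) :
    Integrable fun x : ℝ => f x * cexp (2 * Real.pi * I * x * y) := by
  refine f.integrable.mono ?_ ?_
  · have := f.continuous
    exact Continuous.aestronglyMeasurable (by fun_prop)
  · exact Eventually.of_forall fun x => by simp [norm_fourier_kernel]

theorem norm_fourier_le (f : TestR) (y : ℝ) : ‖fourier f y‖ ≤ ∫ x, ‖f x‖ := by
  refine (norm_integral_le_integral_norm _).trans_eq ?_
  simp [norm_fourier_kernel]

theorem continuous_fourier (f : TestR) : Continuous (fourier f) := by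
  refine continuous_of_dominated (bound := fun x => ‖f x‖) (fun y => ?_) (fun y => ?_) f.integrable.norm ?_
  · exact (integrable_fourier f y).aestronglyMeasurable
  · exact Eventually.of_forall fun x => by simp [norm_fourier_kernel]
  · exact Eventually.of_forall fun x => by fun_prop

theorem fourier_add (f g : TestR) (y : ℝ) : fourier (f + g) y = fourier f y + fourier g y := by
  rw [fourier, fourier, fourier, ← integral_add (integrable_fourier f y) (integrable_fourier g y)]
  refine integral_congr_ae (Eventually.of_forall fun x => ?_)
  change (f x + g x) * _ = _
  ring

theorem fourier_smul (c : ℂ) (f : TestR) (y : ℝ) : fourier (c • f) y = c * fourier f y := by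
  rw [fourier, fourier, ← integral_const_mul]
  refine integral_congr_ae (Eventually.of_forall fun x => ?_)
  change (c • f x) * _ = _
  rw [smul_eq_mul]; ring

theorem fourier_derivR (f : TestR) (y : ℝ) :
    fourier (derivR f) y = -(2 * Real.pi * I * y) * fourier f y := by
  have hv : ∀ x : ℝ, HasDerivAt (fun x : ℝ => cexp (2 * Real.pi * I * x * y))
      (cexp (2 * Real.pi * I * x * y) * (2 * Real.pi * I * y)) x := fun x => by
    have h1 : HasDerivAt (fun z : ℂ => 2 * Real.pi * I * z * y) (2 * Real.pi * I * y) (x : ℂ) := by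
      simpa using ((hasDerivAt_id (x : ℂ)).const_mul (2 * Real.pi * I)).mul_const (y : ℂ)
    exact h1.cexp.comp_ofReal
  have key := integral_mul_deriv_eq_deriv_mul_of_integrable (u := fun x : ℝ => f x)
    (v := fun x : ℝ => cexp (2 * Real.pi * I * x * y))
    (u' := fun x => deriv f x)
    (v' := fun x => cexp (2 * Real.pi * I * x * y) * (2 * Real.pi * I * y))
    (fun x _ => (f.differentiable x).hasDerivAt) (fun x _ => hv x) ?_ (integrable_fourier (derivR f) y)
    (integrable_fourier f y)
  · rw [fourier, fourier, ← integral_const_mul]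
    have h2 : ∫ x : ℝ, (derivR f) x * cexp (2 * Real.pi * I * x * y) =
      -∫ x : ℝ, f x * (cexp (2 * Real.pi * I * x * y) * (2 * Real.pi * I * y)) := by
      rw [key, neg_neg]; rfl
    rw [h2, ← integral_neg]
    refine integral_congr_ae (Eventually.of_forall fun x => ?_)
    simp only
    ring
  · have := (integrable_fourier f y).mul_const (2 * Real.pi * I * y)
    refine this.congr (Eventually.of_forall fun x => ?_)
    simp only [Pi.mul_apply]
    ring

/-- One integration by parts gains a factor `|y|`. -/
theorem abs_mul_norm_fourier_le (f : TestR) (y : ℝ) :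
    |y| * ‖fourier f y‖ ≤ ‖fourier (derivR f) y‖ := by
  rw [fourier_derivR, norm_mul]
  have : ‖-(2 * Real.pi * I * y : ℂ)‖ = 2 * Real.pi * |y| := by
    simp [abs_of_pos Real.pi_pos]
  rw [this]
  have h1 : 1 ≤ 2 * Real.pi := by linarith [Real.pi_gt_three]
  have : 1 * |y| ≤ 2 * Real.pi * |y| := by gcongr
  rw [one_mul] at this
  gcongr

theorem abs_pow_mul_norm_fourier_le (k : ℕ) (f : TestR) (y : ℝ) :
    |y| ^ k * ‖fourier f y‖ ≤ ∫ x, ‖iteratedDeriv k f x‖ := by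
  induction k generalizing f with
  | zero => simpa using norm_fourier_le f y
  | succ k ih =>
    rw [iteratedDeriv_succ']
    calc |y| ^ (k + 1) * ‖fourier f y‖ = |y| ^ k * (|y| * ‖fourier f y‖) := by ring
      _ ≤ |y| ^ k * ‖fourier (derivR f) y‖ := by gcongr; exact abs_mul_norm_fourier_le f y
      _ ≤ _ := ih (derivR f)

theorem hasDerivAt_twist (s : ℂ) (f : TestRx) (x : ℝ) :
    HasDerivAt (twist s f) (s * twist s (divX f) x + twist s (derivRx f) x) x := by
  rcases eq_or_ne x 0 with rfl | hx
  · rw [TestRx.apply_zero, TestRx.apply_zero, mul_zero, zero_add]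
    exact (hasDerivAt_const (0 : ℝ) (0 : ℂ)).congr_of_eventuallyEq (twist s f).eventually_eq_zero
  · have h1 : HasDerivAt (fun x : ℝ => cexp ((Real.log x : ℂ) * s))
        (cexp ((Real.log x : ℂ) * s) * (((x⁻¹ : ℝ) : ℂ) * s)) x :=
      ((Real.hasDerivAt_log hx).ofReal_comp.mul_const s).cexp
    have h2 := h1.mul (f.differentiable x).hasDerivAt
    refine h2.congr_deriv ?_
    rw [twist_apply, twist_apply, divX_apply, derivRx_apply]
    push_cast
    ring

theorem derivR_twist (s : ℂ) (f : TestRx) :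
    derivR (twist s f).toTestR = s • (twist s (divX f)).toTestR + (twist s (derivRx f)).toTestR := by
  ext x
  exact (hasDerivAt_twist s f x).deriv

/-- The Fourier transform of `|x|^s φ(x)` decays faster than any power, with constants that are
polynomial in `s` on vertical strips. -/
theorem exists_fourier_twist_le (k : ℕ) (φ : TestRx) (a b : ℝ) :
    ∃ C : ℝ, 0 ≤ C ∧ ∀ s : ℂ, a ≤ s.re → s.re ≤ b → ∀ y : ℝ,
      |y| ^ k * ‖fourier (twist s φ).toTestR y‖ ≤ C * (1 + ‖s‖) ^ k := by
  induction k generalizing φ with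
  | zero =>
    refine ⟨(∫ x, ‖twist a φ x‖) + ∫ x, ‖twist b φ x‖,
      add_nonneg (integral_nonneg fun x => norm_nonneg _) (integral_nonneg fun x => norm_nonneg _),
      fun s hsa hsb y => ?_⟩
    simp only [pow_zero, one_mul, mul_one]
    refine (norm_fourier_le _ y).trans ?_
    rw [← integral_add (twist a φ).integrable.norm (twist b φ).integrable.norm]
    refine integral_mono (twist s φ).integrable.norm
      ((twist a φ).integrable.norm.add (twist b φ).integrable.norm) fun x => ?_
    simp only [toTestR_apply, twist_apply, norm_mul, Complex.norm_exp]
    rw [← add_mul]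
    refine mul_le_mul_of_nonneg_right ?_ (norm_nonneg (φ x))
    simp only [Complex.re_ofReal_mul, ofReal_re]
    rcases le_total 0 (Real.log x) with h | h
    · have : Real.exp (Real.log x * s.re) ≤ Real.exp (Real.log x * b) := by gcongr
      linarith [Real.exp_pos (Real.log x * a)]
    · have : Real.exp (Real.log x * s.re) ≤ Real.exp (Real.log x * a) :=
        Real.exp_le_exp.2 (mul_le_mul_of_nonpos_left hsa h)
      linarith [Real.exp_pos (Real.log x * b)]
  | succ k ih =>
    obtain ⟨C₁, hC₁, h₁⟩ := ih (divX φ)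
    obtain ⟨C₂, hC₂, h₂⟩ := ih (derivRx φ)
    refine ⟨C₁ + C₂, by positivity, fun s hsa hsb y => ?_⟩
    have hs : 0 ≤ ‖s‖ := norm_nonneg s
    calc |y| ^ (k + 1) * ‖fourier (twist s φ).toTestR y‖
        = |y| ^ k * (|y| * ‖fourier (twist s φ).toTestR y‖) := by ring
      _ ≤ |y| ^ k * ‖fourier (derivR (twist s φ).toTestR) y‖ := by
        gcongr; exact abs_mul_norm_fourier_le _ y
      _ ≤ |y| ^ k * (‖s‖ * ‖fourier (twist s (divX φ)).toTestR y‖ +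
            ‖fourier (twist s (derivRx φ)).toTestR y‖) := by
        gcongr
        rw [derivR_twist, fourier_add, fourier_smul, ← norm_mul]
        exact norm_add_le _ _
      _ = ‖s‖ * (|y| ^ k * ‖fourier (twist s (divX φ)).toTestR y‖) +
            |y| ^ k * ‖fourier (twist s (derivRx φ)).toTestR y‖ := by ring
      _ ≤ ‖s‖ * (C₁ * (1 + ‖s‖) ^ k) + C₂ * (1 + ‖s‖) ^ k := by
        exact add_le_add (mul_le_mul_of_nonneg_left (h₁ s hsa hsb y) hs) (h₂ s hsa hsb y)
      _ ≤ (1 + ‖s‖) * (C₁ * (1 + ‖s‖) ^ k) + (1 + ‖s‖) * (C₂ * (1 + ‖s‖) ^ k) := by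
        have hp : 0 ≤ (1 + ‖s‖) ^ k := by positivity
        nlinarith [mul_nonneg hC₁ hp, mul_nonneg hs (mul_nonneg hC₂ hp)]
      _ = (C₁ + C₂) * (1 + ‖s‖) ^ (k + 1) := by ring

theorem exists_fourier_le (k : ℕ) (f : TestR) :
    ∃ C : ℝ, 0 ≤ C ∧ ∀ y : ℝ, |y| ^ k * ‖fourier f y‖ ≤ C :=
  ⟨∫ x, ‖iteratedDeriv k f x‖, by positivity, abs_pow_mul_norm_fourier_le k f⟩

theorem fourier_shift (t : ℝ) (f : TestR) (y : ℝ) :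
    fourier (shift t f) y = cexp (-(2 * Real.pi * I * t * y)) * fourier f y := by
  rw [fourier, fourier, ← integral_const_mul,
    ← integral_add_right_eq_self (fun x : ℝ => cexp (-(2 * Real.pi * I * t * y)) *
      (f x * cexp (2 * Real.pi * I * x * y))) t]
  refine integral_congr_ae (Eventually.of_forall fun x => ?_)
  change f (x + t) * _ = _
  have : cexp (2 * Real.pi * I * x * y) =
      cexp (-(2 * Real.pi * I * t * y)) * cexp (2 * Real.pi * I * (x + t : ℝ) * y) := by
    rw [← Complex.exp_add]; congr 1; push_cast; ring
  rw [this]; ring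

theorem fourier_dilate {t : ℝ} (ht : 0 < t) (f : TestRx) (y : ℝ) :
    fourier (dilate t ht.ne' f).toTestR y = t * fourier f.toTestR (t * y) := by
  rw [fourier, fourier]
  have h := Measure.integral_comp_div (fun x : ℝ => f x * cexp (2 * Real.pi * I * x * (t * y : ℝ))) t
  rw [abs_of_pos ht] at h
  rw [← Complex.real_smul]
  refine Eq.trans ?_ h
  refine integral_congr_ae (Eventually.of_forall fun x => ?_)
  have ht' : (t : ℂ) ≠ 0 := by exact_mod_cast ht.ne'
  change f (x / t) * _ = f (x / t) * _
  congr 2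
  push_cast
  field_simp

/-! ### Sums over shifted lattices -/

section Lattice

variable {L : Set ℝ}

theorem IsShiftedLattice.exists_equiv (hL : IsShiftedLattice L) :
    ∃ u₁ u₂ : ℝ, u₂ ≠ 0 ∧ ∃ e : ℤ ≃ L, ∀ n, ((e n : L) : ℝ) = u₁ + u₂ * n := by
  obtain ⟨u₁, u₂, hu, rfl⟩ := hL
  refine ⟨u₁, u₂, hu, Equiv.ofBijective (fun n => ⟨u₁ + u₂ * n, n, rfl⟩) ⟨fun m n h => ?_, ?_⟩,
    fun n => rfl⟩
  · have := congrArg Subtype.val h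
    simpa [hu] using this
  · rintro ⟨_, n, rfl⟩
    exact ⟨n, rfl⟩

theorem IsShiftedLattice.summable_rpow (hL : IsShiftedLattice L) {p : ℝ} (hp : p < -1) :
    Summable fun l : L => |(l : ℝ)| ^ p := by
  obtain ⟨u₁, u₂, hu, e, he⟩ := hL.exists_equiv
  rw [← e.summable_iff]
  have h := ((Real.summable_one_div_int_add_rpow (u₁ / u₂) (-p)).2 (by linarith)).mul_left (|u₂| ^ p)
  refine h.congr fun n => ?_
  have h1 : u₁ + u₂ * n = u₂ * (n + u₁ / u₂) := by field_simp; ring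
  rw [Function.comp_apply, he, h1, abs_mul, Real.mul_rpow (abs_nonneg _) (abs_nonneg _),
    Real.rpow_neg (abs_nonneg _), one_div, inv_inv]

theorem IsShiftedLattice.tendsto_abs (hL : IsShiftedLattice L) :
    Tendsto (fun l : L => |(l : ℝ)|) cofinite atTop := by
  obtain ⟨u₁, u₂, hu, e, he⟩ := hL.exists_equiv
  have h1 : Tendsto (fun n : ℤ => u₁ + u₂ * n) cofinite (cocompact ℝ) :=
    (((Homeomorph.mulLeft₀ u₂ hu).trans (Homeomorph.addLeft u₁)).isClosedEmbedding.tendsto_cocompact).comp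
      Int.tendsto_coe_cofinite
  have h2 : Tendsto (fun n : ℤ => |u₁ + u₂ * n|) cofinite atTop :=
    (tendsto_norm_cocompact_atTop (E := ℝ)).comp h1
  have h3 : Tendsto (e.symm : L → ℤ) cofinite cofinite := e.symm.injective.tendsto_cofinite
  refine (h2.comp h3).congr fun l => ?_
  rw [Function.comp_apply, ← he, e.apply_symm_apply]

/-- The coefficient function `α` with its value at `0` replaced by `0`. -/
def offZero (α : L → ℂ) (l : L) : ℂ := if (l : ℝ) = 0 then 0 else α l

theorem offZero_of_eq {α : L → ℂ} {l : L} (h : (l : ℝ) = 0) : offZero α l = 0 := if_pos h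

theorem offZero_of_ne {α : L → ℂ} {l : L} (h : (l : ℝ) ≠ 0) : offZero α l = α l := if_neg h

/-- On a shifted lattice the asymptotic growth condition is a bound at every nonzero point. -/
theorem HasGrowth.exists_offZero_le (hL : IsShiftedLattice L) {α : L → ℂ} {r : ℝ}
    (h : HasGrowth α r) : ∃ C : ℝ, 0 ≤ C ∧ ∀ l : L, ‖offZero α l‖ ≤ C * |(l : ℝ)| ^ r := by
  have h1 : α =O[cofinite] fun l : L => |(l : ℝ)| ^ r :=
    IsBigO.mono h (tendsto_iff_comap.1 hL.tendsto_abs)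
  have h2 : offZero α =O[cofinite] fun l : L => |(l : ℝ)| ^ r := by
    refine IsBigO.trans (IsBigO.of_bound 1 (Eventually.of_forall fun l => ?_)) h1
    unfold offZero
    split_ifs <;> simp
  rw [isBigO_cofinite_iff] at h2
  · obtain ⟨C, hC⟩ := h2
    refine ⟨max C 0, le_max_right _ _, fun l => (hC l).trans ?_⟩
    have h0 : 0 ≤ |(l : ℝ)| ^ r := Real.rpow_nonneg (abs_nonneg _) _
    rw [Real.norm_of_nonneg h0]
    exact mul_le_mul_of_nonneg_right (le_max_left _ _) h0
  · intro l hl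
    by_contra hne
    have hl0 : (l : ℝ) ≠ 0 := fun h => hne (offZero_of_eq h)
    exact (Real.rpow_pos_of_pos (abs_pos.2 hl0) r).ne' hl

/-- The sum `∑_{0 ≠ l ∈ L} α(l) 𝓕f(l t)`. -/
def tailSum (α : L → ℂ) (f : TestR) (t : ℝ) : ℂ := ∑' l : L, offZero α l * fourier f (l * t)

theorem norm_tailSum_term_le {α : L → ℂ} {r C D : ℝ} {k : ℕ} (hC0 : 0 ≤ C)
    (hC : ∀ l : L, ‖offZero α l‖ ≤ C * |(l : ℝ)| ^ r) {f : TestR}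
    (hD : ∀ y : ℝ, |y| ^ k * ‖fourier f y‖ ≤ D) {t : ℝ} (ht : 0 < t) (l : L) :
    ‖offZero α l * fourier f (l * t)‖ ≤ C * D * t ^ (-(k : ℝ)) * |(l : ℝ)| ^ (r - k) := by
  have hD0 : 0 ≤ D := le_trans (by positivity) (hD 0)
  by_cases hl : (l : ℝ) = 0
  · rw [offZero_of_eq hl, zero_mul, norm_zero]
    exact mul_nonneg (by positivity) (Real.rpow_nonneg (abs_nonneg _) _)
  · have hl' : 0 < |(l : ℝ)| := abs_pos.2 hl
    have h1 := hD (l * t)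
    rw [abs_mul, abs_of_pos ht, mul_pow] at h1
    have h2 : ‖fourier f (l * t)‖ ≤ D * (|(l : ℝ)| ^ k * t ^ k)⁻¹ := by
      rw [← div_eq_mul_inv, le_div_iff₀ (by positivity), mul_comm]
      exact h1
    rw [norm_mul]
    refine (mul_le_mul (hC l) h2 (norm_nonneg _) (by positivity)).trans_eq ?_
    rw [Real.rpow_neg ht.le, Real.rpow_sub hl', Real.rpow_natCast, Real.rpow_natCast]
    field_simp

theorem summable_tailSum (hL : IsShiftedLattice L) {α : L → ℂ} {r : ℝ} (h : HasGrowth α r)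
    (f : TestR) {t : ℝ} (ht : 0 < t) :
    Summable fun l : L => offZero α l * fourier f (l * t) := by
  obtain ⟨C, hC0, hC⟩ := h.exists_offZero_le hL
  obtain ⟨k, hk⟩ := exists_nat_gt (r + 1)
  obtain ⟨D, -, hD⟩ := exists_fourier_le k f
  refine Summable.of_norm_bounded
    ((hL.summable_rpow (p := r - k) (by linarith)).mul_left (C * D * t ^ (-(k : ℝ)))) fun l => ?_
  exact norm_tailSum_term_le hC0 hC hD ht l

/-- Decay of the tail sum, with a constant that depends on `f` only through a decay constant of
its Fourier transform. -/
theorem exists_norm_tailSum_le (hL : IsShiftedLattice L) {α : L → ℂ} {r : ℝ} (h : HasGrowth α r)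
    {k : ℕ} (hk : r + 1 < k) :
    ∃ C : ℝ, 0 ≤ C ∧ ∀ (f : TestR) (D : ℝ), (∀ y : ℝ, |y| ^ k * ‖fourier f y‖ ≤ D) →
      ∀ t : ℝ, 0 < t → ‖tailSum α f t‖ ≤ C * D * t ^ (-(k : ℝ)) := by
  obtain ⟨C, hC0, hC⟩ := h.exists_offZero_le hL
  have hs := hL.summable_rpow (p := r - k) (by linarith)
  have hs0 : 0 ≤ ∑' l : L, |(l : ℝ)| ^ (r - k) := tsum_nonneg fun l => by positivity
  refine ⟨C * ∑' l : L, |(l : ℝ)| ^ (r - k), by positivity, fun f D hD t ht => ?_⟩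
  refine (tsum_of_norm_bounded (hs.mul_left (C * D * t ^ (-(k : ℝ)))).hasSum
    (norm_tailSum_term_le hC0 hC hD ht)).trans_eq ?_
  rw [tsum_mul_left]
  ring

theorem continuousOn_tailSum (hL : IsShiftedLattice L) {α : L → ℂ} {r : ℝ} (h : HasGrowth α r)
    (f : TestR) : ContinuousOn (tailSum α f) (Ioi 0) := by
  obtain ⟨C, hC0, hC⟩ := h.exists_offZero_le hL
  obtain ⟨k, hk⟩ := exists_nat_gt (r + 1)
  obtain ⟨D, hD0, hD⟩ := exists_fourier_le k f
  refine continuousOn_of_forall_continuousAt fun t₀ ht₀ => ?_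
  have ht₀' : 0 < t₀ := ht₀
  have hcont : ContinuousOn (tailSum α f) (Ioi (t₀ / 2)) := by
    refine continuousOn_tsum (fun l => ?_)
      ((hL.summable_rpow (p := r - k) (by linarith)).mul_left (C * D * (t₀ / 2) ^ (-(k : ℝ))))
      fun l t ht => ?_
    · exact (continuous_const.mul ((continuous_fourier f).comp
        (continuous_const.mul continuous_id))).continuousOn
    · have ht' : t₀ / 2 < t := ht
      refine (norm_tailSum_term_le hC0 hC hD (by linarith) l).trans ?_
      have : t ^ (-(k : ℝ)) ≤ (t₀ / 2) ^ (-(k : ℝ)) :=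
        Real.rpow_le_rpow_of_nonpos (by linarith) ht'.le (by simp)
      gcongr
  exact hcont.continuousAt (Ioi_mem_nhds (by linarith))

theorem summable_fourierSeries (hL : IsShiftedLattice L) {α : L → ℂ} {r : ℝ} (h : HasGrowth α r)
    (f : TestR) : Summable fun l : L => α l * fourier f l := by
  have h1 := summable_tailSum hL h f one_pos
  by_cases h0 : (0 : ℝ) ∈ L
  · have h2 : Summable fun l : L => if l = ⟨0, h0⟩ then α ⟨0, h0⟩ * fourier f 0 else 0 :=
      (hasSum_ite_eq (⟨0, h0⟩ : L) (α ⟨0, h0⟩ * fourier f 0)).summable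
    refine (h1.add h2).congr fun l => ?_
    by_cases hl : (l : ℝ) = 0
    · have : l = ⟨0, h0⟩ := Subtype.ext hl
      subst this
      simp [offZero]
    · have : l ≠ ⟨0, h0⟩ := fun h => hl (congrArg Subtype.val h)
      simp [offZero, hl, this]
  · refine h1.congr fun l => ?_
    have hl : (l : ℝ) ≠ 0 := fun h => h0 (h ▸ l.2)
    simp [offZero, hl]

theorem fourierSeries_eq (hL : IsShiftedLattice L) {α : L → ℂ} {r : ℝ} (h : HasGrowth α r)
    (f : TestR) : fourierSeries α f = valueAtZero α * fourier f 0 + tailSum α f 1 := by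
  have h1 := summable_tailSum hL h f one_pos
  unfold fourierSeries tailSum valueAtZero
  split_ifs with h0
  · have h2 := hasSum_ite_eq (⟨0, h0⟩ : L) (α ⟨0, h0⟩ * fourier f 0)
    rw [← h2.tsum_eq, ← h2.summable.tsum_add h1]
    refine tsum_congr fun l => ?_
    by_cases hl : (l : ℝ) = 0
    · have : l = ⟨0, h0⟩ := Subtype.ext hl
      subst this
      simp [offZero]
    · have : l ≠ ⟨0, h0⟩ := fun h => hl (congrArg Subtype.val h)
      simp [offZero, hl, this]
  · rw [zero_mul, zero_add]
    refine tsum_congr fun l => ?_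
    have hl : (l : ℝ) ≠ 0 := fun h => h0 (h ▸ l.2)
    simp [offZero, hl]

theorem fourierSeries_dilate (hL : IsShiftedLattice L) {α : L → ℂ} {r : ℝ} (h : HasGrowth α r)
    (f : TestRx) {t : ℝ} (ht : 0 < t) :
    fourierSeries α (dilate t ht.ne' f).toTestR =
      t * (valueAtZero α * fourier f.toTestR 0 + tailSum α f.toTestR t) := by
  rw [fourierSeries_eq hL h, fourier_dilate ht, mul_zero, mul_add, tailSum, tailSum, ← tsum_mul_left]
  congr 1
  · ring
  · refine tsum_congr fun l => ?_
    rw [fourier_dilate ht, mul_one, mul_comm t]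
    ring

/-! ### Fourier series as quasi-periodic distributions -/

theorem isDistribution_fourierSeries (hL : IsShiftedLattice L) {α : L → ℂ} {r : ℝ}
    (h : HasGrowth α r) : IsDistribution (fourierSeries α) where
  linear := by
    refine ⟨fun f g => ?_, fun c f => ?_⟩
    · unfold fourierSeries
      rw [← (summable_fourierSeries hL h f).tsum_add (summable_fourierSeries hL h g)]
      exact tsum_congr fun l => by rw [fourier_add, mul_add]
    · unfold fourierSeries
      rw [smul_eq_mul, ← tsum_mul_left]
      exact tsum_congr fun l => by rw [fourier_smul]; ring
  bound := by
    intro u hu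
    obtain ⟨k, hk⟩ := exists_nat_gt (r + 1)
    obtain ⟨C, hC0, hC⟩ := exists_norm_tailSum_le hL h hk
    refine ⟨k, (‖valueAtZero α‖ + C + 1) * (2 * u), by positivity, fun f hf => ?_⟩
    set S := ∑ i ∈ Finset.range (k + 1), ⨆ x : ℝ, ‖iteratedDeriv i f x‖ with hS
    have hbdd : ∀ i : ℕ, BddAbove (range fun x : ℝ => ‖iteratedDeriv i f x‖) := fun i => by
      have hc : Continuous (iteratedDeriv i f) :=
        f.contDiff.continuous_iteratedDeriv i (by exact_mod_cast le_top)
      have hcs : HasCompactSupport (iteratedDeriv i f) := by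
        induction i with
        | zero => simpa using f.hasCompactSupport
        | succ i ih =>
          rw [iteratedDeriv_succ]
          exact (ih (f.contDiff.continuous_iteratedDeriv i (by exact_mod_cast le_top))).deriv
      obtain ⟨B, hB⟩ := hc.bounded_above_of_compact_support hcs
      exact ⟨B, by rintro _ ⟨x, rfl⟩; exact hB x⟩
    have hnn : ∀ i : ℕ, 0 ≤ ⨆ x : ℝ, ‖iteratedDeriv i f x‖ := fun i =>
      Real.iSup_nonneg fun x => norm_nonneg _
    -- Derivatives vanish off `[-u, u]`, so each `L¹` norm is at most `2u` times the sup norm.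
    have hint : ∀ i : ℕ, i ≤ k → ∫ x, ‖iteratedDeriv i f x‖ ≤ 2 * u * S := fun i hi => by
      have hsupp : ∀ x, x ∉ Icc (-u) u → ‖iteratedDeriv i f x‖ = 0 := fun x hx => by
        rw [norm_eq_zero]
        have hx' : x ∉ tsupport f := fun h => hx (abs_le.1 (hf h))
        rw [iteratedDeriv_eq_iteratedFDeriv]
        have : iteratedFDeriv ℝ i f x = 0 := by
          by_contra hne
          exact hx' (support_iteratedFDeriv_subset i hne)
        rw [this]; rfl
      rw [← setIntegral_eq_integral_of_forall_compl_eq_zero (s := Icc (-u) u) hsupp]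
      have h1 : ∀ x ∈ Icc (-u) u, ‖‖iteratedDeriv i f x‖‖ ≤ S := fun x _ => by
        rw [norm_norm]
        refine (le_ciSup (hbdd i) x).trans ?_
        exact Finset.single_le_sum (f := fun i => ⨆ x : ℝ, ‖iteratedDeriv i f x‖)
          (fun i _ => hnn i) (Finset.mem_range.2 (by omega))
      have h2 := norm_setIntegral_le_of_norm_le_const (μ := volume) (s := Icc (-u) u) (by simp) h1
      refine (le_abs_self _).trans (h2.trans_eq ?_)
      rw [measureReal_def, Real.volume_Icc, ENNReal.toReal_ofReal (by linarith)]
      ring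
    have hS0 : 0 ≤ S := Finset.sum_nonneg fun i _ => hnn i
    rw [fourierSeries_eq hL h]
    have h0 : ‖fourier f 0‖ ≤ 2 * u * S := by
      simpa using (abs_pow_mul_norm_fourier_le 0 f 0).trans (hint 0 (by omega))
    have h1 : ‖tailSum α f 1‖ ≤ C * (2 * u * S) := by
      simpa using hC f (2 * u * S)
        (fun y => (abs_pow_mul_norm_fourier_le k f y).trans (hint k le_rfl)) 1 one_pos
    calc ‖valueAtZero α * fourier f 0 + tailSum α f 1‖
        ≤ ‖valueAtZero α‖ * ‖fourier f 0‖ + ‖tailSum α f 1‖ := by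
          rw [← norm_mul]; exact norm_add_le _ _
      _ ≤ ‖valueAtZero α‖ * (2 * u * S) + C * (2 * u * S) := by gcongr
      _ ≤ (‖valueAtZero α‖ + C + 1) * (2 * u) * S := by
          have : 0 ≤ 2 * u * S := by positivity
          nlinarith

theorem fourierSeries_mem_quasiPeriodic (hL : IsShiftedLattice L) {α : L → ℂ} {r : ℝ}
    (h : HasGrowth α r) : fourierSeries α ∈ quasiPeriodic L := by
  refine ⟨isDistribution_fourierSeries hL h, fun t ht l hl f => ?_⟩
  unfold fourierSeries
  rw [← tsum_mul_left]
  refine tsum_congr fun l' => ?_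
  obtain ⟨n, hn⟩ := ht l' l'.2 l hl
  have : cexp (-(2 * Real.pi * I * t * (l' : ℝ))) = cexp (2 * Real.pi * I * l * (-t)) := by
    rw [Complex.exp_eq_exp_iff_exists_int]
    refine ⟨-n, ?_⟩
    have hn' : (((l' : ℝ) : ℂ) - l) * t = n := by exact_mod_cast hn
    push_cast
    rw [← hn']
    ring
  rw [fourier_shift, this]
  ring

end Lattice

/-! ### Mellin transforms of test functions -/

/-- The reflection `x ↦ f (-x)`. -/
def reflect (f : TestRx) : TestRx := dilate (-1) (by norm_num) f

@[simp] theorem reflect_apply (f : TestRx) (x : ℝ) : reflect f x = f (-x) := by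
  rw [reflect, dilate_apply]; congr 1; ring

@[simp] theorem reflect_reflect (f : TestRx) : reflect (reflect f) = f := by
  ext x; simp

theorem TestRx.isBigO_zero (f : TestRx) (a : ℝ) : f =O[𝓝[>] 0] fun x : ℝ => x ^ a := by
  have h : (f : ℝ → ℂ) =ᶠ[𝓝[>] 0] fun _ => (0 : ℂ) := nhdsWithin_le_nhds f.eventually_eq_zero
  exact h.trans_isBigO (Asymptotics.isBigO_zero _ _)

theorem TestRx.eventually_atTop_eq_zero (f : TestRx) : ∀ᶠ x : ℝ in atTop, f x = 0 := by
  have h := hasCompactSupport_iff_eventuallyEq.1 f.hasCompactSupport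
  rw [coclosedCompact_eq_cocompact] at h
  exact atTop_le_cocompact h

theorem TestRx.isBigO_top (f : TestRx) (a : ℝ) : f =O[atTop] fun x : ℝ => x ^ a := by
  have h : (f : ℝ → ℂ) =ᶠ[atTop] fun _ => (0 : ℂ) := f.eventually_atTop_eq_zero
  exact h.trans_isBigO (Asymptotics.isBigO_zero _ _)

theorem TestRx.mellinConvergent (f : TestRx) (w : ℂ) : MellinConvergent f w :=
  mellinConvergent_of_isBigO_rpow (a := w.re + 1) (b := w.re - 1)
    (f.continuous.locallyIntegrable.locallyIntegrableOn _) (f.isBigO_top _) (by linarith)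
    (f.isBigO_zero _) (by linarith)

theorem TestRx.differentiable_mellin (f : TestRx) : Differentiable ℂ (mellin f) := fun w =>
  mellin_differentiableAt_of_isBigO_rpow (a := w.re + 1) (b := w.re - 1)
    (f.continuous.locallyIntegrable.locallyIntegrableOn _) (f.isBigO_top _) (by linarith)
    (f.isBigO_zero _) (by linarith)

theorem cexp_log_mul {x : ℝ} (hx : 0 < x) (s : ℂ) : cexp ((Real.log x : ℂ) * s) = (x : ℂ) ^ s := by
  rw [cpow_def_of_ne_zero (by exact_mod_cast hx.ne'), Complex.ofReal_log hx.le]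

theorem mellin_twist (s : ℂ) (f : TestRx) (w : ℂ) : mellin (twist s f) w = mellin f (w + s) := by
  rw [← mellin_cpow_smul]
  refine setIntegral_congr_fun measurableSet_Ioi fun x hx => ?_
  simp only [twist_apply, cexp_log_mul hx, smul_eq_mul]

theorem reflect_twist (s : ℂ) (f : TestRx) : reflect (twist s f) = twist s (reflect f) := by
  ext x
  simp [twist_apply]

theorem integral_eq_integral_Ioi_add {h : ℝ → ℂ} (hh : Integrable h) :
    ∫ x, h x = (∫ x in Ioi (0 : ℝ), h x) + ∫ x in Ioi (0 : ℝ), h (-x) := by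
  rw [integral_comp_neg_Ioi, neg_zero, add_comm,
    intervalIntegral.integral_Iic_add_Ioi hh.integrableOn hh.integrableOn]

theorem fourier_zero_eq (f : TestRx) :
    fourier f.toTestR 0 = mellin f 1 + mellin (reflect f) 1 := by
  have : fourier f.toTestR 0 = ∫ x, f x := by
    rw [fourier]
    exact integral_congr_ae (Eventually.of_forall fun x => by simp)
  rw [this, integral_eq_integral_Ioi_add f.integrable]
  simp [mellin]

/-- The operator `f ↦ (x f)'`, which the Mellin transform turns into multiplication. -/
def euler (f : TestRx) : TestRx := derivRx (mulX f)

theorem reflect_euler (f : TestRx) : reflect (euler f) = euler (reflect f) := by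
  ext x
  rw [reflect_apply, euler, euler, derivRx_apply, derivRx_apply]
  have h1 : (mulX (reflect f) : ℝ → ℂ) = fun y => -(mulX f (-y)) := by
    ext y
    rw [mulX_apply, mulX_apply, reflect_apply]
    push_cast; ring
  rw [h1, deriv.fun_neg, deriv_comp_neg, neg_neg]

theorem mellin_euler (f : TestRx) (w : ℂ) : mellin (euler f) w = (1 - w) * mellin f w := by
  have hd : ∀ x ∈ Ici (0 : ℝ), HasDerivAt (fun x : ℝ => (x : ℂ) ^ (w - 1) * mulX f x)
      ((x : ℂ) ^ (w - 1) * euler f x - (1 - w) * ((x : ℂ) ^ (w - 1) * f x)) x := fun x hx => by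
    rcases eq_or_lt_of_le (show 0 ≤ x from hx) with rfl | hx'
    · simp only [(euler f).apply_zero, f.apply_zero, mul_zero, sub_zero]
      refine (hasDerivAt_const (0 : ℝ) (0 : ℂ)).congr_of_eventuallyEq ?_
      filter_upwards [(mulX f).eventually_eq_zero] with x hx
      rw [hx, mul_zero]
    have hx0 : (x : ℂ) ≠ 0 := by exact_mod_cast hx'.ne'
    have h1 : HasDerivAt (fun x : ℝ => (x : ℂ) ^ (w - 1)) ((w - 1) * (x : ℂ) ^ (w - 1 - 1) * 1) x := by
      have := (hasDerivAt_id (x : ℂ)).cpow_const (c := w - 1) (Or.inl (by simpa using hx'))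
      exact this.comp_ofReal
    have h2 := h1.mul ((mulX f).differentiable x).hasDerivAt
    refine h2.congr_deriv ?_
    rw [euler, derivRx_apply, mulX_apply, cpow_sub _ 1 hx0, cpow_one]
    field_simp
    ring
  have hi1 : IntegrableOn (fun x : ℝ => (x : ℂ) ^ (w - 1) * euler f x) (Ioi 0) :=
    (euler f).mellinConvergent w
  have hi2 : IntegrableOn (fun x : ℝ => (x : ℂ) ^ (w - 1) * f x) (Ioi 0) := f.mellinConvergent w
  have htop : Tendsto (fun x : ℝ => (x : ℂ) ^ (w - 1) * mulX f x) atTop (𝓝 0) := by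
    refine tendsto_const_nhds.congr' ?_
    filter_upwards [(mulX f).eventually_atTop_eq_zero] with x hx
    rw [hx, mul_zero]
  have key := integral_Ioi_of_hasDerivAt_of_tendsto' hd (hi1.sub (hi2.const_mul (1 - w))) htop
  rw [integral_sub hi1 (hi2.const_mul (1 - w)), integral_const_mul, (mulX f).apply_zero, mul_zero,
    sub_zero, sub_eq_zero] at key
  exact key

/-! ### The local functional equation -/

theorem integrableOn_rpow_mul_exp_neg {σ b : ℝ} (hσ : 0 < σ) (hb : 0 < b) :
    IntegrableOn (fun t : ℝ => t ^ (σ - 1) * Real.exp (-(b * t))) (Ioi 0) := by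
  have h := integrableOn_rpow_mul_exp_neg_mul_rpow (p := 1) (s := σ - 1) (b := b)
    (by linarith) one_pos hb
  refine h.congr_fun (fun t ht => ?_) measurableSet_Ioi
  simp

theorem continuousOn_cpow_mul_exp (a r : ℂ) :
    ContinuousOn (fun t : ℝ => (t : ℂ) ^ a * cexp (-(r * t))) (Ioi 0) := fun t ht => by
  have ht' : 0 < t := ht
  refine ContinuousAt.continuousWithinAt (ContinuousAt.mul ?_ (by fun_prop))
  exact continuousAt_ofReal_cpow_const _ _ (Or.inr ht'.ne')

theorem inv_mem_slitPlane {z : ℂ} (hz : z ∈ slitPlane) : z⁻¹ ∈ slitPlane := by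
  have h0 : 0 < normSq z := normSq_pos.2 (slitPlane_ne_zero hz)
  rw [mem_slitPlane_iff, inv_re, inv_im] at *
  rcases hz with h | h
  · exact Or.inl (div_pos h h0)
  · exact Or.inr (div_ne_zero (neg_ne_zero.2 h) h0.ne')

/-- The Gamma integral `∫_0^∞ t^{a-1} e^{-rt} dt` for complex `r` in the right half-plane,
continued analytically from positive `r`. -/
theorem integral_cpow_mul_exp_neg_mul {a r : ℂ} (ha : 0 < a.re) (hr : 0 < r.re) :
    ∫ t in Ioi (0 : ℝ), (t : ℂ) ^ (a - 1) * cexp (-(r * t)) = (1 / r) ^ a * Complex.Gamma a := by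
  set U : Set ℂ := {z : ℂ | 0 < z.re} with hU
  have hUo : IsOpen U := isOpen_lt continuous_const continuous_re
  have hUc : IsPreconnected U := (convex_halfSpace_re_gt 0).isPreconnected
  have hd : ∀ z ∈ U, DifferentiableAt ℂ
      (fun z : ℂ => ∫ t in Ioi (0 : ℝ), (t : ℂ) ^ (a - 1) * cexp (-(z * t))) z := by
    intro z hz
    have hz' : 0 < z.re := hz
    refine (hasDerivAt_integral_of_dominated_loc_of_deriv_le
      (F' := fun z t => -((t : ℂ) ^ (a - 1 + 1) * cexp (-(z * t))))
      (bound := fun t => t ^ (a.re + 1 - 1) * Real.exp (-(z.re / 2 * t)))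
      (Metric.ball_mem_nhds z (half_pos hz')) ?_ ?_ ?_ ?_ ?_ ?_).2.differentiableAt
    · exact Eventually.of_forall fun w =>
        (continuousOn_cpow_mul_exp _ w).aestronglyMeasurable measurableSet_Ioi
    · refine (integrableOn_rpow_mul_exp_neg ha hz').mono'
        ((continuousOn_cpow_mul_exp _ z).aestronglyMeasurable measurableSet_Ioi) ?_
      refine (ae_restrict_mem measurableSet_Ioi).mono fun t ht => ?_
      have ht' : 0 < t := ht
      rw [norm_mul, norm_cpow_eq_rpow_re_of_pos ht', Complex.norm_exp]
      simp
    · exact ((continuousOn_cpow_mul_exp _ z).aestronglyMeasurable measurableSet_Ioi).neg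
    · refine (ae_restrict_mem measurableSet_Ioi).mono fun t ht w hw => ?_
      have ht' : 0 < t := ht
      have hw' : z.re / 2 ≤ w.re := by
        have h1 := (abs_re_le_norm (w - z)).trans_lt (by simpa [dist_eq_norm] using hw)
        rw [sub_re] at h1
        linarith [(abs_lt.1 h1).1]
      rw [norm_neg, norm_mul, norm_cpow_eq_rpow_re_of_pos ht', Complex.norm_exp]
      simp only [sub_re, add_re, one_re, neg_re, mul_re, ofReal_re, ofReal_im, mul_zero, sub_zero]
      rw [sub_add_cancel, add_sub_cancel_right]
      gcongr
    · exact integrableOn_rpow_mul_exp_neg (by linarith) (half_pos hz')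
    · refine (ae_restrict_mem measurableSet_Ioi).mono fun t ht w hw => ?_
      have ht' : (t : ℂ) ≠ 0 := by exact_mod_cast (ne_of_gt ht)
      have h1 : HasDerivAt (fun w : ℂ => -(w * t)) (-(t : ℂ)) w := by
        simpa using (hasDerivAt_mul_const (x := w) (t : ℂ)).fun_neg
      refine (h1.cexp.const_mul ((t : ℂ) ^ (a - 1))).congr_deriv ?_
      rw [cpow_add _ _ ht', cpow_one]
      ring
  have hd2 : ∀ z ∈ U, DifferentiableAt ℂ (fun z : ℂ => (1 / z) ^ a * Complex.Gamma a) z := by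
    intro z hz
    have hz' : 0 < z.re := hz
    have hz0 : z ≠ 0 := by rintro rfl; simp at hz'
    refine DifferentiableAt.mul_const ?_ _
    refine DifferentiableAt.cpow_const (by fun_prop (disch := assumption)) ?_
    rw [one_div]
    exact inv_mem_slitPlane (Or.inl hz')
  refine AnalyticOnNhd.eqOn_of_preconnected_of_frequently_eq (U := U) (z₀ := 1)
    (DifferentiableOn.analyticOnNhd (fun z hz => (hd z hz).differentiableWithinAt) hUo)
    (DifferentiableOn.analyticOnNhd (fun z hz => (hd2 z hz).differentiableWithinAt) hUo)
    hUc (by simp [hU]) ?_ hr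
  have hlim : Tendsto (fun x : ℝ => (x : ℂ)) (𝓝[≠] 1) (𝓝[≠] 1) := by
    refine tendsto_nhdsWithin_iff.2 ⟨?_, ?_⟩
    · exact (continuous_ofReal.tendsto' 1 1 (by simp)).mono_left nhdsWithin_le_nhds
    · filter_upwards [self_mem_nhdsWithin] with x hx
      simpa using hx
  refine hlim.frequently (Eventually.frequently ?_)
  filter_upwards [nhdsWithin_le_nhds (lt_mem_nhds one_pos)] with x hx
  exact integral_cpow_mul_exp_neg_mul_Ioi ha hx

theorem mellinConvergent_fourier (f : TestR) {s : ℂ} (hs : 0 < s.re) :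
    MellinConvergent (fourier f) s := by
  obtain ⟨k, hk⟩ := exists_nat_gt s.re
  obtain ⟨C, -, hC⟩ := exists_fourier_le k f
  refine mellinConvergent_of_isBigO_rpow (a := k) (b := 0)
    ((continuous_fourier f).locallyIntegrable.locallyIntegrableOn _) ?_ hk ?_ hs
  · refine IsBigO.of_bound C ?_
    filter_upwards [eventually_gt_atTop 0] with t ht
    rw [Real.rpow_neg ht.le, Real.rpow_natCast, Real.norm_of_nonneg (by positivity),
      ← div_eq_mul_inv, le_div_iff₀ (by positivity), mul_comm]
    simpa [abs_of_pos ht] using hC t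
  · refine IsBigO.of_bound (∫ x, ‖f x‖) (Eventually.of_forall fun t => ?_)
    simpa using norm_fourier_le f t

theorem norm_cpow_le_rpow_mul_exp {z s : ℂ} (hz : z ≠ 0) :
    ‖z ^ s‖ ≤ ‖z‖ ^ s.re * Real.exp (Real.pi * |s.im|) := by
  rw [norm_cpow_of_ne_zero hz, div_eq_mul_inv, ← Real.exp_neg]
  gcongr
  refine (neg_le_abs _).trans ?_
  rw [abs_mul]
  gcongr
  exact abs_arg_le_pi z

/-- The Mellin transform of `𝓕f` damped by `e^{-εt}`, where Fubini's theorem applies. -/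
theorem mellin_fourier_damped (f : TestR) {s : ℂ} (hs : 0 < s.re) {ε : ℝ} (hε : 0 < ε) :
    ∫ t in Ioi (0 : ℝ), (t : ℂ) ^ (s - 1) * cexp (-(ε * t)) * fourier f t =
      Complex.Gamma s * ∫ x : ℝ, f x * (1 / (ε - 2 * Real.pi * I * x)) ^ s := by
  have hg : IntegrableOn (fun t : ℝ => (t : ℂ) ^ (s - 1) * cexp (-(ε * t))) (Ioi 0) := by
    have h := (Real.GammaIntegral_convergent (s := s.re) hs)
    have h2 := integrableOn_rpow_mul_exp_neg_mul_rpow (p := 1) (s := s.re - 1) (b := ε)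
      (by linarith) one_pos hε
    refine h2.mono' ?_ ?_
    · refine ContinuousOn.aestronglyMeasurable (fun t ht => ?_) measurableSet_Ioi
      have ht' : 0 < t := ht
      refine ContinuousAt.continuousWithinAt (ContinuousAt.mul ?_ (by fun_prop))
      exact continuousAt_ofReal_cpow_const _ _ (Or.inr ht'.ne')
    · refine (ae_restrict_mem measurableSet_Ioi).mono fun t ht => ?_
      have ht' : 0 < t := ht
      rw [norm_mul, norm_cpow_eq_rpow_re_of_pos ht', Complex.norm_exp]
      simp
  have hprod : Integrable (fun p : ℝ × ℝ => ((p.1 : ℂ) ^ (s - 1) * cexp (-(ε * p.1))) *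
      (f p.2 * cexp (2 * Real.pi * I * p.2 * p.1))) ((volume.restrict (Ioi 0)).prod volume) := by
    have h1 := Integrable.mul_prod hg f.integrable
    have h2 : Continuous fun p : ℝ × ℝ => cexp (2 * Real.pi * I * p.2 * p.1) := by fun_prop
    refine (h1.mul_bdd (c := 1) h2.aestronglyMeasurable
      (Eventually.of_forall fun p => (norm_fourier_kernel _ _).le)).congr
      (Eventually.of_forall fun p => ?_)
    simp only
    ring
  have hswap := integral_integral_swap (f := fun t x : ℝ => ((t : ℂ) ^ (s - 1) * cexp (-(ε * t))) *
      (f x * cexp (2 * Real.pi * I * x * t))) hprod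
  rw [← integral_const_mul]
  calc ∫ t in Ioi (0 : ℝ), (t : ℂ) ^ (s - 1) * cexp (-(ε * t)) * fourier f t
      = ∫ t in Ioi (0 : ℝ), ∫ x : ℝ, ((t : ℂ) ^ (s - 1) * cexp (-(ε * t))) *
          (f x * cexp (2 * Real.pi * I * x * t)) := by
        refine integral_congr_ae (Eventually.of_forall fun t => ?_)
        simp only
        rw [integral_const_mul, fourier]
    _ = _ := hswap
    _ = _ := by
        refine integral_congr_ae (Eventually.of_forall fun x => ?_)
        simp only
        have h3 := integral_cpow_mul_exp_neg_mul (a := s) (r := ε - 2 * Real.pi * I * x) hs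
          (by simpa using hε)
        rw [mul_comm (f x), ← mul_assoc, mul_comm (Complex.Gamma s), ← h3, ← integral_mul_const]
        refine integral_congr_ae (Eventually.of_forall fun t => ?_)
        simp only
        have : cexp (-((ε - 2 * Real.pi * I * x) * t)) =
            cexp (-(ε * t)) * cexp (2 * Real.pi * I * x * t) := by
          rw [← Complex.exp_add]; congr 1; ring
        rw [this]; ring

theorem one_div_neg_cpow {x : ℝ} (hx : 0 < x) (s : ℂ) :
    (1 / (-(2 * Real.pi * I * x))) ^ s =
      (2 * Real.pi : ℂ) ^ (-s) * cexp (Real.pi * I * s / 2) * (x : ℂ) ^ (-s) := by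
  have h2π : (0 : ℝ) < 2 * Real.pi := by positivity
  have h1 : (1 / (-(2 * Real.pi * I * x)) : ℂ) = (((2 * Real.pi * x)⁻¹ : ℝ) : ℂ) * I := by
    have : (x : ℂ) ≠ 0 := by exact_mod_cast hx.ne'
    have : (Real.pi : ℂ) ≠ 0 := by exact_mod_cast Real.pi_pos.ne'
    push_cast
    field_simp
    simp
  rw [h1, cpow_def_of_ne_zero (by simp [hx.ne', Real.pi_ne_zero]),
    log_ofReal_mul (by positivity) I_ne_zero, log_I, Real.log_inv,
    Real.log_mul h2π.ne' hx.ne', ← Complex.ofReal_ofNat, ← Complex.ofReal_mul,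
    ← cexp_log_mul hx, ← cexp_log_mul h2π, ← Complex.exp_add, ← Complex.exp_add]
  congr 1
  push_cast
  ring

theorem one_div_pos_cpow {x : ℝ} (hx : 0 < x) (s : ℂ) :
    (1 / (2 * Real.pi * I * x)) ^ s =
      (2 * Real.pi : ℂ) ^ (-s) * cexp (-Real.pi * I * s / 2) * (x : ℂ) ^ (-s) := by
  have h2π : (0 : ℝ) < 2 * Real.pi := by positivity
  have h1 : (1 / (2 * Real.pi * I * x) : ℂ) = (((2 * Real.pi * x)⁻¹ : ℝ) : ℂ) * -I := by
    have : (x : ℂ) ≠ 0 := by exact_mod_cast hx.ne'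
    have : (Real.pi : ℂ) ≠ 0 := by exact_mod_cast Real.pi_pos.ne'
    push_cast
    field_simp
    simp
  rw [h1, cpow_def_of_ne_zero (by simp [hx.ne', Real.pi_ne_zero]),
    log_ofReal_mul (by positivity) (neg_ne_zero.2 I_ne_zero), log_neg_I, Real.log_inv,
    Real.log_mul h2π.ne' hx.ne', ← Complex.ofReal_ofNat, ← Complex.ofReal_mul,
    ← cexp_log_mul hx, ← cexp_log_mul h2π, ← Complex.exp_add, ← Complex.exp_add]
  congr 1
  push_cast
  ring

/-- The local functional equation: the Mellin transform of `𝓕f`, expressed by the Mellin transforms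
of `f` on the two half-lines. The coefficients are the first row of `(2π)^{-s} Γ(s) E(s)`. -/
theorem mellin_fourier (f : TestRx) {s : ℂ} (hs : 0 < s.re) :
    mellin (fourier f.toTestR) s = (2 * Real.pi : ℂ) ^ (-s) * Complex.Gamma s *
      (cexp (Real.pi * I * s / 2) * mellin f (1 - s) +
        cexp (-Real.pi * I * s / 2) * mellin (reflect f) (1 - s)) := by
  -- Let the damping factor `e n` tend to `0` on both sides of `mellin_fourier_damped`.
  obtain ⟨e, -, hεpos, hε⟩ := exists_seq_strictAnti_tendsto (0 : ℝ)
  have hleft : Tendsto (fun n : ℕ => ∫ t in Ioi (0 : ℝ), (t : ℂ) ^ (s - 1) *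
      cexp (-(e n * t)) * fourier f.toTestR t) atTop
      (𝓝 (mellin (fourier f.toTestR) s)) := by
    have hconv := mellinConvergent_fourier f.toTestR hs
    refine tendsto_integral_of_dominated_convergence
      (fun t : ℝ => ‖(t : ℂ) ^ (s - 1) • fourier f.toTestR t‖) (fun n => ?_) hconv.norm
      (fun n => ?_) ?_
    · have h1 := hconv.aestronglyMeasurable
      have h2 : Continuous fun t : ℝ => cexp (-(e n * t)) := by fun_prop
      refine (h1.mul h2.aestronglyMeasurable).congr (Eventually.of_forall fun t => ?_)
      simp only [Pi.mul_apply, smul_eq_mul]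
      ring
    · refine (ae_restrict_mem measurableSet_Ioi).mono fun t ht => ?_
      have ht' : 0 < t := ht
      have h1 : ‖cexp (-(e n * t))‖ ≤ 1 := by
        rw [← Complex.ofReal_mul, ← Complex.ofReal_neg, Complex.norm_exp_ofReal]
        exact Real.exp_le_one_iff.2 (neg_nonpos.2 (mul_pos (hεpos n) ht').le)
      rw [smul_eq_mul, norm_mul, norm_mul, norm_mul]
      gcongr
      exact mul_le_of_le_one_right (norm_nonneg _) h1
    · refine Eventually.of_forall fun t => ?_
      have h1 : Tendsto (fun n : ℕ => cexp (-(e n * t))) atTop (𝓝 1) := by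
        have hc : Continuous fun e : ℝ => cexp (-(e * t)) := by fun_prop
        have := (hc.tendsto 0).comp hε
        simp only [ofReal_zero, zero_mul, neg_zero, Complex.exp_zero] at this
        exact this
      have := (h1.const_mul ((t : ℂ) ^ (s - 1))).mul_const (fourier f.toTestR t)
      simpa using this
  have hright : Tendsto (fun n : ℕ => Complex.Gamma s * ∫ x : ℝ, f.toTestR x *
      (1 / ((e n : ℝ) - 2 * Real.pi * I * x)) ^ s) atTop
      (𝓝 (Complex.Gamma s * ∫ x : ℝ, f x * (1 / (-(2 * Real.pi * I * x))) ^ s)) := by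
    refine Tendsto.const_mul _ ?_
    refine tendsto_integral_of_dominated_convergence
      (fun x : ℝ => ((2 * Real.pi) ^ (-s.re) * Real.exp (Real.pi * |s.im|)) *
        ‖twist (-s.re : ℝ) f x‖) (fun n => ?_)
      ((twist (-s.re : ℝ) f).integrable.norm.const_mul _) (fun n => ?_) ?_
    · have h1 : Continuous fun x : ℝ => (1 / ((e n : ℝ) - 2 * Real.pi * I * x)) ^ s := by
        have h0 : ∀ x : ℝ, 0 < (((e n : ℂ) - 2 * Real.pi * I * x)).re := by
          intro x; simpa using hεpos n
        refine Continuous.cpow (Continuous.div continuous_const (by fun_prop) fun x hx => ?_)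
          continuous_const fun x => ?_
        · have := h0 x
          rw [hx] at this
          simp at this
        · rw [one_div]
          exact inv_mem_slitPlane (Or.inl (h0 x))
      exact (f.continuous.mul h1).aestronglyMeasurable
    -- The factor `|x|^{-Re s}` in the bound is harmless because `f` vanishes near the origin.
    · refine Eventually.of_forall fun x => ?_
      rcases eq_or_ne x 0 with rfl | hx
      · simp [f.apply_zero, TestRx.apply_zero]
      · have hx' : 0 < |x| := abs_pos.2 hx
        set z : ℂ := (e n : ℝ) - 2 * Real.pi * I * x with hz
        have him : z.im = -(2 * Real.pi * x) := by simp [hz]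
        have hzn : 2 * Real.pi * |x| ≤ ‖z‖ := by
          have := abs_im_le_norm z
          rwa [him, abs_neg, abs_mul, abs_of_pos (by positivity : 0 < 2 * Real.pi)] at this
        have hz0 : z ≠ 0 := by
          rw [← norm_pos_iff]
          exact lt_of_lt_of_le (by positivity) hzn
        have h1 : ‖(1 / z) ^ s‖ ≤ (2 * Real.pi * |x|) ^ (-s.re) * Real.exp (Real.pi * |s.im|) := by
          refine (norm_cpow_le_rpow_mul_exp (one_div_ne_zero hz0)).trans ?_
          gcongr
          rw [norm_div, norm_one, one_div, Real.inv_rpow (norm_nonneg _),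
            Real.rpow_neg (by positivity)]
          gcongr
        rw [norm_mul, twist_apply, norm_mul, Complex.norm_exp]
        have h2 : Real.exp (((Real.log x : ℂ) * ((-s.re : ℝ) : ℂ)).re) = |x| ^ (-s.re) := by
          rw [Real.rpow_def_of_pos hx', Real.log_abs, ← Complex.ofReal_mul, ofReal_re]
        rw [h2, toTestR_apply]
        rw [Real.mul_rpow (by positivity) hx'.le] at h1
        calc ‖f x‖ * ‖(1 / z) ^ s‖ ≤ ‖f x‖ * ((2 * Real.pi) ^ (-s.re) * |x| ^ (-s.re) *
              Real.exp (Real.pi * |s.im|)) := by gcongr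
          _ = _ := by ring
    · refine Eventually.of_forall fun x => ?_
      rcases eq_or_ne x 0 with rfl | hx
      · simp [f.apply_zero]
      · refine Tendsto.const_mul _ ?_
        have hxπ : 2 * Real.pi * x ≠ 0 := by positivity
        have hne : -(2 * Real.pi * I * x : ℂ) ≠ 0 := by
          simp [Real.pi_ne_zero, hx]
        have hcont : ContinuousAt (fun e : ℝ => (1 / ((e : ℂ) - 2 * Real.pi * I * x)) ^ s) 0 := by
          refine ContinuousAt.cpow (ContinuousAt.div continuousAt_const (by fun_prop) ?_)
            continuousAt_const ?_
          · simpa using hne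
          · rw [one_div]
            refine inv_mem_slitPlane (Or.inr ?_)
            simp [hx, Real.pi_ne_zero]
        have := hcont.tendsto.comp hε
        rw [ofReal_zero, zero_sub] at this
        exact this
  have heq := tendsto_nhds_unique hleft
    (hright.congr fun n => (mellin_fourier_damped f.toTestR hs (hεpos n)).symm)
  have hint : Integrable fun x : ℝ => f x * (1 / (-(2 * Real.pi * I * x))) ^ s := by
    refine ((twist (-s.re : ℝ) f).integrable.norm.const_mul
      ((2 * Real.pi) ^ (-s.re) * Real.exp (Real.pi * |s.im|))).mono' ?_ ?_
    · have : Measurable fun x : ℝ => (1 / (-(2 * Real.pi * I * x))) ^ s := by fun_prop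
      exact f.continuous.aestronglyMeasurable.mul this.aestronglyMeasurable
    · refine Eventually.of_forall fun x => ?_
      rcases eq_or_ne x 0 with rfl | hx
      · simp [f.apply_zero, TestRx.apply_zero]
      · have hx' : 0 < |x| := abs_pos.2 hx
        have hn : ‖-(2 * Real.pi * I * x : ℂ)‖ = 2 * Real.pi * |x| := by
          simp [abs_of_pos Real.pi_pos]
        have hz0 : -(2 * Real.pi * I * x : ℂ) ≠ 0 := by
          rw [← norm_pos_iff, hn]; positivity
        have h1 := norm_cpow_le_rpow_mul_exp (s := s) (one_div_ne_zero hz0)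
        rw [norm_div, norm_one, hn, one_div (2 * Real.pi * |x|), Real.inv_rpow (by positivity),
          ← Real.rpow_neg (by positivity), Real.mul_rpow (by positivity) hx'.le] at h1
        rw [norm_mul, twist_apply, norm_mul, Complex.norm_exp]
        have h2 : Real.exp (((Real.log x : ℂ) * ((-s.re : ℝ) : ℂ)).re) = |x| ^ (-s.re) := by
          rw [Real.rpow_def_of_pos hx', Real.log_abs, ← Complex.ofReal_mul, ofReal_re]
        rw [h2]
        calc _ ≤ ‖f x‖ * ((2 * Real.pi) ^ (-s.re) * |x| ^ (-s.re) *
              Real.exp (Real.pi * |s.im|)) := by gcongr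
          _ = _ := by ring
  rw [heq, integral_eq_integral_Ioi_add hint]
  have hp : ∫ x in Ioi (0 : ℝ), f x * (1 / (-(2 * Real.pi * I * x))) ^ s =
      (2 * Real.pi : ℂ) ^ (-s) * cexp (Real.pi * I * s / 2) * mellin f (1 - s) := by
    rw [mellin, ← integral_const_mul]
    refine setIntegral_congr_fun measurableSet_Ioi fun x hx => ?_
    rw [one_div_neg_cpow hx, smul_eq_mul, sub_sub_cancel_left]
    ring
  have hm : ∫ x in Ioi (0 : ℝ), f (-x) * (1 / (-(2 * Real.pi * I * (-x : ℝ)))) ^ s =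
      (2 * Real.pi : ℂ) ^ (-s) * cexp (-Real.pi * I * s / 2) * mellin (reflect f) (1 - s) := by
    rw [mellin, ← integral_const_mul]
    refine setIntegral_congr_fun measurableSet_Ioi fun x hx => ?_
    rw [Complex.ofReal_neg, mul_neg, neg_neg, one_div_pos_cpow hx, smul_eq_mul,
      sub_sub_cancel_left, reflect_apply]
    ring
  rw [hp, hm]
  ring

theorem fourier_neg (f : TestRx) (y : ℝ) :
    fourier f.toTestR (-y) = fourier (reflect f).toTestR y := by
  rw [fourier, fourier, ← integral_neg_eq_self]
  refine integral_congr_ae (Eventually.of_forall fun x => ?_)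
  simp only [toTestR_apply, reflect_apply]
  congr 2
  push_cast
  ring

/-! ### The pairing of a test function with a column of two functions -/

/-- `Φ_+(f; w) v_+ + Φ_-(f; w) v_-`, where `Φ_±(f; w) = ∫_0^∞ x^{w-1} f(±x) dx`. -/
def pair (f : TestRx) (w : ℂ) (v : Fin 2 → ℂ) : ℂ :=
  mellin f w * v 0 + mellin (reflect f) w * v 1

theorem pair_add (f : TestRx) (w : ℂ) (u v : Fin 2 → ℂ) :
    pair f w (u + v) = pair f w u + pair f w v := by
  simp only [pair, Pi.add_apply]; ring

theorem pair_sub (f : TestRx) (w : ℂ) (u v : Fin 2 → ℂ) :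
    pair f w (u - v) = pair f w u - pair f w v := by
  simp only [pair, Pi.sub_apply]; ring

theorem pair_smul (f : TestRx) (w c : ℂ) (v : Fin 2 → ℂ) :
    pair f w (c • v) = c * pair f w v := by
  simp only [pair, Pi.smul_apply, smul_eq_mul]; ring

theorem differentiable_pair (f : TestRx) {v : ℂ → Fin 2 → ℂ} (hv : Differentiable ℂ v) :
    Differentiable ℂ fun s => pair f (1 - s) (v s) := by
  have h1 := f.differentiable_mellin
  have h2 := (reflect f).differentiable_mellin
  have h3 : ∀ i, Differentiable ℂ fun s => v s i := fun i => differentiable_pi.1 hv i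
  have hs : Differentiable ℂ fun s : ℂ => 1 - s := by fun_prop
  exact ((h1.comp hs).mul (h3 0)).add ((h2.comp hs).mul (h3 1))

/-- Multiplication by `s` is absorbed into the test function, which turns bounds for all test
functions into decay. -/
theorem pair_euler (f : TestRx) (s : ℂ) (v : Fin 2 → ℂ) :
    pair (euler f) (1 - s) v = s * pair f (1 - s) v := by
  rw [pair, pair, reflect_euler, mellin_euler, mellin_euler]
  ring

theorem pair_twist (f : TestRx) (s w : ℂ) (v : Fin 2 → ℂ) :
    pair (twist s f) w v = pair f (w + s) v := by
  rw [pair, pair, reflect_twist, mellin_twist, mellin_twist]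

theorem fourier_zero_eq_pair (f : TestRx) : fourier f.toTestR 0 = pair f 1 ![1, 1] := by
  rw [fourier_zero_eq]
  simp [pair]

/-! ### The involution `f ↦ f_{μ,ν,∞}` -/

theorem pullback_apply (μ ν : ℂ) (f : TestRx) (x : ℝ) :
    pullback μ ν f x = J μ ν x * f (-1 / x) := rfl

theorem J_of_pos (μ ν : ℂ) {x : ℝ} (hx : 0 < x) :
    J μ ν x = cexp (-Real.pi * I * μ / 2) * (x : ℂ) ^ (-2 * ν - 1) := by
  rw [J, Real.sign_of_pos hx, abs_of_pos hx]
  congr 2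
  push_cast; ring

theorem J_neg_of_pos (μ ν : ℂ) {x : ℝ} (hx : 0 < x) :
    J μ ν (-x) = cexp (Real.pi * I * μ / 2) * (x : ℂ) ^ (-2 * ν - 1) := by
  rw [J, Real.sign_of_neg (neg_neg_of_pos hx), abs_neg, abs_of_pos hx]
  congr 2
  push_cast; ring

theorem J_mul_J (μ ν : ℂ) {x : ℝ} (hx : x ≠ 0) : J μ ν x * J μ ν (-1 / x) = 1 := by
  have hx' : 0 < |x| := abs_pos.2 hx
  have h1 : |(-1 / x)| = |x|⁻¹ := by rw [abs_div, abs_neg, abs_one, one_div]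
  have h2 : Real.sign (-1 / x) = -Real.sign x := by
    rw [neg_div, one_div, Real.sign_neg, Real.sign_inv]
  have h3 : (((|x|⁻¹ : ℝ) : ℂ)) ^ (-2 * ν - 1) = (((|x| : ℝ) : ℂ) ^ (-2 * ν - 1))⁻¹ := by
    rw [← cexp_log_mul (inv_pos.2 hx'), ← cexp_log_mul hx', Real.log_inv, ← Complex.exp_neg]
    congr 1
    push_cast; ring
  have h4 : ((|x| : ℝ) : ℂ) ^ (-2 * ν - 1) ≠ 0 := by
    rw [← cexp_log_mul hx']; exact Complex.exp_ne_zero _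
  rw [J, J, h1, h2, h3]
  have h5 : cexp (-(Real.sign x : ℂ) * Real.pi * I * μ / 2) *
      cexp (-((-Real.sign x : ℝ) : ℂ) * Real.pi * I * μ / 2) = 1 := by
    rw [← Complex.exp_add, Complex.exp_eq_one_iff]
    exact ⟨0, by push_cast; ring⟩
  calc _ = (cexp (-(Real.sign x : ℂ) * Real.pi * I * μ / 2) *
      cexp (-((-Real.sign x : ℝ) : ℂ) * Real.pi * I * μ / 2)) *
      (((|x| : ℝ) : ℂ) ^ (-2 * ν - 1) * (((|x| : ℝ) : ℂ) ^ (-2 * ν - 1))⁻¹) := by ring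
    _ = 1 := by rw [h5, mul_inv_cancel₀ h4, one_mul]

theorem pullback_pullback (μ ν : ℂ) (f : TestRx) : pullback μ ν (pullback μ ν f) = f := by
  ext x
  rcases eq_or_ne x 0 with rfl | hx
  · rw [TestRx.apply_zero, TestRx.apply_zero]
  · rw [pullback_apply, pullback_apply, ← mul_assoc, J_mul_J μ ν hx, one_mul]
    congr 1
    field_simp

theorem pullback_twist (μ ν s : ℂ) (f : TestRx) :
    pullback μ ν (twist s f) = twist (-s) (pullback μ ν f) := by
  ext x
  rw [pullback_apply, twist_apply, twist_apply, pullback_apply, neg_div, one_div,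
    Real.log_neg_eq_log, Real.log_inv]
  have : cexp (((-Real.log x : ℝ) : ℂ) * s) = cexp ((Real.log x : ℂ) * -s) := by
    congr 1; push_cast; ring
  rw [this]; ring

theorem pullback_dilate (μ ν : ℂ) (f : TestRx) {t : ℝ} (ht : 0 < t) :
    (pullback μ ν (dilate t ht.ne' f)).toTestR =
      (t : ℂ) ^ (2 * ν + 1) • (dilate t⁻¹ (inv_pos.2 ht).ne' (pullback μ ν f)).toTestR := by
  ext x
  change pullback μ ν (dilate t ht.ne' f) x =
    (t : ℂ) ^ (2 * ν + 1) • dilate t⁻¹ (inv_pos.2 ht).ne' (pullback μ ν f) x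
  rw [pullback_apply, dilate_apply, dilate_apply, pullback_apply, smul_eq_mul]
  rcases eq_or_ne x 0 with rfl | hx
  · simp [f.apply_zero]
  have h1 : -1 / x / t = -1 / (x / t⁻¹) := by field_simp
  have hx' : 0 < |x| := abs_pos.2 hx
  have h2 : J μ ν (x / t⁻¹) = (t : ℂ) ^ (-2 * ν - 1) * J μ ν x := by
    have hs : Real.sign (x / t⁻¹) = Real.sign x := by
      rw [div_inv_eq_mul]
      rcases lt_or_gt_of_ne hx with h | h
      · rw [Real.sign_of_neg h, Real.sign_of_neg (mul_neg_of_neg_of_pos h ht)]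
      · rw [Real.sign_of_pos h, Real.sign_of_pos (mul_pos h ht)]
    have ha : |x / t⁻¹| = |x| * t := by rw [div_inv_eq_mul, abs_mul, abs_of_pos ht]
    rw [J, J, hs, ha, Complex.ofReal_mul, mul_cpow_ofReal_nonneg hx'.le ht.le]
    ring
  have h3 : (t : ℂ) ^ (2 * ν + 1) * (t : ℂ) ^ (-2 * ν - 1) = 1 := by
    rw [← cpow_add _ _ (by exact_mod_cast ht.ne')]
    have : 2 * ν + 1 + (-2 * ν - 1) = 0 := by ring
    rw [this, cpow_zero]
  rw [h1, h2, mul_assoc, ← mul_assoc, h3, one_mul]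

theorem mellin_pullback (μ ν : ℂ) (f : TestRx) (w : ℂ) :
    mellin (pullback μ ν f) w =
      cexp (-Real.pi * I * μ / 2) * mellin (reflect f) (2 * ν + 1 - w) := by
  have h : mellin (fun t : ℝ => (t : ℂ) ^ (-2 * ν - 1) • (fun u : ℝ => reflect f u⁻¹) t) w =
      mellin (reflect f) (2 * ν + 1 - w) := by
    rw [mellin_cpow_smul, mellin_comp_inv]
    congr 1; ring
  rw [← h, ← smul_eq_mul, ← mellin_const_smul]
  refine setIntegral_congr_fun measurableSet_Ioi fun x hx => ?_
  simp only [pullback_apply, J_of_pos μ ν hx, smul_eq_mul, reflect_apply, neg_div, one_div]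
  ring

theorem mellin_reflect_pullback (μ ν : ℂ) (f : TestRx) (w : ℂ) :
    mellin (reflect (pullback μ ν f)) w =
      cexp (Real.pi * I * μ / 2) * mellin f (2 * ν + 1 - w) := by
  have h : mellin (fun t : ℝ => (t : ℂ) ^ (-2 * ν - 1) • (fun u : ℝ => f u⁻¹) t) w =
      mellin f (2 * ν + 1 - w) := by
    rw [mellin_cpow_smul, mellin_comp_inv]
    congr 1; ring
  rw [← h, ← smul_eq_mul, ← mellin_const_smul]
  refine setIntegral_congr_fun measurableSet_Ioi fun x hx => ?_
  have hx2 : -1 / -x = x⁻¹ := by rw [neg_div_neg_eq, one_div]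
  simp only [reflect_apply, pullback_apply, J_neg_of_pos μ ν hx, smul_eq_mul, hx2]
  ring

/-- On the Mellin side the involution is the substitution `w ↦ 2ν + 1 - w` together with `Σ_μ`. -/
theorem pair_pullback (μ ν : ℂ) (f : TestRx) (w : ℂ) (v : Fin 2 → ℂ) :
    pair (pullback μ ν f) w v = pair f (2 * ν + 1 - w) (Sig μ *ᵥ v) := by
  rw [pair, pair, mellin_pullback, mellin_reflect_pullback]
  simp [Sig, Matrix.mulVec, dotProduct, Fin.sum_univ_two]
  ring

/-! ### Mellin transforms of tail sums -/

section Lattice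

variable {L : Set ℝ}

theorem IsShiftedLattice.countable (hL : IsShiftedLattice L) : Countable L := by
  obtain ⟨u₁, u₂, hu, e, he⟩ := hL.exists_equiv
  exact Countable.of_equiv ℤ e

theorem summable_offZero_mul_rpow (hL : IsShiftedLattice L) {α : L → ℂ} {r : ℝ}
    (h : HasGrowth α r) {σ : ℝ} (hσ : r + 1 < σ) :
    Summable fun l : L => ‖offZero α l‖ * |(l : ℝ)| ^ (-σ) := by
  obtain ⟨C, hC0, hC⟩ := h.exists_offZero_le hL
  refine Summable.of_nonneg_of_le (fun l => by positivity) (fun l => ?_)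
    ((hL.summable_rpow (p := r - σ) (by linarith)).mul_left C)
  by_cases hl : (l : ℝ) = 0
  · rw [offZero_of_eq hl, norm_zero, zero_mul]
    positivity
  · have hl' : 0 < |(l : ℝ)| := abs_pos.2 hl
    calc _ ≤ C * |(l : ℝ)| ^ r * |(l : ℝ)| ^ (-σ) := by gcongr; exact hC l
      _ = C * |(l : ℝ)| ^ (r - σ) := by rw [mul_assoc, ← Real.rpow_add hl']; rfl

theorem isBigO_top_tailSum (hL : IsShiftedLattice L) {α : L → ℂ} {r : ℝ} (h : HasGrowth α r)
    (f : TestR) (a : ℝ) : tailSum α f =O[atTop] fun t : ℝ => t ^ (-a) := by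
  obtain ⟨k, hk⟩ := exists_nat_gt (max (r + 1) a)
  obtain ⟨D, -, hD⟩ := exists_fourier_le k f
  obtain ⟨C, -, hC⟩ := exists_norm_tailSum_le hL h ((le_max_left _ _).trans_lt hk)
  refine IsBigO.of_bound (C * D) ?_
  filter_upwards [eventually_ge_atTop 1] with t ht
  have h0 : 0 < t := by linarith
  have hCD : 0 ≤ C * D := by
    have h1 := (norm_nonneg _).trans (hC f D hD 1 one_pos)
    simpa using h1
  refine (hC f D hD t h0).trans ?_
  rw [Real.norm_of_nonneg (by positivity)]
  gcongr
  exact (le_max_right _ _).trans hk.le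

theorem isBigO_zero_tailSum (hL : IsShiftedLattice L) {α : L → ℂ} {r : ℝ} (h : HasGrowth α r)
    (f : TestR) {k : ℕ} (hk : r + 1 < k) :
    tailSum α f =O[𝓝[>] 0] fun t : ℝ => t ^ (-(k : ℝ)) := by
  obtain ⟨D, -, hD⟩ := exists_fourier_le k f
  obtain ⟨C, -, hC⟩ := exists_norm_tailSum_le hL h hk
  refine IsBigO.of_bound (C * D) ?_
  filter_upwards [self_mem_nhdsWithin] with t ht
  have h0 : 0 < t := ht
  rw [Real.norm_of_nonneg (by positivity)]
  exact hC f D hD t h0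

theorem locallyIntegrableOn_tailSum (hL : IsShiftedLattice L) {α : L → ℂ} {r : ℝ}
    (h : HasGrowth α r) (f : TestR) : LocallyIntegrableOn (tailSum α f) (Ioi 0) :=
  (continuousOn_tailSum hL h f).locallyIntegrableOn measurableSet_Ioi

theorem mellinConvergent_tailSum (hL : IsShiftedLattice L) {α : L → ℂ} {r : ℝ}
    (h : HasGrowth α r) (f : TestR) {k : ℕ} (hk : r + 1 < k) {s : ℂ} (hs : k < s.re) :
    MellinConvergent (tailSum α f) s :=
  mellinConvergent_of_isBigO_rpow (locallyIntegrableOn_tailSum hL h f)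
    (isBigO_top_tailSum hL h f (s.re + 1)) (by linarith) (isBigO_zero_tailSum hL h f hk) hs

theorem differentiableAt_mellin_tailSum (hL : IsShiftedLattice L) {α : L → ℂ} {r : ℝ}
    (h : HasGrowth α r) (f : TestR) {k : ℕ} (hk : r + 1 < k) {s : ℂ} (hs : k < s.re) :
    DifferentiableAt ℂ (mellin (tailSum α f)) s :=
  mellin_differentiableAt_of_isBigO_rpow (locallyIntegrableOn_tailSum hL h f)
    (isBigO_top_tailSum hL h f (s.re + 1)) (by linarith) (isBigO_zero_tailSum hL h f hk) hs

theorem fourier_mul_eq (f : TestRx) {l : ℝ} (hl : l ≠ 0) (t : ℝ) :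
    fourier f.toTestR (l * t) =
      fourier (if 0 < l then f else reflect f).toTestR (|l| * t) := by
  rcases lt_or_gt_of_ne hl with h | h
  · rw [if_neg h.not_gt, abs_of_neg h, ← fourier_neg]
    congr 1; ring
  · rw [if_pos h, abs_of_pos h]

theorem norm_cpow_smul_comp_mul (g : ℝ → ℂ) (s : ℂ) {a : ℝ} (ha : 0 < a) {t : ℝ} (ht : 0 < t) :
    ‖(t : ℂ) ^ (s - 1) • g (a * t)‖ =
      a ^ (1 - s.re) * ‖((a * t : ℝ) : ℂ) ^ (s - 1) • g (a * t)‖ := by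
  rw [norm_smul, norm_smul, norm_cpow_eq_rpow_re_of_pos ht,
    norm_cpow_eq_rpow_re_of_pos (mul_pos ha ht), Real.mul_rpow ha.le ht.le]
  simp only [sub_re, one_re]
  have : a ^ (1 - s.re) * a ^ (s.re - 1) = 1 := by
    rw [← Real.rpow_add ha]; simp
  calc _ = (a ^ (1 - s.re) * a ^ (s.re - 1)) * (t ^ (s.re - 1) * ‖g (a * t)‖) := by
        rw [this, one_mul]
    _ = _ := by ring

theorem integral_norm_mellin_comp_mul (g : ℝ → ℂ) (s : ℂ) {a : ℝ} (ha : 0 < a) :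
    ∫ t in Ioi (0 : ℝ), ‖(t : ℂ) ^ (s - 1) • g (a * t)‖ =
      a ^ (-s.re) * ∫ t in Ioi (0 : ℝ), ‖(t : ℂ) ^ (s - 1) • g t‖ := by
  have h1 := integral_comp_mul_left_Ioi (fun u : ℝ => ‖(u : ℂ) ^ (s - 1) • g u‖) 0 ha
  rw [mul_zero, smul_eq_mul] at h1
  have h2 : a ^ (-s.re) = a ^ (1 - s.re) * a⁻¹ := by
    rw [← Real.rpow_neg_one, ← Real.rpow_add ha]; congr 1; ring
  rw [h2, mul_assoc, ← h1, ← integral_const_mul]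
  refine setIntegral_congr_fun measurableSet_Ioi fun t ht => ?_
  exact norm_cpow_smul_comp_mul g s ha ht

theorem hasSum_mellin_tailSum (hL : IsShiftedLattice L) {α : L → ℂ} {r : ℝ} (h : HasGrowth α r)
    (f : TestRx) {s : ℂ} (hs : r + 1 < s.re) (hs0 : 0 < s.re) :
    HasSum (fun l : L => offZero α l * (((|(l : ℝ)| : ℝ) : ℂ) ^ (-s) *
      mellin (fourier (if 0 < (l : ℝ) then f else reflect f).toTestR) s))
      (mellin (tailSum α f.toTestR) s) := by
  have := hL.countable
  set F : L → ℝ → ℂ := fun l t => offZero α l * ((t : ℂ) ^ (s - 1) *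
    fourier (if 0 < (l : ℝ) then f else reflect f).toTestR (|(l : ℝ)| * t)) with hF
  have hconv : ∀ l : L, (l : ℝ) ≠ 0 → MellinConvergent (fun t : ℝ =>
      fourier (if 0 < (l : ℝ) then f else reflect f).toTestR (|(l : ℝ)| * t)) s := fun l hl =>
    (MellinConvergent.comp_mul_left (abs_pos.2 hl)).2 (mellinConvergent_fourier _ hs0)
  have hint : ∀ l, Integrable (F l) (volume.restrict (Ioi 0)) := fun l => by
    by_cases hl : (l : ℝ) = 0
    · simp [hF, offZero_of_eq hl]
    · exact (hconv l hl).const_mul (offZero α l)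
  set K : ℝ := (∫ t in Ioi (0 : ℝ), ‖(t : ℂ) ^ (s - 1) • fourier f.toTestR t‖) +
    ∫ t in Ioi (0 : ℝ), ‖(t : ℂ) ^ (s - 1) • fourier (reflect f).toTestR t‖ with hK
  have hsum : Summable fun l : L => ∫ t in Ioi (0 : ℝ), ‖F l t‖ := by
    refine Summable.of_nonneg_of_le (fun l => integral_nonneg fun t => norm_nonneg _) (fun l => ?_)
      ((summable_offZero_mul_rpow hL h hs).mul_right K)
    by_cases hl : (l : ℝ) = 0
    · simp [hF, offZero_of_eq hl]
    · simp only [hF, norm_mul (offZero α l)]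
      rw [integral_const_mul, mul_assoc]
      gcongr
      refine (integral_norm_mellin_comp_mul _ s (abs_pos.2 hl)).trans_le ?_
      gcongr
      have h1 : 0 ≤ ∫ t in Ioi (0 : ℝ), ‖(t : ℂ) ^ (s - 1) • fourier f.toTestR t‖ :=
        integral_nonneg fun t => norm_nonneg _
      have h2 : 0 ≤ ∫ t in Ioi (0 : ℝ), ‖(t : ℂ) ^ (s - 1) • fourier (reflect f).toTestR t‖ :=
        integral_nonneg fun t => norm_nonneg _
      split_ifs <;> linarith
  have key := hasSum_integral_of_summable_integral_norm hint hsum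
  have h1 : ∫ t in Ioi (0 : ℝ), ∑' l, F l t = mellin (tailSum α f.toTestR) s := by
    refine setIntegral_congr_fun measurableSet_Ioi fun t ht => ?_
    simp only [tailSum, smul_eq_mul]
    rw [← tsum_mul_left]
    refine tsum_congr fun l => ?_
    by_cases hl : (l : ℝ) = 0
    · simp [hF, offZero_of_eq hl]
    · rw [fourier_mul_eq f hl]
      simp only [hF]
      ring
  rw [h1] at key
  refine key.congr_fun fun l => Eq.symm ?_
  by_cases hl : (l : ℝ) = 0
  · simp [hF, offZero_of_eq hl]
  · simp only [hF]
    rw [integral_const_mul]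
    congr 1
    have := mellin_comp_mul_left
      (fourier (if 0 < (l : ℝ) then f else reflect f).toTestR) s (abs_pos.2 hl)
    simpa only [mellin, smul_eq_mul] using this

theorem summable_offZero_mul_cpow (hL : IsShiftedLattice L) {α : L → ℂ} {r : ℝ}
    (h : HasGrowth α r) {s : ℂ} (hs : r + 1 < s.re) (p : L → Prop) [DecidablePred p] :
    Summable fun l : L => if p l then offZero α l * ((|(l : ℝ)| : ℝ) : ℂ) ^ (-s) else 0 := by
  refine Summable.of_norm_bounded (summable_offZero_mul_rpow hL h hs) fun l => ?_
  split_ifs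
  · by_cases hl : (l : ℝ) = 0
    · simp [offZero_of_eq hl]
    · rw [norm_mul, norm_cpow_eq_rpow_re_of_pos (abs_pos.2 hl), neg_re]
  · rw [norm_zero]; positivity

theorem xiPlus_eq (α : L → ℂ) (s : ℂ) : xiPlus α s =
    ∑' l : L, if 0 < (l : ℝ) then offZero α l * ((|(l : ℝ)| : ℝ) : ℂ) ^ (-s) else 0 := by
  unfold xiPlus
  refine (tsum_subtype {l : L | 0 < (l : ℝ)} (fun l => α l / ((l : ℝ) : ℂ) ^ s)).trans ?_
  refine tsum_congr fun l => ?_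
  by_cases hl : 0 < (l : ℝ)
  · rw [indicator_of_mem (by exact hl), if_pos hl, offZero_of_ne hl.ne', abs_of_pos hl, cpow_neg,
      div_eq_mul_inv]
  · rw [indicator_of_notMem (by exact hl), if_neg hl]

theorem xiMinus_eq (α : L → ℂ) (s : ℂ) : xiMinus α s =
    ∑' l : L, if (l : ℝ) < 0 then offZero α l * ((|(l : ℝ)| : ℝ) : ℂ) ^ (-s) else 0 := by
  unfold xiMinus
  refine (tsum_subtype {l : L | (l : ℝ) < 0} (fun l => α l / ((|(l : ℝ)| : ℝ) : ℂ) ^ s)).trans ?_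
  refine tsum_congr fun l => ?_
  by_cases hl : (l : ℝ) < 0
  · rw [indicator_of_mem (by exact hl), if_pos hl, offZero_of_ne hl.ne, cpow_neg, div_eq_mul_inv]
  · rw [indicator_of_notMem (by exact hl), if_neg hl]

/-- The Mellin transform of the tail sum is the pairing of `f` with `E(s) Ξ(α; s)`. -/
theorem mellin_tailSum (hL : IsShiftedLattice L) {α : L → ℂ} {r : ℝ} (h : HasGrowth α r)
    (f : TestRx) {s : ℂ} (hs : r + 1 < s.re) (hs0 : 0 < s.re) :
    mellin (tailSum α f.toTestR) s = pair f (1 - s) (E s *ᵥ completed α s) := by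
  have h1 := hasSum_mellin_tailSum hL h f hs hs0
  have hp := (summable_offZero_mul_cpow hL h hs (fun l => 0 < (l : ℝ))).hasSum
  have hm := (summable_offZero_mul_cpow hL h hs (fun l => (l : ℝ) < 0)).hasSum
  rw [← xiPlus_eq] at hp
  rw [← xiMinus_eq] at hm
  have h2 := (hp.mul_right (mellin (fourier f.toTestR) s)).add
    (hm.mul_right (mellin (fourier (reflect f).toTestR) s))
  have h3 := h1.unique (h2.congr_fun fun l => Eq.symm ?_)
  · rw [h3, mellin_fourier f hs0, mellin_fourier (reflect f) hs0, reflect_reflect]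
    simp only [pair, E, completed, Matrix.mulVec, dotProduct, Fin.sum_univ_two, Matrix.of_apply,
      Matrix.cons_val', Matrix.cons_val_zero, Matrix.cons_val_one, Matrix.cons_val_fin_one]
    ring
  · rcases lt_trichotomy (l : ℝ) 0 with hl | hl | hl
    · simp only [if_pos hl, if_neg hl.not_gt]
      ring
    · simp [hl, offZero_of_eq hl]
    · simp only [if_pos hl, if_neg hl.not_gt]
      ring

/-- A Dirichlet series over a part of `L` is holomorphic on its half-plane of absolute
convergence. -/
theorem differentiableOn_xi (hL : IsShiftedLattice L) {α : L → ℂ} {r : ℝ} (h : HasGrowth α r)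
    (p : L → Prop) [DecidablePred p] :
    DifferentiableOn ℂ (fun s => ∑' l : L,
      if p l then offZero α l * ((|(l : ℝ)| : ℝ) : ℂ) ^ (-s) else 0) {s : ℂ | r + 1 < s.re} := by
  intro s₀ hs₀
  have hs₀' : r + 1 < s₀.re := hs₀
  obtain ⟨a, ha1, ha2⟩ := exists_between hs₀'
  set b := s₀.re + 1 with hb
  have hopen : IsOpen {s : ℂ | a < s.re ∧ s.re < b} :=
    (isOpen_lt continuous_const continuous_re).inter (isOpen_lt continuous_re continuous_const)
  have hmem : s₀ ∈ {s : ℂ | a < s.re ∧ s.re < b} := ⟨ha2, by linarith⟩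
  have hd := differentiableOn_tsum_of_summable_norm
    (u := fun l : L => ‖offZero α l‖ * |(l : ℝ)| ^ (-a) + ‖offZero α l‖ * |(l : ℝ)| ^ (-b))
    (F := fun (l : L) (s : ℂ) =>
      if p l then offZero α l * ((|(l : ℝ)| : ℝ) : ℂ) ^ (-s) else 0)
    ((summable_offZero_mul_rpow hL h ha1).add (summable_offZero_mul_rpow hL h (by linarith)))
    (fun l => ?_) hopen (fun l s hs => ?_)
  · exact (hd.differentiableAt (hopen.mem_nhds hmem)).differentiableWithinAt
  · by_cases hp : p l
    · by_cases hl : (l : ℝ) = 0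
      · simp [offZero_of_eq hl]
      · simp only [if_pos hp]
        have hl0 : ((|(l : ℝ)| : ℝ) : ℂ) ≠ 0 := by simpa using hl
        intro s _
        exact ((DifferentiableAt.const_cpow (by fun_prop) (Or.inl hl0)).const_mul
          _).differentiableWithinAt
    · simp only [if_neg hp]
      exact differentiableOn_const _
  · by_cases hl : (l : ℝ) = 0
    · simp [offZero_of_eq hl]
    · have hl0 : 0 < |(l : ℝ)| := abs_pos.2 hl
      refine le_trans (b := ‖offZero α l‖ * |(l : ℝ)| ^ (-s.re)) ?_ ?_
      · split_ifs
        · rw [norm_mul, norm_cpow_eq_rpow_re_of_pos hl0, neg_re]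
        · rw [norm_zero]; positivity
      · rw [← mul_add]
        refine mul_le_mul_of_nonneg_left ?_ (norm_nonneg _)
        have hpa : 0 < |(l : ℝ)| ^ (-a) := Real.rpow_pos_of_pos hl0 _
        have hpb : 0 < |(l : ℝ)| ^ (-b) := Real.rpow_pos_of_pos hl0 _
        rcases le_total 1 |(l : ℝ)| with h1 | h1
        · have := Real.rpow_le_rpow_of_exponent_le h1 (neg_le_neg hs.1.le)
          linarith
        · have := Real.rpow_le_rpow_of_exponent_ge hl0 h1 (neg_le_neg hs.2.le)
          linarith

theorem differentiableOn_xiPlus (hL : IsShiftedLattice L) {α : L → ℂ} {r : ℝ}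
    (h : HasGrowth α r) : DifferentiableOn ℂ (xiPlus α) {s : ℂ | r + 1 < s.re} :=
  (differentiableOn_xi hL h (fun l => 0 < (l : ℝ))).congr fun s _ => xiPlus_eq α s

theorem differentiableOn_xiMinus (hL : IsShiftedLattice L) {α : L → ℂ} {r : ℝ}
    (h : HasGrowth α r) : DifferentiableOn ℂ (xiMinus α) {s : ℂ | r + 1 < s.re} :=
  (differentiableOn_xi hL h (fun l => (l : ℝ) < 0)).congr fun s _ => xiMinus_eq α s

end Lattice

/-! ### Gluing pairings into a column of entire functions -/

theorem eq_of_eq_on_halfPlane {F G : ℂ → ℂ} (hF : Differentiable ℂ F) (hG : Differentiable ℂ G)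
    {B : ℝ} (h : ∀ s : ℂ, B < s.re → F s = G s) : F = G := by
  have hF' : AnalyticOnNhd ℂ F univ := fun z _ => hF.analyticAt z
  have hG' : AnalyticOnNhd ℂ G univ := fun z _ => hG.analyticAt z
  refine hF'.eq_of_eventuallyEq hG' (z₀ := ((B + 1 : ℝ) : ℂ)) ?_
  have ho : IsOpen {s : ℂ | B < s.re} := isOpen_lt continuous_const continuous_re
  filter_upwards [ho.mem_nhds (show ((B + 1 : ℝ) : ℂ) ∈ {s : ℂ | B < s.re} by simp)] with s hs
  exact h s hs

/-- Test functions supported on one half-line, whose pairing reads off one component. -/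
theorem exists_component_tests : ∃ (m : ℂ → ℂ) (φ : Fin 2 → TestRx), Differentiable ℂ m ∧ m 1 ≠ 0 ∧
    ∀ i w v, pair (φ i) w v = m w * v i := by
  let b : ContDiffBump (2 : ℝ) := ⟨1 / 2, 1, by norm_num, by norm_num⟩
  have hsupp : ∀ x : ℝ, x ≤ 0 → b x = 0 := fun x hx => b.zero_of_le_dist (by
    rw [Real.dist_eq, abs_sub_comm]
    exact le_trans (by show (1 : ℝ) ≤ 2 - x; linarith) (le_abs_self _))
  have hts : tsupport (fun x => ((b x : ℝ) : ℂ)) ⊆ Metric.closedBall 2 1 := by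
    refine (closure_mono ?_).trans b.tsupport_eq.subset
    intro x hx
    simpa using hx
  let φ : TestRx :=
    { toFun := fun x => ((b x : ℝ) : ℂ)
      contDiff' := Complex.ofRealCLM.contDiff.comp b.contDiff
      hasCompactSupport' := HasCompactSupport.of_support_subset_isCompact
        (isCompact_closedBall (2 : ℝ) 1) ((subset_tsupport _).trans hts)
      tsupport_subset' := fun x hx h0 => by
        have h0' : x = 0 := h0
        have := hts hx
        rw [h0', Metric.mem_closedBall, Real.dist_eq] at this
        norm_num at this }
  have hφ : ∀ x, φ x = ((b x : ℝ) : ℂ) := fun x => rfl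
  have hm0 : ∀ w, mellin (reflect φ) w = 0 := fun w => by
    rw [mellin, ← integral_zero ℝ ℂ (μ := volume.restrict (Ioi 0))]
    refine setIntegral_congr_fun measurableSet_Ioi fun x hx => ?_
    have hx' : 0 < x := hx
    simp only [reflect_apply, hφ, hsupp (-x) (by linarith), ofReal_zero, smul_zero]
  refine ⟨mellin φ, ![φ, reflect φ], φ.differentiable_mellin, ?_, fun i w v => ?_⟩
  · have h1 : mellin φ 1 = ((∫ x, b x : ℝ) : ℂ) := by
      have h2 : fourier φ.toTestR 0 = mellin φ 1 := by rw [fourier_zero_eq, hm0, add_zero]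
      rw [← h2, fourier, ← integral_complex_ofReal]
      exact integral_congr_ae (Eventually.of_forall fun x => by simp [hφ])
    rw [h1]
    exact_mod_cast b.integral_pos.ne'
  · fin_cases i
    · simp [pair, hm0]
    · simp [pair, hm0]

/-- Entire functions attached to test functions that are pairings with one column on a right
half-plane are pairings with a column of entire functions. -/
theorem exists_entire_column {m : ℂ → ℂ} {φ : Fin 2 → TestRx} (hm : Differentiable ℂ m)
    (hm1 : m 1 ≠ 0) (hφ : ∀ i w v, pair (φ i) w v = m w * v i) (W : TestRx → ℂ → ℂ)
    (hW : ∀ f, Differentiable ℂ (W f)) (v : ℂ → Fin 2 → ℂ) (B : ℝ)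
    (h : ∀ f s, B < s.re → W f s = pair f (1 - s) (v s)) :
    ∃ R : ℂ → Fin 2 → ℂ, Differentiable ℂ R ∧ ∀ f s, W f s = pair f (1 - s) (R s) := by
  -- The twist by `s` moves the point `1 - s` to `1`, where `m` does not vanish.
  set R : ℂ → Fin 2 → ℂ := fun s i => W (twist s (φ i)) s / m 1 with hR
  have hg : ∀ s₀ s i u, pair (twist s₀ (φ i)) (1 - s) u = m (1 - s + s₀) * u i :=
    fun s₀ s i u => by rw [pair_twist, hφ]
  have key : ∀ f s, W f s = pair f (1 - s) (R s) := by
    intro f s₀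
    have hdm : Differentiable ℂ fun s : ℂ => m (1 - s + s₀) := hm.comp (by fun_prop)
    have h1 := eq_of_eq_on_halfPlane (F := fun s => m (1 - s + s₀) * W f s)
      (G := fun s => pair f (1 - s) (fun i => W (twist s₀ (φ i)) s)) (B := B)
      (hdm.mul (hW f)) (differentiable_pair f (differentiable_pi.2 fun i => hW _)) (fun s hs => ?_)
    · have h2 := congrFun h1 s₀
      have h3 : (fun i => W (twist s₀ (φ i)) s₀) = m 1 • R s₀ := by
        ext i
        simp only [hR, Pi.smul_apply, smul_eq_mul]
        field_simp
      simp only [sub_add_cancel] at h2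
      rw [h3, pair_smul] at h2
      exact mul_left_cancel₀ hm1 h2
    · rw [h f s hs, ← pair_smul]
      congr 1
      ext i
      rw [h _ s hs, hg]
      rfl
  refine ⟨R, ?_, key⟩
  refine differentiable_pi.2 fun i s₀ => ?_
  have hdm : Differentiable ℂ fun s : ℂ => m (1 - s + s₀) := hm.comp (by fun_prop)
  have hne : ∀ᶠ s in 𝓝 s₀, m (1 - s + s₀) ≠ 0 := by
    refine hdm.continuous.continuousAt.eventually_ne ?_
    simpa using hm1
  have hquot : DifferentiableAt ℂ (fun s => W (twist s₀ (φ i)) s / m (1 - s + s₀)) s₀ :=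
    (hW _ s₀).fun_div (hdm s₀) (by simpa using hm1)
  refine hquot.congr_of_eventuallyEq ?_
  filter_upwards [hne] with s hs
  rw [key, hg]
  field_simp

/-! ### Modified tail sums -/

section Pair

variable {L₁ L₂ : Set ℝ}

/-- The automorphy relation tested on all dilates of `f`. -/
theorem tailSum_inversion (hL₁ : IsShiftedLattice L₁) (hL₂ : IsShiftedLattice L₂) {μ ν : ℂ}
    {α₁ : L₁ → ℂ} {α₂ : L₂ → ℂ} {r₁ r₂ : ℝ} (h₁ : HasGrowth α₁ r₁) (h₂ : HasGrowth α₂ r₂)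
    (hT : ∀ f : TestRx, fourierSeries α₁ f.toTestR = fourierSeries α₂ (pullback μ ν f).toTestR)
    (f : TestRx) {t : ℝ} (ht : 0 < t) :
    valueAtZero α₁ * fourier f.toTestR 0 + tailSum α₁ f.toTestR t =
      (t : ℂ) ^ (2 * ν - 1) * (valueAtZero α₂ * fourier (pullback μ ν f).toTestR 0 +
        tailSum α₂ (pullback μ ν f).toTestR t⁻¹) := by
  have h := hT (dilate t ht.ne' f)
  have ht0 : (t : ℂ) ≠ 0 := by exact_mod_cast ht.ne'
  rw [fourierSeries_dilate hL₁ h₁ f ht, pullback_dilate μ ν f ht,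
    (isDistribution_fourierSeries hL₂ h₂).linear.map_smul, smul_eq_mul,
    fourierSeries_dilate hL₂ h₂ _ (inv_pos.2 ht)] at h
  have h3 : (t : ℂ) ^ (2 * ν + 1) = t * (t : ℂ) * (t : ℂ) ^ (2 * ν - 1) := by
    have : 2 * ν + 1 = 1 + 1 + (2 * ν - 1) := by ring
    rw [this, cpow_add _ _ ht0, cpow_add _ _ ht0, cpow_one]
  rw [h3] at h
  refine mul_left_cancel₀ ht0 (h.trans ?_)
  push_cast
  field_simp

/-- The tail sum, corrected on `(0, 1]` by the two terms that obstruct its decay at `0`. -/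
def modTail (μ ν : ℂ) (α₁ : L₁ → ℂ) (α₂ : L₂ → ℂ) (f : TestRx) (t : ℝ) : ℂ :=
  tailSum α₁ f.toTestR t + (Ioc (0 : ℝ) 1).indicator (fun u : ℝ =>
    valueAtZero α₁ * fourier f.toTestR 0 -
      valueAtZero α₂ * fourier (pullback μ ν f).toTestR 0 * (u : ℂ) ^ (2 * ν - 1)) t

variable {μ ν : ℂ} {α₁ : L₁ → ℂ} {α₂ : L₂ → ℂ} {r₁ r₂ : ℝ}

theorem modTail_of_one_lt (f : TestRx) {t : ℝ} (ht : 1 < t) :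
    modTail μ ν α₁ α₂ f t = tailSum α₁ f.toTestR t := by
  rw [modTail, indicator_of_notMem (fun h => absurd h.2 (not_le.2 ht)), add_zero]

theorem modTail_of_le_one (hL₁ : IsShiftedLattice L₁) (hL₂ : IsShiftedLattice L₂)
    (h₁ : HasGrowth α₁ r₁) (h₂ : HasGrowth α₂ r₂)
    (hT : ∀ f : TestRx, fourierSeries α₁ f.toTestR = fourierSeries α₂ (pullback μ ν f).toTestR)
    (f : TestRx) {t : ℝ} (ht : 0 < t) (ht1 : t ≤ 1) :
    modTail μ ν α₁ α₂ f t =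
      (t : ℂ) ^ (2 * ν - 1) * tailSum α₂ (pullback μ ν f).toTestR t⁻¹ := by
  have h := tailSum_inversion hL₁ hL₂ h₁ h₂ hT f ht
  rw [modTail, indicator_of_mem (show t ∈ Ioc (0 : ℝ) 1 from ⟨ht, ht1⟩)]
  linear_combination h

theorem pullback_invariance_symm
    (hT : ∀ f : TestRx, fourierSeries α₁ f.toTestR = fourierSeries α₂ (pullback μ ν f).toTestR)
    (f : TestRx) : fourierSeries α₂ f.toTestR = fourierSeries α₁ (pullback μ ν f).toTestR := by
  rw [hT, pullback_pullback]

theorem locallyIntegrableOn_modTail (hL₁ : IsShiftedLattice L₁) (h₁ : HasGrowth α₁ r₁)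
    (f : TestRx) : LocallyIntegrableOn (modTail μ ν α₁ α₂ f) (Ioi 0) := by
  refine (locallyIntegrableOn_tailSum hL₁ h₁ f.toTestR).add ?_
  have hc : ContinuousOn (fun u : ℝ => valueAtZero α₁ * fourier f.toTestR 0 -
      valueAtZero α₂ * fourier (pullback μ ν f).toTestR 0 * (u : ℂ) ^ (2 * ν - 1)) (Ioi 0) :=
    fun t ht => by
      have ht' : 0 < t := ht
      exact (continuousAt_const.sub (continuousAt_const.mul
        (continuousAt_ofReal_cpow_const _ _ (Or.inr ht'.ne')))).continuousWithinAt
  intro t ht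
  obtain ⟨U, hU, hi⟩ := (hc.locallyIntegrableOn (μ := volume) measurableSet_Ioi) t ht
  exact ⟨U, hU, hi.indicator measurableSet_Ioc⟩

theorem isBigO_top_modTail (hL₁ : IsShiftedLattice L₁) (h₁ : HasGrowth α₁ r₁) (f : TestRx)
    (a : ℝ) : modTail μ ν α₁ α₂ f =O[atTop] fun t : ℝ => t ^ (-a) := by
  refine (isBigO_top_tailSum hL₁ h₁ f.toTestR a).congr' ?_ EventuallyEq.rfl
  filter_upwards [eventually_gt_atTop 1] with t ht
  exact (modTail_of_one_lt f ht).symm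

theorem isBigO_zero_modTail (hL₁ : IsShiftedLattice L₁) (hL₂ : IsShiftedLattice L₂)
    (h₁ : HasGrowth α₁ r₁) (h₂ : HasGrowth α₂ r₂)
    (hT : ∀ f : TestRx, fourierSeries α₁ f.toTestR = fourierSeries α₂ (pullback μ ν f).toTestR)
    (f : TestRx) (a : ℝ) : modTail μ ν α₁ α₂ f =O[𝓝[>] 0] fun t : ℝ => t ^ (-a) := by
  have h := (isBigO_top_tailSum hL₂ h₂ (pullback μ ν f).toTestR
    (-a - (2 * ν - 1).re)).comp_tendsto tendsto_inv_nhdsGT_zero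
  have h3 : (fun t : ℝ => (t : ℂ) ^ (2 * ν - 1)) =O[𝓝[>] 0] fun t : ℝ => t ^ (2 * ν - 1).re := by
    refine IsBigO.of_bound 1 ?_
    filter_upwards [self_mem_nhdsWithin] with t ht
    have ht' : 0 < t := ht
    rw [norm_cpow_eq_rpow_re_of_pos ht', Real.norm_of_nonneg (by positivity), one_mul]
  refine (h3.mul h).congr' ?_ ?_
  · filter_upwards [self_mem_nhdsWithin, nhdsWithin_le_nhds (eventually_le_nhds one_pos)]
      with t ht ht1
    exact (modTail_of_le_one hL₁ hL₂ h₁ h₂ hT f ht ht1).symm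
  · filter_upwards [self_mem_nhdsWithin] with t ht
    have ht' : 0 < t := ht
    simp only [Function.comp_apply]
    rw [Real.inv_rpow ht'.le, ← Real.rpow_neg ht'.le, ← Real.rpow_add ht']
    congr 1
    ring

/-- The modified tail sum decays rapidly at `0` as well as at `∞`, so its Mellin transform is
entire. -/
theorem differentiable_mellin_modTail (hL₁ : IsShiftedLattice L₁) (hL₂ : IsShiftedLattice L₂)
    (h₁ : HasGrowth α₁ r₁) (h₂ : HasGrowth α₂ r₂)
    (hT : ∀ f : TestRx, fourierSeries α₁ f.toTestR = fourierSeries α₂ (pullback μ ν f).toTestR)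
    (f : TestRx) : Differentiable ℂ (mellin (modTail μ ν α₁ α₂ f)) := fun s =>
  mellin_differentiableAt_of_isBigO_rpow (locallyIntegrableOn_modTail hL₁ h₁ f)
    (isBigO_top_modTail hL₁ h₁ f (s.re + 1)) (by linarith)
    (isBigO_zero_modTail hL₁ hL₂ h₁ h₂ hT f (s.re - 1)) (by linarith)

/-- The correction on `(0, 1]` contributes the polar terms. -/
theorem mellin_modTail_eq (hL₁ : IsShiftedLattice L₁) (h₁ : HasGrowth α₁ r₁) (f : TestRx)
    {k : ℕ} (hk : r₁ + 1 < k) {s : ℂ} (hs : k < s.re) (hs2 : 0 < s.re + (2 * ν - 1).re) :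
    mellin (modTail μ ν α₁ α₂ f) s = mellin (tailSum α₁ f.toTestR) s +
      valueAtZero α₁ * fourier f.toTestR 0 / s -
      valueAtZero α₂ * fourier (pullback μ ν f).toTestR 0 / (s + 2 * ν - 1) := by
  have hs0 : 0 < s.re := lt_of_le_of_lt (Nat.cast_nonneg k) hs
  set p₁ := valueAtZero α₁ * fourier f.toTestR 0
  set p₂ := valueAtZero α₂ * fourier (pullback μ ν f).toTestR 0
  have ha := hasMellin_const_smul (hasMellin_one_Ioc hs0).1 p₁
  have hb := hasMellin_const_smul (hasMellin_cpow_Ioc (2 * ν - 1) hs2).1 p₂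
  have hab := hasMellin_sub ha.1 hb.1
  have ht := hasMellin_add (mellinConvergent_tailSum hL₁ h₁ f.toTestR hk hs) hab.1
  have heq : modTail μ ν α₁ α₂ f = fun t => tailSum α₁ f.toTestR t +
      (p₁ • (Ioc (0 : ℝ) 1).indicator (fun _ => (1 : ℂ)) t -
        p₂ • (Ioc (0 : ℝ) 1).indicator (fun t => (t : ℂ) ^ (2 * ν - 1)) t) := by
    ext t
    rw [modTail]
    by_cases ht : t ∈ Ioc (0 : ℝ) 1
    · simp only [indicator_of_mem ht, smul_eq_mul, mul_one]; rfl
    · simp only [indicator_of_notMem ht, smul_zero, sub_zero]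
  rw [heq, ht.2, hab.2, ha.2, hb.2, (hasMellin_one_Ioc hs0).2, (hasMellin_cpow_Ioc _ hs2).2]
  simp only [smul_eq_mul]
  rw [← add_sub_assoc, ← add_sub_assoc]
  ring

/-- The functional equation, before division by the Mellin transforms of the test function. -/
theorem mellin_modTail_symm (hL₁ : IsShiftedLattice L₁) (hL₂ : IsShiftedLattice L₂)
    (h₁ : HasGrowth α₁ r₁) (h₂ : HasGrowth α₂ r₂)
    (hT : ∀ f : TestRx, fourierSeries α₁ f.toTestR = fourierSeries α₂ (pullback μ ν f).toTestR)
    (f : TestRx) (s : ℂ) : mellin (modTail μ ν α₁ α₂ f) s =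
      mellin (modTail μ ν α₂ α₁ (pullback μ ν f)) (1 - 2 * ν - s) := by
  have h : mellin (fun t : ℝ => (t : ℂ) ^ (2 * ν - 1) •
      (fun u : ℝ => modTail μ ν α₂ α₁ (pullback μ ν f) u⁻¹) t) s =
      mellin (modTail μ ν α₂ α₁ (pullback μ ν f)) (1 - 2 * ν - s) := by
    rw [mellin_cpow_smul, mellin_comp_inv]
    congr 1; ring
  rw [← h]
  refine setIntegral_congr_ae measurableSet_Ioi ?_
  filter_upwards [compl_mem_ae_iff.2 (measure_singleton (1 : ℝ))] with t ht1 ht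
  have ht0 : 0 < t := ht
  congr 1
  simp only [smul_eq_mul]
  rcases lt_or_gt_of_ne (show t ≠ 1 from ht1) with h' | h'
  · rw [modTail_of_le_one hL₁ hL₂ h₁ h₂ hT f ht0 h'.le,
      modTail_of_one_lt _ ((one_lt_inv₀ ht0).2 h')]
  · rw [modTail_of_one_lt _ h', modTail_of_le_one hL₂ hL₁ h₂ h₁ (pullback_invariance_symm hT)
      _ (inv_pos.2 ht0) (inv_le_one_of_one_le₀ h'.le), pullback_pullback, inv_inv, ← mul_assoc]
    have : (t : ℂ) ^ (2 * ν - 1) * ((t⁻¹ : ℝ) : ℂ) ^ (2 * ν - 1) = 1 := by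
      rw [← mul_cpow_ofReal_nonneg ht0.le (inv_pos.2 ht0).le, ← Complex.ofReal_mul,
        mul_inv_cancel₀ ht0.ne', ofReal_one, one_cpow]
    rw [this, one_mul]

end Pair

/-! ### Polar parts -/

/-- The polar part `(a₁ s⁻¹ 1₂ - a₂ (s + 2ν - 1)⁻¹ Σ_μ) (1, 1)ᵗ`. -/
def polarPart (μ ν a₁ a₂ s : ℂ) : Fin 2 → ℂ :=
  ((a₁ / s) • (1 : Matrix (Fin 2) (Fin 2) ℂ) - (a₂ / (s + 2 * ν - 1)) • Sig μ) *ᵥ ![1, 1]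

theorem regularized_eq (μ ν a₁ a₂ : ℂ) (X : ℂ → Fin 2 → ℂ) (s : ℂ) :
    regularized μ ν a₁ a₂ X s = E s *ᵥ X s + polarPart μ ν a₁ a₂ s := rfl

theorem polarPart_eq (μ ν a₁ a₂ s : ℂ) : polarPart μ ν a₁ a₂ s =
    (a₁ / s) • ![1, 1] - (a₂ / (s + 2 * ν - 1)) • (Sig μ *ᵥ ![1, 1]) := by
  rw [polarPart, Matrix.sub_mulVec, Matrix.smul_mulVec, Matrix.smul_mulVec, Matrix.one_mulVec]

theorem fourier_pullback_zero (μ ν : ℂ) (f : TestRx) :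
    fourier (pullback μ ν f).toTestR 0 = pair f (2 * ν) (Sig μ *ᵥ ![1, 1]) := by
  rw [fourier_zero_eq_pair, pair_pullback]
  congr 1; ring

/-- The entire function that remains of the pairing with the polar part once its two poles are
subtracted. -/
def polarRest (μ ν a₁ a₂ : ℂ) (f : TestRx) (s : ℂ) : ℂ :=
  a₁ * dslope (fun z => pair f (1 - z) ![1, 1]) 0 s -
    a₂ * dslope (fun z => pair f (1 - z) (Sig μ *ᵥ ![1, 1])) (1 - 2 * ν) s

theorem differentiable_dslope {F : ℂ → ℂ} (hF : Differentiable ℂ F) (c : ℂ) :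
    Differentiable ℂ (dslope F c) := by
  rw [← differentiableOn_univ] at *
  exact (Complex.differentiableOn_dslope univ_mem).2 hF

theorem differentiable_polarRest (μ ν a₁ a₂ : ℂ) (f : TestRx) :
    Differentiable ℂ (polarRest μ ν a₁ a₂ f) :=
  ((differentiable_dslope (differentiable_pair f (differentiable_const _)) _).const_mul a₁).sub
    ((differentiable_dslope (differentiable_pair f (differentiable_const _)) _).const_mul a₂)

theorem polarRest_eq (μ ν a₁ a₂ : ℂ) (f : TestRx) {s : ℂ} (hs : s ≠ 0) (hs' : s ≠ 1 - 2 * ν) :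
    polarRest μ ν a₁ a₂ f s = pair f (1 - s) (polarPart μ ν a₁ a₂ s) -
      a₁ * fourier f.toTestR 0 / s +
      a₂ * fourier (pullback μ ν f).toTestR 0 / (s + 2 * ν - 1) := by
  have h1 : s + 2 * ν - 1 ≠ 0 := fun h => hs' (by linear_combination h)
  have h2 : s - (1 - 2 * ν) = s + 2 * ν - 1 := by ring
  have h3 : 1 - (1 - 2 * ν) = 2 * ν := by ring
  rw [polarRest, dslope_of_ne _ hs, dslope_of_ne _ hs', slope_def_field, slope_def_field,
    polarPart_eq, pair_sub, pair_smul, pair_smul, fourier_pullback_zero, fourier_zero_eq_pair,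
    sub_zero, sub_zero, h2, h3]
  field_simp
  ring

/-! ### From automorphic pairs to Dirichlet series -/

section Pair

variable {L₁ L₂ : Set ℝ} {μ ν : ℂ} {α₁ : L₁ → ℂ} {α₂ : L₂ → ℂ} {r₁ r₂ : ℝ}

/-- A column is determined by its pairings with all test functions. -/
theorem pair_ext {u v : Fin 2 → ℂ} {s : ℂ} (h : ∀ f, pair f (1 - s) u = pair f (1 - s) v) :
    u = v := by
  obtain ⟨m, φ, -, hm1, hφ⟩ := exists_component_tests
  ext i
  have := h (twist s (φ i))
  rw [pair_twist, pair_twist, hφ, hφ, sub_add_cancel] at this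
  exact mul_left_cancel₀ hm1 this

theorem exists_regularization (hL₁ : IsShiftedLattice L₁) (hL₂ : IsShiftedLattice L₂)
    (h₁ : HasGrowth α₁ r₁) (h₂ : HasGrowth α₂ r₂)
    (hT : ∀ f : TestRx, fourierSeries α₁ f.toTestR = fourierSeries α₂ (pullback μ ν f).toTestR) :
    ∃ R : ℂ → Fin 2 → ℂ, Differentiable ℂ R ∧ ∀ f s, mellin (modTail μ ν α₁ α₂ f) s +
      polarRest μ ν (valueAtZero α₁) (valueAtZero α₂) f s = pair f (1 - s) (R s) := by
  obtain ⟨m, φ, hm, hm1, hφ⟩ := exists_component_tests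
  obtain ⟨k, hk⟩ := exists_nat_gt (r₁ + 1)
  refine exists_entire_column hm hm1 hφ (fun f s => mellin (modTail μ ν α₁ α₂ f) s +
      polarRest μ ν (valueAtZero α₁) (valueAtZero α₂) f s)
    (fun f => (differentiable_mellin_modTail hL₁ hL₂ h₁ h₂ hT f).add
      (differentiable_polarRest _ _ _ _ f))
    (fun s => E s *ᵥ completed α₁ s + polarPart μ ν (valueAtZero α₁) (valueAtZero α₂) s)
    (max k (-(2 * ν - 1).re)) fun f s hs => ?_
  have hs1 : (k : ℝ) < s.re := (le_max_left _ _).trans_lt hs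
  have hs2 : 0 < s.re + (2 * ν - 1).re := by linarith [(le_max_right _ _).trans_lt hs]
  have hs0 : 0 < s.re := lt_of_le_of_lt (Nat.cast_nonneg k) hs1
  rw [mellin_modTail_eq hL₁ h₁ f hk hs1 hs2, pair_add,
    mellin_tailSum hL₁ h₁ f (hk.trans hs1) hs0, polarRest_eq]
  · ring
  · rintro rfl; simp at hs0
  · rintro rfl; simp at hs2

/-- A column of entire functions that regularizes the pairing of every test function with
`E(s) Ξ(α₁; s)`. -/
def IsRegularization (μ ν : ℂ) (α₁ : L₁ → ℂ) (α₂ : L₂ → ℂ) (R : ℂ → Fin 2 → ℂ) : Prop :=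
  Differentiable ℂ R ∧ ∀ f s, mellin (modTail μ ν α₁ α₂ f) s +
      polarRest μ ν (valueAtZero α₁) (valueAtZero α₂) f s = pair f (1 - s) (R s)

variable {R R₁ R₂ : ℂ → Fin 2 → ℂ}

theorem IsRegularization.pair_sub_polarPart (hR : IsRegularization μ ν α₁ α₂ R) (f : TestRx)
    {s : ℂ} (hs : s ≠ 0) (hs' : s ≠ 1 - 2 * ν) :
    pair f (1 - s) (R s - polarPart μ ν (valueAtZero α₁) (valueAtZero α₂) s) =
      mellin (modTail μ ν α₁ α₂ f) s - valueAtZero α₁ * fourier f.toTestR 0 / s +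
        valueAtZero α₂ * fourier (pullback μ ν f).toTestR 0 / (s + 2 * ν - 1) := by
  rw [pair_sub, ← hR.2, polarRest_eq _ _ _ _ _ hs hs']
  ring

theorem IsRegularization.functional_equation (hL₁ : IsShiftedLattice L₁)
    (hL₂ : IsShiftedLattice L₂) (h₁ : HasGrowth α₁ r₁) (h₂ : HasGrowth α₂ r₂)
    (hT : ∀ f : TestRx, fourierSeries α₁ f.toTestR = fourierSeries α₂ (pullback μ ν f).toTestR)
    (hR₁ : IsRegularization μ ν α₁ α₂ R₁) (hR₂ : IsRegularization μ ν α₂ α₁ R₂)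
    {s : ℂ} (hs : s ≠ 0) (hs' : s ≠ 1 - 2 * ν) :
    R₁ s - polarPart μ ν (valueAtZero α₁) (valueAtZero α₂) s =
      Sig μ *ᵥ (R₂ (1 - 2 * ν - s) -
        polarPart μ ν (valueAtZero α₂) (valueAtZero α₁) (1 - 2 * ν - s)) := by
  refine pair_ext (s := s) fun f => ?_
  have e2 : 2 * ν + 1 - (1 - (1 - 2 * ν - s)) = 1 - s := by ring
  have h3 := hR₂.pair_sub_polarPart (pullback μ ν f) (s := 1 - 2 * ν - s)
    (fun h => hs' (by linear_combination -h)) (fun h => hs (by linear_combination -h))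
  rw [pair_pullback, e2] at h3
  rw [h3, hR₁.pair_sub_polarPart f hs hs', mellin_modTail_symm hL₁ hL₂ h₁ h₂ hT f s,
    pullback_pullback]
  have h4 : s + 2 * ν - 1 ≠ 0 := fun h => hs' (by linear_combination h)
  have e3 : 1 - 2 * ν - s = -(s + 2 * ν - 1) := by ring
  have e4 : 1 - 2 * ν - s + 2 * ν - 1 = -s := by ring
  rw [e4, e3, div_neg, div_neg]
  ring

/-- The regularization is `E(s) Ξ(α₁; s)` plus the polar part on the whole half-plane of
absolute convergence. -/
theorem IsRegularization.eq_completed (hL₁ : IsShiftedLattice L₁)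
    (h₁ : HasGrowth α₁ r₁) (hR : IsRegularization μ ν α₁ α₂ R) {s : ℂ} (hs : r₁ + 1 < s.re)
    (hn : ∀ n : ℕ, s ≠ -n) (hs' : s ≠ 1 - 2 * ν) :
    R s = E s *ᵥ completed α₁ s + polarPart μ ν (valueAtZero α₁) (valueAtZero α₂) s := by
  set a₁ := valueAtZero α₁
  set a₂ := valueAtZero α₂
  have hs0 : s ≠ 0 := by simpa using hn 0
  have hq : s + 2 * ν - 1 ≠ 0 := fun h => hs' (by linear_combination h)
  have hΓ : Complex.Gamma s ≠ 0 := Complex.Gamma_ne_zero hn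
  set U : Set ℂ := {z : ℂ | r₁ + 1 < z.re} with hU
  have hUo : IsOpen U := isOpen_lt continuous_const continuous_re
  have hUc : IsPreconnected U := (convex_halfSpace_re_gt _).isPreconnected
  -- Both sides become holomorphic after multiplication by `z (z + 2ν - 1) / Γ(z)`.
  set ξ : ℂ → Fin 2 → ℂ := fun z => ![xiPlus α₁ z, xiMinus α₁ z] with hξ
  have hξd : ∀ i, DifferentiableOn ℂ (fun z => ξ z i) U := fun i => by
    fin_cases i
    · exact differentiableOn_xiPlus hL₁ h₁
    · exact differentiableOn_xiMinus hL₁ h₁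
  have hE : ∀ i j, Differentiable ℂ fun z => E z i j := fun i j => by
    fin_cases i <;> fin_cases j <;> simp only [E] <;> simp <;> fun_prop
  have hcompl : ∀ z, completed α₁ z = ((2 * Real.pi : ℂ) ^ (-z) * Complex.Gamma z) • ξ z := by
    intro z
    ext i
    fin_cases i <;> simp [completed, hξ]
  have hΓd := Complex.differentiable_one_div_Gamma
  have hpow : Differentiable ℂ fun z : ℂ => (2 * Real.pi : ℂ) ^ (-z) := fun z =>
    DifferentiableAt.const_cpow (by fun_prop) (Or.inl (by simp [Real.pi_ne_zero]))
  set F : Fin 2 → ℂ → ℂ := fun i z => z * (z + 2 * ν - 1) * (Complex.Gamma z)⁻¹ * R z i with hF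
  set G : Fin 2 → ℂ → ℂ := fun i z =>
    z * (z + 2 * ν - 1) * (2 * Real.pi : ℂ) ^ (-z) * (E z *ᵥ ξ z) i + (Complex.Gamma z)⁻¹ *
      (a₁ * (z + 2 * ν - 1) * (![1, 1] : Fin 2 → ℂ) i - a₂ * z * (Sig μ *ᵥ ![1, 1]) i) with hG
  have hRd := differentiable_pi.1 hR.1
  have hFd : ∀ i, DifferentiableOn ℂ (F i) U := fun i =>
    (((by fun_prop : Differentiable ℂ fun z : ℂ => z * (z + 2 * ν - 1)).mul hΓd).mul
      (hRd i)).differentiableOn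
  have hGd : ∀ i, DifferentiableOn ℂ (G i) U := fun i => by
    have hEξ : DifferentiableOn ℂ (fun z => (E z *ᵥ ξ z) i) U := by
      simp only [Matrix.mulVec, dotProduct, Fin.sum_univ_two]
      exact ((hE i 0).differentiableOn.mul (hξd 0)).add ((hE i 1).differentiableOn.mul (hξd 1))
    exact ((((by fun_prop : Differentiable ℂ fun z : ℂ => z * (z + 2 * ν - 1)).mul
      hpow).differentiableOn).mul hEξ).add (hΓd.mul (by fun_prop)).differentiableOn
  -- At `s` and wherever the factor does not vanish, the claim is the identity `F = G`.
  have hagree : ∀ z : ℂ, (∀ n : ℕ, z ≠ -n) → z ≠ 1 - 2 * ν →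
      (R z = E z *ᵥ completed α₁ z + polarPart μ ν a₁ a₂ z ↔ ∀ i, F i z = G i z) := by
    intro z hzn hz'
    have hz0 : z ≠ 0 := by simpa using hzn 0
    have hzq : z + 2 * ν - 1 ≠ 0 := fun h => hz' (by linear_combination h)
    have hzΓ : Complex.Gamma z ≠ 0 := Complex.Gamma_ne_zero hzn
    have h2 : ∀ i, G i z = z * (z + 2 * ν - 1) * (Complex.Gamma z)⁻¹ *
        (E z *ᵥ completed α₁ z + polarPart μ ν a₁ a₂ z) i := fun i => by
      rw [hcompl, Matrix.mulVec_smul, polarPart_eq]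
      simp only [hG, Pi.add_apply, Pi.sub_apply, Pi.smul_apply, smul_eq_mul]
      field_simp
    have h3 : z * (z + 2 * ν - 1) * (Complex.Gamma z)⁻¹ ≠ 0 :=
      mul_ne_zero (mul_ne_zero hz0 hzq) (inv_ne_zero hzΓ)
    rw [funext_iff]
    refine forall_congr' fun i => ?_
    rw [h2]
    simp only [hF]
    exact ⟨fun h => by rw [h], fun h => mul_left_cancel₀ h3 h⟩
  refine (hagree s hn hs').2 fun i => ?_
  obtain ⟨k, hk⟩ := exists_nat_gt (r₁ + 1)
  set B := max (k : ℝ) (-(2 * ν - 1).re) with hB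
  -- On a smaller half-plane the two sides agree by the computation of the Mellin transform.
  have hlarge : ∀ z : ℂ, B < z.re → F i z = G i z := by
    intro z hz
    have hz1 : (k : ℝ) < z.re := (le_max_left _ _).trans_lt hz
    have hz2 : 0 < z.re + (2 * ν - 1).re := by linarith [(le_max_right _ _).trans_lt hz]
    have hz0 : 0 < z.re := lt_of_le_of_lt (Nat.cast_nonneg k) hz1
    have hzn : ∀ n : ℕ, z ≠ -n := fun n h => by
      rw [h] at hz0
      simp at hz0
      exact absurd hz0 (not_lt.2 (Nat.cast_nonneg n))
    have hz' : z ≠ 1 - 2 * ν := by rintro rfl; simp at hz2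
    refine (hagree z hzn hz').1 ?_ i
    refine pair_ext (s := z) fun f => ?_
    rw [← hR.2, mellin_modTail_eq hL₁ h₁ f hk hz1 hz2, pair_add,
      mellin_tailSum hL₁ h₁ f (hk.trans hz1) hz0, polarRest_eq _ _ _ _ _ (by simpa using hzn 0) hz']
    ring
  have hw : ((B + 1 : ℝ) : ℂ) ∈ U := by
    have : (k : ℝ) ≤ B := le_max_left _ _
    simp only [hU, mem_ofPred_eq, ofReal_re]
    linarith
  refine AnalyticOnNhd.eqOn_of_preconnected_of_eventuallyEq ((hFd i).analyticOnNhd hUo)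
    ((hGd i).analyticOnNhd hUo) hUc hw ?_ hs
  have ho : IsOpen {z : ℂ | B < z.re} := isOpen_lt continuous_const continuous_re
  filter_upwards [ho.mem_nhds (show ((B + 1 : ℝ) : ℂ) ∈ {z : ℂ | B < z.re} by simp)] with z hz
  exact hlarge z hz

end Pair

section Pair

variable {L₁ L₂ : Set ℝ} {μ ν : ℂ} {α₁ : L₁ → ℂ} {α₂ : L₂ → ℂ} {r₁ r₂ : ℝ}
  {R R₁ R₂ : ℂ → Fin 2 → ℂ}

/-! ### Growth in vertical strips -/

/-- Polynomial growth in vertical strips of the Mellin transform attached to the twist `|x|^s φ`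
whose exponent moves with the argument `s`. -/
theorem exists_norm_mellin_modTail_twist_le (hL₁ : IsShiftedLattice L₁)
    (hL₂ : IsShiftedLattice L₂) (h₁ : HasGrowth α₁ r₁) (h₂ : HasGrowth α₂ r₂)
    (hT : ∀ f : TestRx, fourierSeries α₁ f.toTestR = fourierSeries α₂ (pullback μ ν f).toTestR)
    (φ : TestRx) (a b : ℝ) : ∃ (k : ℕ) (C : ℝ), 0 ≤ C ∧ ∀ s : ℂ, a ≤ s.re → s.re ≤ b →
      ‖mellin (modTail μ ν α₁ α₂ (twist s φ)) s‖ ≤ C * (1 + ‖s‖) ^ k := by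
  obtain ⟨k, hk⟩ := exists_nat_gt
    (max (max (r₁ + 1) (r₂ + 1)) (max (b + 1) (2 - a - 2 * ν.re)))
  have hk₁ : r₁ + 1 < k := ((le_max_left _ _).trans (le_max_left _ _)).trans_lt hk
  have hk₂ : r₂ + 1 < k := ((le_max_right _ _).trans (le_max_left _ _)).trans_lt hk
  have hkb : b + 1 < k := ((le_max_left _ _).trans (le_max_right _ _)).trans_lt hk
  have hka : 2 - a - 2 * ν.re < k := ((le_max_right _ _).trans (le_max_right _ _)).trans_lt hk
  obtain ⟨C₁, hC₁0, hC₁⟩ := exists_norm_tailSum_le hL₁ h₁ hk₁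
  obtain ⟨C₂, hC₂0, hC₂⟩ := exists_norm_tailSum_le hL₂ h₂ hk₂
  obtain ⟨D₁, hD₁0, hD₁⟩ := exists_fourier_twist_le k φ a b
  obtain ⟨D₂, hD₂0, hD₂⟩ := exists_fourier_twist_le k (pullback μ ν φ) (-b) (-a)
  -- On `(0, 1]` the modified tail sum is a tail sum for the other lattice, twisted by `-s`.
  set w : ℝ → ℝ := fun t => (Ioc (0 : ℝ) 1).indicator (fun _ => 1) t +
    (Ioi (1 : ℝ)).indicator (fun t => t ^ (-2 : ℝ)) t with hw
  have hw1 : Integrable ((Ioc (0 : ℝ) 1).indicator fun _ => (1 : ℝ)) :=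
    (integrable_indicator_iff measurableSet_Ioc).2 (by simp)
  have hw2 : Integrable ((Ioi (1 : ℝ)).indicator fun t => t ^ (-2 : ℝ)) :=
    (integrable_indicator_iff measurableSet_Ioi).2
      (integrableOn_Ioi_rpow_of_lt (by norm_num) one_pos)
  have hwi : IntegrableOn w (Ioi 0) := (hw1.add hw2).integrableOn
  have hw0 : ∀ t, 0 ≤ w t := fun t => add_nonneg
    (indicator_nonneg (fun _ _ => zero_le_one) _)
    (indicator_nonneg (fun t ht => Real.rpow_nonneg (zero_le_one.trans (le_of_lt ht)) _) _)
  refine ⟨k, (C₁ * D₁ + C₂ * D₂) * ∫ t in Ioi (0 : ℝ), w t,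
    mul_nonneg (by positivity) (integral_nonneg hw0), fun s hsa hsb => ?_⟩
  have hpos : 0 ≤ (1 + ‖s‖) ^ k := by positivity
  have hbound : ∀ t ∈ Ioi (0 : ℝ), ‖(t : ℂ) ^ (s - 1) • modTail μ ν α₁ α₂ (twist s φ) t‖ ≤
      (C₁ * D₁ + C₂ * D₂) * (1 + ‖s‖) ^ k * w t := by
    intro t ht
    have ht0 : 0 < t := ht
    rw [norm_smul, norm_cpow_eq_rpow_re_of_pos ht0, sub_re, one_re]
    rcases le_or_gt t 1 with ht1 | ht1
    · have hwt : w t = 1 := by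
        simp only [hw]
        rw [indicator_of_mem (show t ∈ Ioc (0 : ℝ) 1 from ⟨ht0, ht1⟩),
          indicator_of_notMem (show t ∉ Ioi (1 : ℝ) from not_lt.2 ht1), add_zero]
      rw [hwt, mul_one, modTail_of_le_one hL₁ hL₂ h₁ h₂ hT _ ht0 ht1, norm_mul,
        norm_cpow_eq_rpow_re_of_pos ht0, pullback_twist]
      have h3 := hC₂ (twist (-s) (pullback μ ν φ)).toTestR (D₂ * (1 + ‖s‖) ^ k)
        (fun y => by simpa using hD₂ (-s) (by simpa using hsb) (by simpa using hsa) y)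
        t⁻¹ (inv_pos.2 ht0)
      rw [Real.inv_rpow ht0.le, ← Real.rpow_neg ht0.le, neg_neg] at h3
      have h4 : t ^ (s.re - 1) * (t ^ (2 * ν - 1).re * t ^ (k : ℝ)) ≤ 1 := by
        rw [← Real.rpow_add ht0, ← Real.rpow_add ht0]
        refine Real.rpow_le_one ht0.le ht1 ?_
        simp only [sub_re, mul_re, re_ofNat, im_ofNat, zero_mul, sub_zero, one_re]
        linarith
      calc t ^ (s.re - 1) * (t ^ (2 * ν - 1).re *
            ‖tailSum α₂ (twist (-s) (pullback μ ν φ)).toTestR t⁻¹‖)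
          ≤ t ^ (s.re - 1) * (t ^ (2 * ν - 1).re *
            (C₂ * (D₂ * (1 + ‖s‖) ^ k) * t ^ (k : ℝ))) := by gcongr
        _ = (t ^ (s.re - 1) * (t ^ (2 * ν - 1).re * t ^ (k : ℝ))) *
            (C₂ * (D₂ * (1 + ‖s‖) ^ k)) := by ring
        _ ≤ 1 * (C₂ * (D₂ * (1 + ‖s‖) ^ k)) := by gcongr
        _ ≤ (C₁ * D₁ + C₂ * D₂) * (1 + ‖s‖) ^ k := by
          have : 0 ≤ C₁ * D₁ * (1 + ‖s‖) ^ k := by positivity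
          linarith
    · have hwt : w t = t ^ (-2 : ℝ) := by
        simp only [hw]
        rw [indicator_of_notMem (fun h => absurd h.2 (not_le.2 ht1)),
          indicator_of_mem (show t ∈ Ioi (1 : ℝ) from ht1), zero_add]
      rw [hwt, modTail_of_one_lt _ ht1]
      have h3 := hC₁ (twist s φ).toTestR (D₁ * (1 + ‖s‖) ^ k) (hD₁ s hsa hsb) t ht0
      have h4 : t ^ (s.re - 1) * t ^ (-(k : ℝ)) ≤ t ^ (-2 : ℝ) := by
        rw [← Real.rpow_add ht0]
        exact Real.rpow_le_rpow_of_exponent_le ht1.le (by linarith)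
      calc t ^ (s.re - 1) * ‖tailSum α₁ (twist s φ).toTestR t‖
          ≤ t ^ (s.re - 1) * (C₁ * (D₁ * (1 + ‖s‖) ^ k) * t ^ (-(k : ℝ))) := by gcongr
        _ = C₁ * (D₁ * (1 + ‖s‖) ^ k) * (t ^ (s.re - 1) * t ^ (-(k : ℝ))) := by ring
        _ ≤ C₁ * (D₁ * (1 + ‖s‖) ^ k) * t ^ (-2 : ℝ) := by gcongr
        _ ≤ (C₁ * D₁ + C₂ * D₂) * (1 + ‖s‖) ^ k * t ^ (-2 : ℝ) := by
          have : 0 ≤ C₂ * D₂ * (1 + ‖s‖) ^ k := by positivity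
          refine mul_le_mul_of_nonneg_right ?_ (by positivity)
          linarith
  refine (norm_integral_le_of_norm_le (hwi.const_mul ((C₁ * D₁ + C₂ * D₂) * (1 + ‖s‖) ^ k))
    ((ae_restrict_mem measurableSet_Ioi).mono hbound)).trans_eq ?_
  rw [integral_const_mul]
  ring

theorem one_le_norm_of_abs_im {s : ℂ} (hs : 1 + 2 * ‖ν‖ ≤ |s.im|) :
    1 ≤ ‖s‖ ∧ 1 ≤ ‖s + 2 * ν - 1‖ := by
  refine ⟨by linarith [abs_im_le_norm s, norm_nonneg ν], ?_⟩
  have h1 := abs_im_le_norm (s + 2 * ν - 1)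
  have h2 : (s + 2 * ν - 1).im = s.im + 2 * ν.im := by simp
  rw [h2] at h1
  have h3 := abs_sub_abs_le_abs_sub s.im (-(2 * ν.im))
  rw [sub_neg_eq_add, abs_neg, abs_mul, abs_two] at h3
  linarith [abs_im_le_norm ν]

/-- Away from the poles the unregularized functions grow at most polynomially in vertical
strips. -/
theorem IsRegularization.exists_norm_sub_polarPart_le (hL₁ : IsShiftedLattice L₁)
    (hL₂ : IsShiftedLattice L₂) (h₁ : HasGrowth α₁ r₁) (h₂ : HasGrowth α₂ r₂)
    (hT : ∀ f : TestRx, fourierSeries α₁ f.toTestR = fourierSeries α₂ (pullback μ ν f).toTestR)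
    (hR : IsRegularization μ ν α₁ α₂ R) (a b : ℝ) :
    ∃ (k : ℕ) (C : ℝ), 0 ≤ C ∧ ∀ s : ℂ, a ≤ s.re → s.re ≤ b → 1 + 2 * ‖ν‖ ≤ |s.im| → ∀ i,
      ‖(R s - polarPart μ ν (valueAtZero α₁) (valueAtZero α₂) s) i‖ ≤ C * (1 + ‖s‖) ^ k := by
  obtain ⟨m, φ, -, hm1, hφ⟩ := exists_component_tests
  have hi : ∀ i, ∃ (k : ℕ) (C : ℝ), 0 ≤ C ∧ ∀ s : ℂ, a ≤ s.re → s.re ≤ b →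
      1 + 2 * ‖ν‖ ≤ |s.im| →
      ‖(R s - polarPart μ ν (valueAtZero α₁) (valueAtZero α₂) s) i‖ ≤ C * (1 + ‖s‖) ^ k := by
    intro i
    obtain ⟨k, C, hC0, hC⟩ := exists_norm_mellin_modTail_twist_le hL₁ hL₂ h₁ h₂ hT (φ i) a b
    obtain ⟨D₁, hD₁0, hD₁⟩ := exists_fourier_twist_le 0 (φ i) a b
    obtain ⟨D₂, hD₂0, hD₂⟩ := exists_fourier_twist_le 0 (pullback μ ν (φ i)) (-b) (-a)
    refine ⟨k, (C + ‖valueAtZero α₁‖ * D₁ + ‖valueAtZero α₂‖ * D₂) / ‖m 1‖, by positivity,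
      fun s hsa hsb hs => ?_⟩
    obtain ⟨hn1, hn2⟩ := one_le_norm_of_abs_im hs
    have hs0 : s ≠ 0 := by rintro rfl; simp at hn1; linarith
    have hs1 : s ≠ 1 - 2 * ν := by rintro rfl; simp at hn2; linarith
    have h3 := hR.pair_sub_polarPart (twist s (φ i)) hs0 hs1
    rw [pair_twist, hφ, sub_add_cancel] at h3
    have h4 : ‖fourier (twist s (φ i)).toTestR 0‖ ≤ D₁ := by simpa using hD₁ s hsa hsb 0
    have h5 : ‖fourier (pullback μ ν (twist s (φ i))).toTestR 0‖ ≤ D₂ := by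
      rw [pullback_twist]
      simpa using hD₂ (-s) (by simpa using hsb) (by simpa using hsa) 0
    have h6 : 1 ≤ (1 + ‖s‖) ^ k := one_le_pow₀ (by linarith)
    have hdiv : ∀ x y : ℂ, 1 ≤ ‖y‖ → ‖x / y‖ ≤ ‖x‖ := fun x y hy => by
      rw [norm_div]; exact div_le_self (norm_nonneg _) hy
    have h7 := congrArg norm h3
    rw [norm_mul] at h7
    have hm : 0 < ‖m 1‖ := norm_pos_iff.2 hm1
    rw [div_mul_eq_mul_div, le_div_iff₀ hm, mul_comm, h7]
    refine (norm_add_le _ _).trans ((add_le_add (norm_sub_le _ _) le_rfl).trans ?_)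
    have h8 : ‖valueAtZero α₁ * fourier (twist s (φ i)).toTestR 0 / s‖ ≤
        ‖valueAtZero α₁‖ * D₁ := by
      refine (hdiv _ _ hn1).trans ?_
      rw [norm_mul]; gcongr
    have h9 : ‖valueAtZero α₂ * fourier (pullback μ ν (twist s (φ i))).toTestR 0 /
        (s + 2 * ν - 1)‖ ≤ ‖valueAtZero α₂‖ * D₂ := by
      refine (hdiv _ _ hn2).trans ?_
      rw [norm_mul]; gcongr
    have h10 : 0 ≤ ‖valueAtZero α₁‖ * D₁ := by positivity
    have h11 : 0 ≤ ‖valueAtZero α₂‖ * D₂ := by positivity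
    have h12 := hC s hsa hsb
    nlinarith [mul_le_mul_of_nonneg_left h6 h10, mul_le_mul_of_nonneg_left h6 h11]
  obtain ⟨k₀, C₀, hC₀0, hC₀⟩ := hi 0
  obtain ⟨k₁, C₁, hC₁0, hC₁⟩ := hi 1
  refine ⟨k₀ + k₁, C₀ + C₁, by positivity, fun s hsa hsb hs i => ?_⟩
  have hs1 : 1 ≤ 1 + ‖s‖ := by linarith [norm_nonneg s]
  have hp0 : (1 + ‖s‖) ^ k₀ ≤ (1 + ‖s‖) ^ (k₀ + k₁) := pow_le_pow_right₀ hs1 (by omega)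
  have hp1 : (1 + ‖s‖) ^ k₁ ≤ (1 + ‖s‖) ^ (k₀ + k₁) := pow_le_pow_right₀ hs1 (by omega)
  have hp : 0 ≤ (1 + ‖s‖) ^ (k₀ + k₁) := by positivity
  fin_cases i
  · refine (hC₀ s hsa hsb hs).trans ?_
    nlinarith [mul_le_mul_of_nonneg_left hp0 hC₀0, mul_nonneg hC₁0 hp]
  · refine (hC₁ s hsa hsb hs).trans ?_
    nlinarith [mul_le_mul_of_nonneg_left hp1 hC₁0, mul_nonneg hC₀0 hp]

/-! ### The matrix `E(s)` -/

/-- `det E(s) = 2 i sin (π s)`. -/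
def detE (s : ℂ) : ℂ := cexp (Real.pi * I * s) - cexp (-Real.pi * I * s)

/-- The column `E(s)⁻¹ v`, defined off the zeros of `det E(s)`. -/
def solveE (s : ℂ) (v : Fin 2 → ℂ) : Fin 2 → ℂ :=
  ![(cexp (Real.pi * I * s / 2) * v 0 - cexp (-Real.pi * I * s / 2) * v 1) / detE s,
    (cexp (Real.pi * I * s / 2) * v 1 - cexp (-Real.pi * I * s / 2) * v 0) / detE s]

theorem detE_eq (s : ℂ) : detE s = cexp (Real.pi * I * s / 2) * cexp (Real.pi * I * s / 2) -
    cexp (-Real.pi * I * s / 2) * cexp (-Real.pi * I * s / 2) := by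
  rw [detE, ← Complex.exp_add, ← Complex.exp_add]
  congr 2 <;> ring

theorem E_mulVec_solveE {s : ℂ} (hs : detE s ≠ 0) (v : Fin 2 → ℂ) : E s *ᵥ solveE s v = v := by
  have h := detE_eq s
  ext i
  fin_cases i
  · simp only [E, solveE, Matrix.mulVec, dotProduct, Fin.sum_univ_two, Matrix.of_apply,
      Matrix.cons_val', Matrix.cons_val_zero, Matrix.cons_val_one, Matrix.cons_val_fin_one,
      Fin.zero_eta]
    rw [← mul_div_assoc, ← mul_div_assoc, ← add_div, div_eq_iff hs, h]; ring
  · simp only [E, solveE, Matrix.mulVec, dotProduct, Fin.sum_univ_two, Matrix.of_apply,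
      Matrix.cons_val', Matrix.cons_val_zero, Matrix.cons_val_one, Matrix.cons_val_fin_one,
      Fin.mk_one]
    rw [← mul_div_assoc, ← mul_div_assoc, ← add_div, div_eq_iff hs, h]; ring

theorem solveE_E_mulVec {s : ℂ} (hs : detE s ≠ 0) (v : Fin 2 → ℂ) : solveE s (E s *ᵥ v) = v := by
  have h := detE_eq s
  ext i
  fin_cases i
  · simp only [E, solveE, Matrix.mulVec, dotProduct, Fin.sum_univ_two, Matrix.of_apply,
      Matrix.cons_val', Matrix.cons_val_zero, Matrix.cons_val_one, Matrix.cons_val_fin_one,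
      Fin.zero_eta]
    rw [div_eq_iff hs, h]; ring
  · simp only [E, solveE, Matrix.mulVec, dotProduct, Fin.sum_univ_two, Matrix.of_apply,
      Matrix.cons_val', Matrix.cons_val_zero, Matrix.cons_val_one, Matrix.cons_val_fin_one,
      Fin.mk_one]
    rw [div_eq_iff hs, h]; ring

theorem detE_int (n : ℤ) : detE n = 0 := by
  rw [detE, sub_eq_zero, Complex.exp_eq_exp_iff_exists_int]
  exact ⟨n, by ring⟩

theorem ne_neg_nat_of_detE_ne_zero {s : ℂ} (hs : detE s ≠ 0) (n : ℕ) : s ≠ -n := by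
  rintro rfl
  exact hs (by simpa using detE_int (-(n : ℤ)))

theorem differentiable_detE : Differentiable ℂ detE := by unfold detE; fun_prop

theorem norm_cexp_pi_mul (s : ℂ) (c : ℝ) : ‖cexp (c * I * s)‖ = Real.exp (-(c * s.im)) := by
  rw [Complex.norm_exp]
  simp

theorem le_norm_detE (s : ℂ) :
    Real.exp (Real.pi * |s.im|) - Real.exp (-(Real.pi * |s.im|)) ≤ ‖detE s‖ := by
  have h1 := norm_cexp_pi_mul s Real.pi
  have h2 := norm_cexp_pi_mul s (-Real.pi)
  rw [Complex.ofReal_neg] at h2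
  have h3 := abs_norm_sub_norm_le (cexp (Real.pi * I * s)) (cexp (-Real.pi * I * s))
  rw [h1, h2] at h3
  rw [detE]
  refine le_trans ?_ h3
  rcases le_total 0 s.im with h | h
  · rw [abs_of_nonneg h, abs_sub_comm]
    refine le_trans (le_of_eq ?_) (le_abs_self _)
    congr 2; ring
  · rw [abs_of_nonpos h]
    refine le_trans (le_of_eq ?_) (le_abs_self _)
    congr 2 <;> ring

theorem norm_solveE_le {s : ℂ} (hs : 1 ≤ |s.im|) {v : Fin 2 → ℂ} {M : ℝ} (hv : ∀ i, ‖v i‖ ≤ M)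
    (i : Fin 2) : ‖solveE s v i‖ ≤ 4 * M * Real.exp (-(Real.pi * |s.im| / 2)) := by
  have hM : 0 ≤ M := (norm_nonneg _).trans (hv 0)
  set y := Real.pi * |s.im| with hy
  have hy1 : 1 ≤ y := by nlinarith [Real.pi_gt_three]
  have he1 : ‖cexp (Real.pi * I * s / 2)‖ ≤ Real.exp (y / 2) := by
    have := norm_cexp_pi_mul s (Real.pi / 2)
    have h2 : (((Real.pi / 2 : ℝ) : ℂ) * I * s) = Real.pi * I * s / 2 := by push_cast; ring
    rw [h2] at this
    rw [this, hy]
    refine Real.exp_le_exp.2 ?_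
    nlinarith [neg_abs_le s.im, Real.pi_pos]
  have he2 : ‖cexp (-Real.pi * I * s / 2)‖ ≤ Real.exp (y / 2) := by
    have := norm_cexp_pi_mul s (-Real.pi / 2)
    have h2 : (((-Real.pi / 2 : ℝ) : ℂ) * I * s) = -Real.pi * I * s / 2 := by push_cast; ring
    rw [h2] at this
    rw [this, hy]
    refine Real.exp_le_exp.2 ?_
    nlinarith [le_abs_self s.im, Real.pi_pos]
  have hd : Real.exp y / 2 ≤ ‖detE s‖ := by
    refine le_trans ?_ (le_norm_detE s)
    rw [← hy]
    have h1 : Real.exp (-y) ≤ 1 := Real.exp_le_one_iff.2 (by linarith)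
    have h2 : y + 1 ≤ Real.exp y := Real.add_one_le_exp y
    linarith
  have hnum : ∀ u v : ℂ, ‖u‖ ≤ M → ‖v‖ ≤ M →
      ‖(cexp (Real.pi * I * s / 2) * u - cexp (-Real.pi * I * s / 2) * v) / detE s‖ ≤
        4 * M * Real.exp (-(y / 2)) := fun u v hu hv => by
    have hy0 := Real.exp_pos y
    rw [norm_div, div_le_iff₀ (by linarith)]
    have h1 : ‖cexp (Real.pi * I * s / 2) * u - cexp (-Real.pi * I * s / 2) * v‖ ≤
        Real.exp (y / 2) * M + Real.exp (y / 2) * M := by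
      refine (norm_sub_le _ _).trans ?_
      rw [norm_mul, norm_mul]
      gcongr
    refine h1.trans ?_
    have h2 : Real.exp (y / 2) = Real.exp (-(y / 2)) * Real.exp y := by
      rw [← Real.exp_add]; congr 1; ring
    calc Real.exp (y / 2) * M + Real.exp (y / 2) * M
        = 4 * M * Real.exp (-(y / 2)) * (Real.exp y / 2) := by rw [h2]; ring
      _ ≤ _ := by gcongr
  fin_cases i
  · exact hnum _ _ (hv 0) (hv 1)
  · exact hnum _ _ (hv 1) (hv 0)

end Pair

/-! ### The completed Dirichlet series attached to an automorphic pair -/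

theorem eventually_codiscrete_iff {p : ℂ → Prop} :
    (∀ᶠ s in codiscrete ℂ, p s) ↔ ∀ x, ∀ᶠ s in 𝓝[≠] x, p s := by
  simp only [Filter.Eventually, mem_codiscrete, disjoint_principal_right, compl_compl]

theorem eventually_codiscrete_ne_zero {F : ℂ → ℂ} (hF : Differentiable ℂ F) {c : ℂ}
    (hc : F c ≠ 0) : ∀ᶠ s in codiscrete ℂ, F s ≠ 0 :=
  AnalyticOnNhd.preimage_zero_mem_codiscrete (fun z _ => hF.analyticAt z) hc

theorem detE_I_ne_zero : detE I ≠ 0 := by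
  rw [← norm_pos_iff]
  refine lt_of_lt_of_le ?_ (le_norm_detE I)
  rw [I_im, abs_one, mul_one, sub_pos, Real.exp_lt_exp]
  linarith [Real.pi_pos]

theorem eventually_codiscrete_detE_ne_zero (ν : ℂ) :
    ∀ᶠ s in codiscrete ℂ, detE s ≠ 0 ∧ detE (1 - 2 * ν - s) ≠ 0 := by
  refine (eventually_codiscrete_ne_zero differentiable_detE detE_I_ne_zero).and
    (eventually_codiscrete_ne_zero (F := fun s => detE (1 - 2 * ν - s)) (c := 1 - 2 * ν - I)
      (differentiable_detE.comp (by fun_prop)) ?_)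
  rw [sub_sub_cancel]
  exact detE_I_ne_zero

theorem detE_zero : detE 0 = 0 := by simpa using detE_int 0

theorem ne_zero_of_detE_ne_zero {s : ℂ} (hs : detE s ≠ 0) : s ≠ 0 := by
  rintro rfl; exact hs detE_zero

theorem meromorphic_of_differentiable {F : ℂ → ℂ} (hF : Differentiable ℂ F) : Meromorphic F :=
  fun x => (hF.analyticAt x).meromorphicAt

theorem meromorphic_polarPart (μ ν a₁ a₂ : ℂ) (i : Fin 2) :
    Meromorphic fun s => polarPart μ ν a₁ a₂ s i := by
  simp only [polarPart_eq, Pi.sub_apply, Pi.smul_apply, smul_eq_mul]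
  have hc : ∀ c : ℂ, Meromorphic fun _ : ℂ => c := fun c =>
    meromorphic_of_differentiable (differentiable_const c)
  exact (((hc a₁).div (meromorphic_of_differentiable differentiable_id)).mul (hc _)).sub
    (((hc a₂).div (meromorphic_of_differentiable
      (by fun_prop : Differentiable ℂ fun s : ℂ => s + 2 * ν - 1))).mul (hc _))

theorem meromorphic_solveE {A : ℂ → Fin 2 → ℂ} (hA : ∀ i, Meromorphic fun s => A s i) (i : Fin 2) :
    Meromorphic fun s => solveE s (A s) i := by
  have h1 : Meromorphic fun s : ℂ => cexp (Real.pi * I * s / 2) :=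
    meromorphic_of_differentiable (by fun_prop)
  have h2 : Meromorphic fun s : ℂ => cexp (-Real.pi * I * s / 2) :=
    meromorphic_of_differentiable (by fun_prop)
  have hd := meromorphic_of_differentiable differentiable_detE
  fin_cases i
  · exact ((h1.mul (hA 0)).sub (h2.mul (hA 1))).div hd
  · exact ((h1.mul (hA 1)).sub (h2.mul (hA 0))).div hd

open Classical in
/-- The completed functions on the half-planes of absolute convergence, continued elsewhere by
`E(s)⁻¹ A(s)`. The two formulas agree off a discrete set; the first is kept where it makes sense
because at a zero of `det E(s)` the second has no meaning. -/
def continuation {L : Set ℝ} (α : L → ℂ) (A : ℂ → Fin 2 → ℂ) (s : ℂ) : Fin 2 → ℂ :=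
  if ∃ r : ℝ, HasGrowth α r ∧ r + 1 < s.re then completed α s else solveE s (A s)

section Pair

variable {L₁ L₂ : Set ℝ} {μ ν : ℂ} {α₁ : L₁ → ℂ} {α₂ : L₂ → ℂ} {r₁ r₂ : ℝ}
  {R R₁ R₂ : ℂ → Fin 2 → ℂ}

/-- The function `R(s)` minus the polar part, that is, the continuation of `E(s) Ξ(α₁; s)`. -/
def unregularized (μ ν : ℂ) (α₁ : L₁ → ℂ) (α₂ : L₂ → ℂ) (R : ℂ → Fin 2 → ℂ) (s : ℂ) :
    Fin 2 → ℂ :=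
  R s - polarPart μ ν (valueAtZero α₁) (valueAtZero α₂) s

theorem continuation_eq_solveE (hL₁ : IsShiftedLattice L₁) (hR : IsRegularization μ ν α₁ α₂ R)
    {s : ℂ} (hs : detE s ≠ 0) (hs' : s ≠ 1 - 2 * ν) :
    continuation α₁ (unregularized μ ν α₁ α₂ R) s =
      solveE s (unregularized μ ν α₁ α₂ R s) := by
  unfold continuation
  split_ifs with h
  · obtain ⟨r, hr, hrs⟩ := h
    rw [unregularized, hR.eq_completed hL₁ hr hrs (ne_neg_nat_of_detE_ne_zero hs) hs',
      add_sub_cancel_right, solveE_E_mulVec hs]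
  · rfl

theorem isMeromorphicContinuation (hL₁ : IsShiftedLattice L₁)
    (hR : IsRegularization μ ν α₁ α₂ R) :
    IsMeromorphicContinuation α₁ (continuation α₁ (unregularized μ ν α₁ α₂ R)) where
  meromorphic i := by
    have hA : ∀ i, Meromorphic fun s => unregularized μ ν α₁ α₂ R s i := fun i =>
      (meromorphic_of_differentiable (differentiable_pi.1 hR.1 i)).sub
        (meromorphic_polarPart μ ν _ _ i)
    refine (meromorphic_solveE hA i).congr_codiscrete ?_
    filter_upwards [eventually_codiscrete_detE_ne_zero ν] with s hs
    rw [continuation_eq_solveE hL₁ hR hs.1]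
    exact fun h => ne_zero_of_detE_ne_zero hs.2 (by rw [h, sub_self])
  eq_completed r hr s hs _ := if_pos ⟨r, hr, hs⟩

theorem one_add_pow_le_exp_sqrt (k : ℕ) {M : ℝ} (hM : 0 ≤ M) {y : ℝ} (hy : 0 ≤ y) :
    (1 + (M + y)) ^ k ≤
      (1 + M) ^ k * ((2 * k).factorial * Real.exp 1) * Real.exp √y := by
  have hu : 0 ≤ √y := Real.sqrt_nonneg y
  have hsq : √y * √y = y := Real.mul_self_sqrt hy
  have h1 : 1 + (M + y) ≤ (1 + M) * (1 + √y) ^ 2 := by nlinarith [mul_nonneg hM hu, mul_nonneg hM hy]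
  have h2 := Real.pow_div_factorial_le_exp (1 + √y) (by linarith) (2 * k)
  rw [div_le_iff₀ (by positivity), Real.exp_add] at h2
  calc (1 + (M + y)) ^ k ≤ ((1 + M) * (1 + √y) ^ 2) ^ k := by gcongr
    _ = (1 + M) ^ k * (1 + √y) ^ (2 * k) := by rw [mul_pow, ← pow_mul]
    _ ≤ (1 + M) ^ k * (Real.exp 1 * Real.exp √y * (2 * k).factorial) := by gcongr
    _ = _ := by ring

theorem eventually_stripInfty (σ₁ σ₂ T : ℝ) :
    ∀ᶠ s in stripInfty σ₁ σ₂, (σ₁ ≤ s.re ∧ s.re ≤ σ₂) ∧ T ≤ |s.im| := by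
  have h1 : ∀ᶠ s in stripInfty σ₁ σ₂, σ₁ ≤ s.re ∧ s.re ≤ σ₂ :=
    mem_inf_of_right (mem_principal_self _)
  have h2 : ∀ᶠ s : ℂ in stripInfty σ₁ σ₂, T + (|σ₁| + |σ₂|) ≤ ‖s‖ :=
    Filter.Eventually.filter_mono inf_le_left
      (tendsto_norm_cobounded_atTop.eventually_ge_atTop _)
  filter_upwards [h1, h2] with s hs hn
  refine ⟨hs, ?_⟩
  have h3 := norm_le_abs_re_add_abs_im s
  have h4 : |s.re| ≤ |σ₁| + |σ₂| := by
    rw [abs_le]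
    constructor <;> linarith [neg_abs_le σ₁, le_abs_self σ₂, abs_nonneg σ₁, abs_nonneg σ₂]
  linarith

theorem stripBound_continuation (hL₁ : IsShiftedLattice L₁)
    (hL₂ : IsShiftedLattice L₂) (h₁ : HasGrowth α₁ r₁) (h₂ : HasGrowth α₂ r₂)
    (hT : ∀ f : TestRx, fourierSeries α₁ f.toTestR = fourierSeries α₂ (pullback μ ν f).toTestR)
    (hR : IsRegularization μ ν α₁ α₂ R) :
    StripBound (continuation α₁ (unregularized μ ν α₁ α₂ R)) := by
  intro σ₁ σ₂ _ i
  obtain ⟨k, C, hC0, hC⟩ := hR.exists_norm_sub_polarPart_le hL₁ hL₂ h₁ h₂ hT σ₁ σ₂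
  set M := |σ₁| + |σ₂| with hM
  have hM0 : 0 ≤ M := by positivity
  refine IsBigO.of_bound (4 * (C * ((1 + M) ^ k * ((2 * k).factorial * Real.exp 1)))) ?_
  filter_upwards [eventually_stripInfty σ₁ σ₂ (1 + 2 * ‖ν‖)] with s hs
  obtain ⟨⟨hs1, hs2⟩, hs3⟩ := hs
  have him : 1 ≤ |s.im| := by linarith [norm_nonneg ν]
  obtain ⟨hn1, hn2⟩ := one_le_norm_of_abs_im hs3
  have hdet : detE s ≠ 0 := by
    rw [← norm_pos_iff]
    refine lt_of_lt_of_le ?_ (le_norm_detE s)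
    rw [sub_pos, Real.exp_lt_exp]
    have : 0 < Real.pi * |s.im| := by positivity
    linarith
  have hs' : s ≠ 1 - 2 * ν := by rintro rfl; simp at hn2; linarith
  rw [continuation_eq_solveE hL₁ hR hdet hs']
  refine (norm_solveE_le him (hC s hs1 hs2 hs3) i).trans ?_
  have hre : |s.re| ≤ M := by
    rw [abs_le]
    constructor <;> linarith [neg_abs_le σ₁, le_abs_self σ₂, abs_nonneg σ₁, abs_nonneg σ₂]
  have hpow : (1 + ‖s‖) ^ k ≤
      (1 + M) ^ k * ((2 * k).factorial * Real.exp 1) * Real.exp √|s.im| := by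
    refine le_trans ?_ (one_add_pow_le_exp_sqrt k hM0 (abs_nonneg s.im))
    have := norm_le_abs_re_add_abs_im s
    gcongr
    linarith
  rw [Real.norm_of_nonneg (Real.exp_nonneg _), Real.exp_add]
  have he : -Real.pi * |s.im| / 2 = -(Real.pi * |s.im| / 2) := by ring
  rw [he]
  calc 4 * (C * (1 + ‖s‖) ^ k) * Real.exp (-(Real.pi * |s.im| / 2))
      ≤ 4 * (C * ((1 + M) ^ k * ((2 * k).factorial * Real.exp 1) * Real.exp √|s.im|)) *
          Real.exp (-(Real.pi * |s.im| / 2)) := by gcongr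
    _ = _ := by ring

theorem exists_analyticCondition (hL₁ : IsShiftedLattice L₁)
    (hL₂ : IsShiftedLattice L₂) (h₁ : HasGrowth α₁ r₁) (h₂ : HasGrowth α₂ r₂)
    (hT : ∀ f : TestRx, fourierSeries α₁ f.toTestR = fourierSeries α₂ (pullback μ ν f).toTestR) :
    ∃ X₁ X₂ : ℂ → Fin 2 → ℂ,
      AnalyticCondition α₁ α₂ μ ν X₁ X₂ ∧ StripBound X₁ ∧ StripBound X₂ := by
  have hT' := pullback_invariance_symm hT
  obtain ⟨R₁, hR₁⟩ : ∃ R, IsRegularization μ ν α₁ α₂ R :=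
    exists_regularization hL₁ hL₂ h₁ h₂ hT
  obtain ⟨R₂, hR₂⟩ : ∃ R, IsRegularization μ ν α₂ α₁ R :=
    exists_regularization hL₂ hL₁ h₂ h₁ hT'
  refine ⟨continuation α₁ (unregularized μ ν α₁ α₂ R₁),
    continuation α₂ (unregularized μ ν α₂ α₁ R₂), ⟨isMeromorphicContinuation hL₁ hR₁,
      isMeromorphicContinuation hL₂ hR₂, ⟨R₁, hR₁.1, ?_⟩, ?_⟩,
    stripBound_continuation hL₁ hL₂ h₁ h₂ hT hR₁, stripBound_continuation hL₂ hL₁ h₂ h₁ hT' hR₂⟩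
  · filter_upwards [eventually_codiscrete_detE_ne_zero ν] with s hs
    have hs' : s ≠ 1 - 2 * ν := fun h => ne_zero_of_detE_ne_zero hs.2 (by rw [h, sub_self])
    rw [regularized_eq, continuation_eq_solveE hL₁ hR₁ hs.1 hs', E_mulVec_solveE hs.1,
      unregularized, sub_add_cancel]
  · filter_upwards [eventually_codiscrete_detE_ne_zero ν] with s hs
    have hs0 := ne_zero_of_detE_ne_zero hs.1
    have hs' : s ≠ 1 - 2 * ν := fun h => ne_zero_of_detE_ne_zero hs.2 (by rw [h, sub_self])
    have e : -s - 2 * ν + 1 = 1 - 2 * ν - s := by ring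
    rw [e, continuation_eq_solveE hL₁ hR₁ hs.1 hs', E_mulVec_solveE hs.1,
      continuation_eq_solveE hL₂ hR₂ hs.2 (fun h => hs0 (by linear_combination -h)),
      E_mulVec_solveE hs.2]
    exact IsRegularization.functional_equation hL₁ hL₂ h₁ h₂ hT hR₁ hR₂ hs0 hs'

end Pair

/-! ### Shifting a vertical contour across simple poles -/

theorem tendsto_integral_inv_of_pos {w : ℂ} (hw : 0 < w.re) :
    Tendsto (fun T : ℝ => ∫ y in (-T)..T, (w + y * I)⁻¹) atTop (𝓝 (Real.pi : ℂ)) := by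
  have hne : ∀ y : ℝ, w + y * I ∈ slitPlane := fun y => Or.inl (by simpa using hw)
  have hd : ∀ y : ℝ, HasDerivAt (fun y : ℝ => -I * Complex.log (w + y * I)) (w + y * I)⁻¹ y := by
    intro y
    have h1 : HasDerivAt (fun z : ℂ => w + z * I) I (y : ℂ) := by
      simpa using ((hasDerivAt_id (y : ℂ)).mul_const I).const_add w
    have h2 := ((h1.clog (hne y)).const_mul (-I)).comp_ofReal
    refine h2.congr_deriv ?_
    rw [div_eq_mul_inv, ← mul_assoc, neg_mul, I_mul_I, neg_neg, one_mul]
  have hcont : Continuous fun y : ℝ => (w + y * I)⁻¹ :=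
    Continuous.inv₀ (by fun_prop) fun y => slitPlane_ne_zero (hne y)
  have heq : ∀ T : ℝ, ∫ y in (-T)..T, (w + y * I)⁻¹ =
      -I * Complex.log (w + T * I) - -I * Complex.log (w + ((-T : ℝ) : ℂ) * I) := fun T =>
    intervalIntegral.integral_eq_sub_of_hasDerivAt (fun y _ => hd y)
      (hcont.intervalIntegrable _ _)
  -- After removing the common summand `log T`, the two logarithms tend to `log I` and `log (-I)`.
  have hlim : Tendsto (fun T : ℝ => -I * Complex.log (w * (T⁻¹ : ℝ) + I) -
      -I * Complex.log (w * (T⁻¹ : ℝ) + -I)) atTop (𝓝 (Real.pi : ℂ)) := by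
    have h0 : Tendsto (fun T : ℝ => w * ((T⁻¹ : ℝ) : ℂ)) atTop (𝓝 0) := by
      have := (continuous_ofReal.tendsto 0).comp tendsto_inv_atTop_zero
      simpa using this.const_mul w
    have h1 : Tendsto (fun T : ℝ => w * ((T⁻¹ : ℝ) : ℂ) + I) atTop (𝓝 I) := by
      simpa using h0.add_const I
    have h2 : Tendsto (fun T : ℝ => w * ((T⁻¹ : ℝ) : ℂ) + -I) atTop (𝓝 (-I)) := by
      simpa using h0.add_const (-I)
    have h3 := (h1.clog (Or.inr (by simp))).const_mul (-I)
    have h4 := (h2.clog (Or.inr (by simp))).const_mul (-I)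
    have h5 := h3.sub h4
    rw [log_I, log_neg_I] at h5
    convert h5 using 2
    linear_combination (Real.pi : ℂ) * I_mul_I
  refine hlim.congr' ?_
  filter_upwards [eventually_gt_atTop 0] with T hT
  have hT0 : (T : ℂ) ≠ 0 := by exact_mod_cast hT.ne'
  have hre : 0 < w.re * T⁻¹ := by positivity
  have h1 : w + T * I = T * (w * (T⁻¹ : ℝ) + I) := by push_cast; field_simp
  have h2 : w + ((-T : ℝ) : ℂ) * I = T * (w * (T⁻¹ : ℝ) + -I) := by push_cast; field_simp
  have hn1 : w * ((T⁻¹ : ℝ) : ℂ) + I ≠ 0 := fun h => by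
    have := congrArg re h
    rw [add_re, re_mul_ofReal, I_re, zero_re] at this
    linarith
  have hn2 : w * ((T⁻¹ : ℝ) : ℂ) + -I ≠ 0 := fun h => by
    have := congrArg re h
    rw [add_re, re_mul_ofReal, neg_re, I_re, zero_re] at this
    linarith
  rw [heq, h1, h2, log_ofReal_mul hT hn1, log_ofReal_mul hT hn2]
  ring

theorem tendsto_integral_inv_of_neg {w : ℂ} (hw : w.re < 0) :
    Tendsto (fun T : ℝ => ∫ y in (-T)..T, (w + y * I)⁻¹) atTop (𝓝 (-(Real.pi : ℂ))) := by
  have h := (tendsto_integral_inv_of_pos (w := -w) (by simpa using hw)).neg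
  refine h.congr fun T => ?_
  rw [← intervalIntegral.integral_neg, ← neg_neg T, ← intervalIntegral.integral_comp_neg, neg_neg]
  refine intervalIntegral.integral_congr fun y _ => ?_
  rw [← inv_neg]
  congr 1
  push_cast; ring

/-- Vertical line integrals of `Z(s) - p₁ / s + p₂ / (s - q)`, with `Z` entire, on two sides of
the poles `0` and `q`. -/
theorem integral_vertical_sub_eq {Z : ℂ → ℂ} (hZ : Differentiable ℂ Z) {p₁ p₂ q : ℂ} {a b : ℝ}
    (ha : a < 0) (hb : 0 < b) (haq : a < q.re) (hbq : q.re < b)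
    (N : ℂ → ℂ) (hN : ∀ s, N s = Z s - p₁ / s + p₂ / (s - q))
    (hdecay : ∀ ε : ℝ, 0 < ε → ∃ T₀ : ℝ, ∀ s : ℂ, a ≤ s.re → s.re ≤ b → T₀ ≤ |s.im| → ‖N s‖ ≤ ε)
    (hia : Integrable fun y : ℝ => N (a + y * I)) (hib : Integrable fun y : ℝ => N (b + y * I)) :
    (∫ y : ℝ, N (b + y * I)) - ∫ y : ℝ, N (a + y * I) = 2 * Real.pi * (p₂ - p₁) := by
  have hab : a < b := ha.trans hb
  have hZN : ∀ s, Z s = N s + p₁ / s - p₂ / (s - q) := fun s => by rw [hN]; ring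
  -- The horizontal sides contribute nothing in the limit.
  have hhor : ∀ e : ℝ, |e| = 1 → Tendsto
      (fun T : ℝ => ∫ x in a..b, Z (x + (e * T : ℝ) * I)) atTop (𝓝 0) := by
    intro e he
    rw [Metric.tendsto_nhds]
    intro ε hε
    set δ := ε / (2 * (b - a)) with hδ
    have hba : 0 < b - a := by linarith
    have hδ0 : 0 < δ := by positivity
    obtain ⟨T₀, hT₀⟩ := hdecay (δ / 3) (by positivity)
    have hinv : ∀ p c : ℂ, ∃ T₁ : ℝ, ∀ s : ℂ, T₁ ≤ |s.im| → ‖p / (s - c)‖ ≤ δ / 3 := by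
      intro p c
      refine ⟨|c.im| + (‖p‖ + 1) / (δ / 3), fun s hs => ?_⟩
      have h1 : (‖p‖ + 1) / (δ / 3) ≤ ‖s - c‖ := by
        refine le_trans ?_ (abs_im_le_norm _)
        rw [sub_im]
        linarith [abs_sub_abs_le_abs_sub s.im c.im]
      have h2 : 0 < ‖s - c‖ := lt_of_lt_of_le (by positivity) h1
      rw [norm_div, div_le_iff₀ h2]
      rw [div_le_iff₀ (by positivity)] at h1
      linarith
    obtain ⟨T₁, hT₁⟩ := hinv p₁ 0
    obtain ⟨T₂, hT₂⟩ := hinv p₂ q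
    filter_upwards [eventually_ge_atTop (max (max T₀ T₁) T₂), eventually_ge_atTop 0] with T hT hT0
    rw [dist_zero_right]
    have hbound : ∀ x ∈ uIoc a b, ‖Z (x + (e * T : ℝ) * I)‖ ≤ δ := by
      intro x hx
      rw [uIoc_of_le hab.le] at hx
      set s : ℂ := x + (e * T : ℝ) * I with hs
      have hre : s.re = x := by simp [hs]
      have him : |s.im| = T := by
        have : s.im = e * T := by simp [hs]
        rw [this, abs_mul, he, one_mul, abs_of_nonneg hT0]
      have h0 := hT₀ s (by rw [hre]; exact hx.1.le) (by rw [hre]; exact hx.2)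
        (by rw [him]; exact ((le_max_left _ _).trans (le_max_left _ _)).trans hT)
      have h1 := hT₁ s (by rw [him]; exact ((le_max_right _ _).trans (le_max_left _ _)).trans hT)
      have h2 := hT₂ s (by rw [him]; exact (le_max_right _ _).trans hT)
      rw [sub_zero] at h1
      rw [hZN]
      refine (norm_sub_le _ _).trans ?_
      refine (add_le_add (norm_add_le _ _) le_rfl).trans ?_
      linarith
    refine (intervalIntegral.norm_integral_le_of_norm_le_const hbound).trans_lt ?_
    rw [abs_of_pos hba, hδ]
    field_simp
    linarith
  have hrect : ∀ T : ℝ, (∫ y in (-T)..T, Z (b + y * I)) - ∫ y in (-T)..T, Z (a + y * I) =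
      I * ((∫ x in a..b, Z (x + ((-1) * T : ℝ) * I)) - ∫ x in a..b, Z (x + (1 * T : ℝ) * I)) := by
    intro T
    have h := integral_boundary_rect_eq_zero_of_differentiableOn Z (a + (-T : ℝ) * I)
      (b + (T : ℝ) * I) hZ.differentiableOn
    simp only [add_re, add_im, ofReal_re, ofReal_im, re_ofReal_mul, im_ofReal_mul, I_re, I_im,
      mul_zero, mul_one, add_zero, zero_add, smul_eq_mul] at h
    rw [neg_one_mul, one_mul]
    linear_combination (-I) * h + ((∫ y in (-T)..T, Z (b + y * I)) -
      ∫ y in (-T)..T, Z (a + y * I)) * I_mul_I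
  have hlim0 : Tendsto (fun T : ℝ => (∫ y in (-T)..T, Z (b + y * I)) -
      ∫ y in (-T)..T, Z (a + y * I)) atTop (𝓝 0) := by
    have h1 := ((hhor (-1) (by norm_num)).sub (hhor 1 (by norm_num))).const_mul I
    rw [sub_zero, mul_zero] at h1
    exact h1.congr fun T => (hrect T).symm
  have hline : ∀ c : ℝ, c ≠ 0 → c ≠ q.re → Integrable (fun y : ℝ => N (c + y * I)) →
      ∀ ℓ₁ ℓ₂ : ℂ, Tendsto (fun T : ℝ => ∫ y in (-T)..T, ((c : ℂ) + y * I)⁻¹) atTop (𝓝 ℓ₁) →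
      Tendsto (fun T : ℝ => ∫ y in (-T)..T, ((c - q : ℂ) + y * I)⁻¹) atTop (𝓝 ℓ₂) →
      Tendsto (fun T : ℝ => ∫ y in (-T)..T, Z (c + y * I)) atTop
        (𝓝 ((∫ y : ℝ, N (c + y * I)) + p₁ * ℓ₁ - p₂ * ℓ₂)) := by
    intro c hc hcq hi ℓ₁ ℓ₂ hℓ₁ hℓ₂
    have h1 := intervalIntegral_tendsto_integral hi tendsto_neg_atTop_atBot tendsto_id
    refine ((h1.add (hℓ₁.const_mul p₁)).sub (hℓ₂.const_mul p₂)).congr fun T => ?_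
    have hc1 : Continuous fun y : ℝ => ((c : ℂ) + y * I)⁻¹ := by
      refine Continuous.inv₀ (by fun_prop) fun y h => hc ?_
      simpa using congrArg re h
    have hc2 : Continuous fun y : ℝ => ((c - q : ℂ) + y * I)⁻¹ := by
      refine Continuous.inv₀ (by fun_prop) fun y h => hcq ?_
      have := congrArg re h
      simp at this
      linarith
    simp only [id]
    rw [← intervalIntegral.integral_const_mul, ← intervalIntegral.integral_const_mul,
      ← intervalIntegral.integral_add hi.intervalIntegrable
        ((hc1.intervalIntegrable _ _).const_mul p₁),
      ← intervalIntegral.integral_sub (hi.intervalIntegrable.add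
        ((hc1.intervalIntegrable _ _).const_mul p₁)) ((hc2.intervalIntegrable _ _).const_mul p₂)]
    refine intervalIntegral.integral_congr fun y _ => ?_
    rw [hZN, div_eq_mul_inv, div_eq_mul_inv]
    congr 3
    ring
  have hb' := hline b hb.ne' hbq.ne' hib _ _
    (tendsto_integral_inv_of_pos (w := b) (by simpa using hb))
    (tendsto_integral_inv_of_pos (w := b - q) (by simpa using hbq))
  have ha' := hline a ha.ne haq.ne hia _ _
    (tendsto_integral_inv_of_neg (w := a) (by simpa using ha))
    (tendsto_integral_inv_of_neg (w := a - q) (by simpa using haq))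
  have hfin := tendsto_nhds_unique hlim0 (hb'.sub ha')
  linear_combination -hfin

/-! ### Bounds on vertical lines and Mellin inversion -/

theorem norm_mellin_le (g : ℝ → ℂ) (s : ℂ) :
    ‖mellin g s‖ ≤ ∫ t in Ioi (0 : ℝ), t ^ (s.re - 1) * ‖g t‖ := by
  refine (norm_integral_le_integral_norm _).trans_eq (setIntegral_congr_fun measurableSet_Ioi ?_)
  intro t ht
  simp only
  rw [norm_smul, norm_cpow_eq_rpow_re_of_pos ht, sub_re, one_re]

theorem integrableOn_rpow_mul_norm {g : ℝ → ℂ} {c : ℝ} (h : MellinConvergent g c) :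
    IntegrableOn (fun t => t ^ (c - 1) * ‖g t‖) (Ioi 0) := by
  refine IntegrableOn.congr_fun (Integrable.norm h) (fun t ht => ?_) measurableSet_Ioi
  rw [norm_smul, norm_cpow_eq_rpow_re_of_pos ht, sub_re, one_re, ofReal_re]

/-- The Mellin transform of a test function is bounded in vertical strips. -/
theorem exists_norm_mellin_le (f : TestRx) (a b : ℝ) :
    ∃ C : ℝ, 0 ≤ C ∧ ∀ w : ℂ, a ≤ w.re → w.re ≤ b → ‖mellin f w‖ ≤ C := by
  have ha := integrableOn_rpow_mul_norm (f.mellinConvergent a)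
  have hb := integrableOn_rpow_mul_norm (f.mellinConvergent b)
  refine ⟨∫ t in Ioi (0 : ℝ), (t ^ (a - 1) * ‖f t‖ + t ^ (b - 1) * ‖f t‖),
    setIntegral_nonneg measurableSet_Ioi fun t ht => ?_, fun w hwa hwb => ?_⟩
  · have : (0 : ℝ) < t := ht
    positivity
  have hw := integrableOn_rpow_mul_norm (c := w.re) (f.mellinConvergent _)
  refine (norm_mellin_le _ _).trans (setIntegral_mono_on hw (ha.add hb) measurableSet_Ioi ?_)
  intro t ht
  have ht0 : (0 : ℝ) < t := ht
  rw [← add_mul]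
  refine mul_le_mul_of_nonneg_right ?_ (norm_nonneg _)
  rcases le_total 1 t with h | h
  · exact (Real.rpow_le_rpow_of_exponent_le h (by linarith)).trans
      (le_add_of_nonneg_left (by positivity))
  · exact (Real.rpow_le_rpow_of_exponent_ge ht0 h (by linarith)).trans
      (le_add_of_nonneg_right (by positivity))

theorem exists_norm_pair_le (f : TestRx) (a b : ℝ) :
    ∃ C : ℝ, 0 ≤ C ∧ ∀ s : ℂ, a ≤ s.re → s.re ≤ b → ∀ (v : Fin 2 → ℂ) (M : ℝ),
      (∀ i, ‖v i‖ ≤ M) → ‖pair f (1 - s) v‖ ≤ C * M := by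
  obtain ⟨C₁, hC₁0, hC₁⟩ := exists_norm_mellin_le f (1 - b) (1 - a)
  obtain ⟨C₂, hC₂0, hC₂⟩ := exists_norm_mellin_le (reflect f) (1 - b) (1 - a)
  refine ⟨C₁ + C₂, by positivity, fun s hsa hsb v M hv => ?_⟩
  have h1 : 1 - b ≤ (1 - s).re := by rw [sub_re, one_re]; linarith
  have h2 : (1 - s).re ≤ 1 - a := by rw [sub_re, one_re]; linarith
  rw [pair, add_mul]
  refine (norm_add_le _ _).trans ?_
  rw [norm_mul, norm_mul]
  exact add_le_add (mul_le_mul (hC₁ _ h1 h2) (hv 0) (norm_nonneg _) hC₁0)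
    (mul_le_mul (hC₂ _ h1 h2) (hv 1) (norm_nonneg _) hC₂0)

section Line

variable {L : Set ℝ} {α : L → ℂ} {r : ℝ} {k : ℕ} {c : ℝ}

theorem mellin_tailSum_euler (hL : IsShiftedLattice L) (h : HasGrowth α r) (f : TestRx) {s : ℂ}
    (hs : r + 1 < s.re) (hs0 : 0 < s.re) :
    mellin (tailSum α (euler f).toTestR) s = s * mellin (tailSum α f.toTestR) s := by
  rw [mellin_tailSum hL h _ hs hs0, mellin_tailSum hL h _ hs hs0, pair_euler]

theorem exists_norm_mellin_tailSum_le (α : L → ℂ) (f : TestR) (c : ℝ) :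
    ∃ C : ℝ, ∀ s : ℂ, s.re = c → ‖mellin (tailSum α f) s‖ ≤ C :=
  ⟨_, fun s hs => hs ▸ norm_mellin_le _ s⟩

theorem verticalIntegrable_mellin_tailSum (hL : IsShiftedLattice L) (h : HasGrowth α r)
    (hk : r + 1 < k) (hc : k < c) (hc1 : 1 ≤ c) (f : TestRx) :
    VerticalIntegrable (mellin (tailSum α f.toTestR)) c := by
  obtain ⟨C, hC⟩ := exists_norm_mellin_tailSum_le α (euler (euler f)).toTestR c
  have hre : ∀ y : ℝ, ((c : ℂ) + y * I).re = c := fun y => by simp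
  have him : ∀ y : ℝ, ((c : ℂ) + y * I).im = y := fun y => by simp
  have hcont : Continuous fun y : ℝ => mellin (tailSum α f.toTestR) (c + y * I) := by
    refine continuous_iff_continuousAt.2 fun y => ?_
    refine ContinuousAt.comp (f := fun y : ℝ => (c : ℂ) + y * I) (x := y)
      (differentiableAt_mellin_tailSum hL h f.toTestR hk (by rwa [hre])).continuousAt ?_
    fun_prop
  refine (integrable_inv_one_add_sq.const_mul C).mono' hcont.aestronglyMeasurable
    (Eventually.of_forall fun y => ?_)
  have h1 := hC (c + y * I) (hre y)
  have hs : r + 1 < ((c : ℂ) + y * I).re := by rw [hre]; linarith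
  have hs0 : 0 < ((c : ℂ) + y * I).re := by rw [hre]; linarith
  rw [mellin_tailSum_euler hL h _ hs hs0, mellin_tailSum_euler hL h _ hs hs0, ← mul_assoc,
    norm_mul, norm_mul, Complex.norm_mul_self_eq_normSq, normSq_apply, hre, him] at h1
  have h2 : 0 < 1 + y ^ 2 := by positivity
  rw [← div_eq_mul_inv, le_div_iff₀ h2]
  have h3 : 1 + y ^ 2 ≤ c * c + y * y := by nlinarith
  rw [mul_comm]
  exact (mul_le_mul_of_nonneg_right h3 (norm_nonneg _)).trans h1

theorem integral_mellin_tailSum (hL : IsShiftedLattice L) (h : HasGrowth α r)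
    (hk : r + 1 < k) (hc : k < c) (hc1 : 1 ≤ c) (f : TestRx) :
    ∫ y : ℝ, mellin (tailSum α f.toTestR) (c + y * I) =
      2 * Real.pi * tailSum α f.toTestR 1 := by
  have hinv := mellinInv_mellin_eq c (tailSum α f.toTestR) one_pos
    (mellinConvergent_tailSum hL h f.toTestR hk (by simpa using hc))
    (verticalIntegrable_mellin_tailSum hL h hk hc hc1 f)
    ((continuousOn_tailSum hL h f.toTestR).continuousAt (Ioi_mem_nhds one_pos))
  rw [← hinv, mellinInv]
  simp only [ofReal_one, one_cpow, one_smul]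
  rw [Complex.real_smul]
  push_cast
  generalize ∫ y : ℝ, mellin (tailSum α f.toTestR) (c + y * I) = A
  field_simp

end Line

/-! ### From Dirichlet series to automorphic pairs -/

theorem exists_norm_polarPart_le (μ ν a₁ a₂ : ℂ) :
    ∃ M : ℝ, 0 ≤ M ∧ ∀ s : ℂ, 1 ≤ ‖s‖ → 1 ≤ ‖s + 2 * ν - 1‖ →
      ∀ i, ‖polarPart μ ν a₁ a₂ s i‖ ≤ M := by
  have hcol : ∀ i : Fin 2, ‖(Sig μ *ᵥ ![1, 1]) i‖ ≤ ‖Sig μ *ᵥ ![1, 1]‖ := norm_le_pi_norm _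
  refine ⟨‖a₁‖ + ‖a₂‖ * ‖Sig μ *ᵥ ![1, 1]‖, by positivity, fun s h1 h2 i => ?_⟩
  have hone : ‖(![1, 1] : Fin 2 → ℂ) i‖ = 1 := by fin_cases i <;> simp
  have hdiv : ∀ x y : ℂ, 1 ≤ ‖y‖ → ‖x / y‖ ≤ ‖x‖ := fun x y hy => by
    rw [norm_div]; exact div_le_self (norm_nonneg _) hy
  rw [polarPart_eq, Pi.sub_apply, Pi.smul_apply, Pi.smul_apply, smul_eq_mul, smul_eq_mul]
  refine (norm_sub_le _ _).trans ?_
  rw [norm_mul, norm_mul, hone, mul_one]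
  exact add_le_add (hdiv _ _ h1)
    (mul_le_mul (hdiv _ _ h2) (hcol i) (norm_nonneg _) (norm_nonneg _))

theorem norm_E_mulVec_le {s : ℂ} {v : Fin 2 → ℂ} {M : ℝ} (hv : ∀ i, ‖v i‖ ≤ M) (i : Fin 2) :
    ‖(E s *ᵥ v) i‖ ≤ 2 * (Real.exp (Real.pi / 2 * |s.im|) * M) := by
  have hM : 0 ≤ M := (norm_nonneg _).trans (hv 0)
  have h1 : ‖cexp (Real.pi * I * s / 2)‖ ≤ Real.exp (Real.pi / 2 * |s.im|) := by
    have e : (Real.pi : ℂ) * I * s / 2 = ((Real.pi / 2 : ℝ) : ℂ) * I * s := by push_cast; ring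
    rw [e, norm_cexp_pi_mul, ← mul_neg]
    gcongr
    exact neg_le_abs _
  have h2 : ‖cexp (-Real.pi * I * s / 2)‖ ≤ Real.exp (Real.pi / 2 * |s.im|) := by
    have e : -(Real.pi : ℂ) * I * s / 2 = ((-(Real.pi / 2) : ℝ) : ℂ) * I * s := by
      push_cast; ring
    rw [e, norm_cexp_pi_mul, neg_mul, neg_neg]
    gcongr
    exact le_abs_self _
  have key : ∀ x y : ℂ, ‖x‖ ≤ Real.exp (Real.pi / 2 * |s.im|) →
      ‖y‖ ≤ Real.exp (Real.pi / 2 * |s.im|) →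
      ‖x * v 0 + y * v 1‖ ≤ 2 * (Real.exp (Real.pi / 2 * |s.im|) * M) := by
    intro x y hx hy
    refine (norm_add_le _ _).trans ?_
    rw [norm_mul, norm_mul, two_mul]
    exact add_le_add (mul_le_mul hx (hv 0) (norm_nonneg _) (Real.exp_nonneg _))
      (mul_le_mul hy (hv 1) (norm_nonneg _) (Real.exp_nonneg _))
  fin_cases i
  · simpa [E, Matrix.mulVec, dotProduct, Fin.sum_univ_two] using key _ _ h1 h2
  · simpa [E, Matrix.mulVec, dotProduct, Fin.sum_univ_two] using key _ _ h2 h1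

/-- A power of `b + y` is at most a constant times `exp (ε y)`, for every `ε > 0`. -/
theorem add_pow_le_mul_exp {b y ε : ℝ} (hb : 0 ≤ b) (hy : 0 ≤ y) (hε : 0 < ε) (n : ℕ) :
    (b + y) ^ n ≤ n.factorial / ε ^ n * Real.exp (ε * b) * Real.exp (ε * y) := by
  have h := Real.pow_div_factorial_le_exp (ε * (b + y)) (by positivity) n
  rw [div_le_iff₀ (by positivity), mul_pow, mul_add, Real.exp_add] at h
  rw [div_mul_eq_mul_div, div_mul_eq_mul_div, le_div_iff₀ (by positivity)]
  linarith

/-- Phragmén–Lindelöf: the pairing of a test function with an entire regularization of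
`E(s) X(s)` is bounded in a strip as soon as it is bounded on the two sides. -/
theorem norm_pair_le_of_weakStripBound {μ ν a₁ a₂ : ℂ} {X R : ℂ → Fin 2 → ℂ}
    (hR : Differentiable ℂ R)
    (hRX : ∀ᶠ s in codiscrete ℂ, regularized μ ν a₁ a₂ X s = R s)
    (hX : WeakStripBound X) {b : ℝ} (hb : 0 < b) (f : TestRx) {C : ℝ}
    (hleft : ∀ s : ℂ, s.re = -b → ‖pair f (1 - s) (R s)‖ ≤ C)
    (hright : ∀ s : ℂ, s.re = b → ‖pair f (1 - s) (R s)‖ ≤ C) {s : ℂ} (hs : -b ≤ s.re)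
    (hs' : s.re ≤ b) : ‖pair f (1 - s) (R s)‖ ≤ C := by
  have hd := differentiable_pair f hR
  refine PhragmenLindelof.vertical_strip (f := fun s => pair f (1 - s) (R s))
    hd.diffContOnCl ?_ hleft hright hs hs'
  obtain ⟨c₀, hc₀, hO⟩ := hX (-b) b (by linarith)
  obtain ⟨n, hn⟩ := exists_nat_ge (max c₀ 1)
  obtain ⟨D₀, hD₀⟩ := (hO 0).bound
  obtain ⟨D₁, hD₁⟩ := (hO 1).bound
  obtain ⟨M, hM0, hM⟩ := exists_norm_polarPart_le μ ν a₁ a₂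
  obtain ⟨Cf, hCf0, hCf⟩ := exists_norm_pair_le f (-b) b
  set D := max (max D₀ D₁) 0 with hD
  have hD00 : 0 ≤ D := le_max_right _ _
  set ε := Real.pi / (4 * b) with hε
  have hε0 : 0 < ε := by positivity
  set B := 3 * (n.factorial / ε ^ n * Real.exp (ε * b)) with hB
  refine ⟨ε, ?_, B, IsBigO.of_bound (Cf * (2 * D + M)) ?_⟩
  · rw [hε]
    exact div_lt_div_of_pos_left Real.pi_pos (by linarith) (by linarith)
  have hbig : ∃ T : ℝ, 1 + 2 * ‖ν‖ ≤ T ∧ ∀ z : ℂ, -b ≤ z.re → z.re ≤ b → T ≤ |z.im| →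
      ∀ i, ‖X z i‖ ≤ D * Real.exp (‖z‖ ^ c₀) := by
    have hev := hD₀.and hD₁
    rw [stripInfty, eventually_inf_principal, ← comap_norm_atTop, eventually_comap,
      eventually_atTop] at hev
    obtain ⟨T, hT⟩ := hev
    refine ⟨max T (1 + 2 * ‖ν‖), le_max_right _ _, fun z hz1 hz2 hz3 i => ?_⟩
    obtain ⟨h0, h1⟩ := hT ‖z‖ (((le_max_left _ _).trans hz3).trans (abs_im_le_norm z)) z rfl
      ⟨hz1, hz2⟩
    rw [Real.norm_of_nonneg (Real.exp_nonneg _)] at h0 h1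
    fin_cases i
    · refine h0.trans ?_
      gcongr
      exact (le_max_left _ _).trans (le_max_left _ _)
    · refine h1.trans ?_
      gcongr
      exact (le_max_right _ _).trans (le_max_left _ _)
  obtain ⟨T, hT1, hT⟩ := hbig
  -- The bound holds off a discrete set, hence everywhere in the open region by continuity.
  have hpt : ∀ z : ℂ, -b ≤ z.re → z.re ≤ b → T ≤ |z.im| → regularized μ ν a₁ a₂ X z = R z →
      ‖pair f (1 - z) (R z)‖ ≤ Cf * (2 * D + M) * Real.exp (B * Real.exp (ε * |z.im|)) := by
    intro z hz1 hz2 hz3 hz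
    obtain ⟨hn1, hn2⟩ := one_le_norm_of_abs_im (hT1.trans hz3)
    have hnorm : ‖z‖ ≤ b + |z.im| :=
      (norm_le_abs_re_add_abs_im z).trans (by gcongr; exact abs_le.2 ⟨hz1, hz2⟩)
    have hc : ‖z‖ ^ c₀ ≤ ‖z‖ ^ n := by
      rw [← Real.rpow_natCast]
      exact Real.rpow_le_rpow_of_exponent_le hn1 ((le_max_left _ _).trans hn)
    have hπ : Real.pi / 2 * |z.im| ≤ 2 * ‖z‖ ^ n := by
      have hn0 : n ≠ 0 := by
        rintro rfl
        have := (le_max_right _ _).trans hn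
        norm_num at this
      have h1 : ‖z‖ ≤ ‖z‖ ^ n := le_self_pow₀ hn1 hn0
      have h2 := abs_im_le_norm z
      have h3 : Real.pi / 2 * |z.im| ≤ 2 * |z.im| := by
        gcongr
        linarith [Real.pi_le_four]
      linarith
    have hexp : Real.exp (Real.pi / 2 * |z.im|) * Real.exp (‖z‖ ^ c₀) ≤
        Real.exp (B * Real.exp (ε * |z.im|)) := by
      rw [← Real.exp_add, Real.exp_le_exp]
      have h1 := add_pow_le_mul_exp hb.le (abs_nonneg z.im) hε0 n
      have h2 : ‖z‖ ^ n ≤ (b + |z.im|) ^ n := by gcongr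
      rw [hB]
      linarith
    have h1exp : 1 ≤ Real.exp (B * Real.exp (ε * |z.im|)) := Real.one_le_exp (by positivity)
    rw [mul_assoc]
    refine hCf z hz1 hz2 _ _ fun i => ?_
    rw [← hz, regularized_eq, Pi.add_apply]
    refine (norm_add_le _ _).trans ?_
    rw [add_mul]
    refine add_le_add ((norm_E_mulVec_le (hT z hz1 hz2 hz3) i).trans ?_)
      ((hM z hn1 hn2 i).trans (le_mul_of_one_le_right hM0 h1exp))
    calc _ = 2 * D * (Real.exp (Real.pi / 2 * |z.im|) * Real.exp (‖z‖ ^ c₀)) := by ring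
      _ ≤ _ := by gcongr
  rw [eventually_inf_principal]
  have hT' : ∀ᶠ z : ℂ in comap (_root_.abs ∘ im) atTop, T < |z.im| :=
    tendsto_comap.eventually (eventually_gt_atTop T)
  filter_upwards [hT'] with z hz hzs
  rw [Real.norm_of_nonneg (Real.exp_nonneg _)]
  have hopen : ∀ᶠ w : ℂ in 𝓝 z, -b < w.re ∧ w.re < b ∧ T < |w.im| :=
    (continuous_re.continuousAt.eventually_const_lt hzs.1).and
      ((continuous_re.continuousAt.eventually_lt_const hzs.2).and
        ((continuous_abs.comp continuous_im).continuousAt.eventually_const_lt hz))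
  have hev := (eventually_codiscrete_iff.1 hRX z).and (hopen.filter_mono nhdsWithin_le_nhds)
  refine le_of_tendsto_of_tendsto
    (hd.continuous.norm.continuousAt.tendsto.mono_left nhdsWithin_le_nhds)
    ((Continuous.continuousAt (by fun_prop :
      Continuous fun w : ℂ => Cf * (2 * D + M) *
        Real.exp (B * Real.exp (ε * |w.im|)))).tendsto.mono_left nhdsWithin_le_nhds)
    (hev.mono fun w hw => hpt w hw.2.1.le hw.2.2.1.le hw.2.2.2.le hw.1)

section Converse

variable {L₁ L₂ : Set ℝ} {μ ν : ℂ} {α₁ : L₁ → ℂ} {α₂ : L₂ → ℂ} {r₁ r₂ : ℝ}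
  {X₁ X₂ R : ℂ → Fin 2 → ℂ} {k : ℕ}

theorem eq_of_eventuallyEq_nhdsNE {F G : ℂ → ℂ} {p : ℂ} (hF : ContinuousAt F p)
    (hG : ContinuousAt G p) (h : ∀ᶠ s in 𝓝[≠] p, F s = G s) : F p = G p :=
  tendsto_nhds_unique (hF.tendsto.mono_left nhdsWithin_le_nhds)
    ((hG.tendsto.mono_left nhdsWithin_le_nhds).congr' (h.mono fun _ hs => hs.symm))

/-- The pairing of `f` with `R`, less the pairing with the polar part; off the two poles this is
`pair f (1 - s) (R s - polarPart s)`. -/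
def subPolarPairing (μ ν a₁ a₂ : ℂ) (R : ℂ → Fin 2 → ℂ) (f : TestRx) (s : ℂ) : ℂ :=
  pair f (1 - s) (R s) - polarRest μ ν a₁ a₂ f s - a₁ * fourier f.toTestR 0 / s +
    a₂ * fourier (pullback μ ν f).toTestR 0 / (s - (1 - 2 * ν))

theorem subPolarPairing_eq (μ ν a₁ a₂ : ℂ) (R : ℂ → Fin 2 → ℂ) (f : TestRx) {s : ℂ} (hs : s ≠ 0)
    (hs' : s ≠ 1 - 2 * ν) : subPolarPairing μ ν a₁ a₂ R f s =
      pair f (1 - s) (R s - polarPart μ ν a₁ a₂ s) := by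
  rw [subPolarPairing, polarRest_eq _ _ _ _ _ hs hs', pair_sub]
  have : s - (1 - 2 * ν) = s + 2 * ν - 1 := by ring
  rw [this]
  ring

theorem continuousAt_subPolarPairing (a₁ a₂ : ℂ) (hR : Differentiable ℂ R) (f : TestRx) {s : ℂ}
    (hs : s ≠ 0) (hs' : s ≠ 1 - 2 * ν) : ContinuousAt (subPolarPairing μ ν a₁ a₂ R f) s :=
  ((((differentiable_pair f hR).continuous.sub
    (differentiable_polarRest μ ν a₁ a₂ f).continuous).continuousAt.sub
      (continuousAt_const.div continuousAt_id hs)).add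
    (continuousAt_const.div (continuousAt_id.sub continuousAt_const) (sub_ne_zero.2 hs')))

theorem ne_neg_nat_of_re_pos {s : ℂ} (hs : 0 < s.re) (n : ℕ) : s ≠ -n := by
  rintro rfl
  rw [neg_re, natCast_re] at hs
  linarith [(Nat.cast_nonneg n : (0 : ℝ) ≤ n)]

theorem subPolarPairing_eq_mellin (hL₁ : IsShiftedLattice L₁) (h₁ : HasGrowth α₁ r₁)
    (hX : IsMeromorphicContinuation α₁ X₁) (hR : Differentiable ℂ R)
    (hRX : ∀ᶠ s in codiscrete ℂ,
      regularized μ ν (valueAtZero α₁) (valueAtZero α₂) X₁ s = R s)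
    (hk : r₁ + 1 < k) (f : TestRx) {s : ℂ} (hs : k < s.re) (hq : (1 - 2 * ν).re < s.re) :
    subPolarPairing μ ν (valueAtZero α₁) (valueAtZero α₂) R f s = mellin (tailSum α₁ f.toTestR) s := by
  have hpos : ∀ z : ℂ, k < z.re → 0 < z.re := fun z hz => (Nat.cast_nonneg k).trans_lt hz
  have hne : ∀ z : ℂ, k < z.re → z ≠ 0 := fun z hz h => by
    have := hpos z hz
    simp [h] at this
  have hne' : ∀ z : ℂ, (1 - 2 * ν).re < z.re → z ≠ 1 - 2 * ν := fun z hz h => by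
    rw [h] at hz; exact lt_irrefl _ hz
  refine eq_of_eventuallyEq_nhdsNE (continuousAt_subPolarPairing _ _ hR f (hne s hs) (hne' s hq))
    (differentiableAt_mellin_tailSum hL₁ h₁ f.toTestR hk hs).continuousAt ?_
  have hopen : ∀ᶠ z : ℂ in 𝓝 s, k < z.re ∧ (1 - 2 * ν).re < z.re :=
    (continuous_re.continuousAt.eventually_const_lt hs).and
      (continuous_re.continuousAt.eventually_const_lt hq)
  filter_upwards [eventually_codiscrete_iff.1 hRX s, hopen.filter_mono nhdsWithin_le_nhds]
    with z hz hz'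
  have hr : r₁ + 1 < z.re := hk.trans hz'.1
  rw [subPolarPairing_eq _ _ _ _ _ _ (hne z hz'.1) (hne' z hz'.2), ← hz, regularized_eq,
    add_sub_cancel_right, hX.eq_completed r₁ h₁ z hr (ne_neg_nat_of_re_pos (hpos z hz'.1)),
    mellin_tailSum hL₁ h₁ f hr (hpos z hz'.1)]

theorem subPolarPairing_eq_mellin_pullback (hL₂ : IsShiftedLattice L₂) (h₂ : HasGrowth α₂ r₂)
    (hX : IsMeromorphicContinuation α₂ X₂) (hR : Differentiable ℂ R)
    (hRX : ∀ᶠ s in codiscrete ℂ,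
      regularized μ ν (valueAtZero α₁) (valueAtZero α₂) X₁ s = R s)
    (hfe : ∀ᶠ s in codiscrete ℂ, E s *ᵥ X₁ s =
      Sig μ *ᵥ (E (-s - 2 * ν + 1) *ᵥ X₂ (-s - 2 * ν + 1)))
    (hk : r₂ + 1 < k) (f : TestRx) {s : ℂ} (hs : k < (1 - 2 * ν - s).re) (hq : s.re < 0) :
    subPolarPairing μ ν (valueAtZero α₁) (valueAtZero α₂) R f s =
      mellin (tailSum α₂ (pullback μ ν f).toTestR) (1 - 2 * ν - s) := by
  have hpos : ∀ z : ℂ, k < z.re → 0 < z.re := fun z hz => (Nat.cast_nonneg k).trans_lt hz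
  have hne : ∀ z : ℂ, z.re < 0 → z ≠ 0 := fun z hz h => by simp [h] at hz
  have hne' : ∀ z : ℂ, k < (1 - 2 * ν - z).re → z ≠ 1 - 2 * ν := fun z hz h => by
    have := hpos _ hz
    simp [h] at this
  have hsub : Continuous fun z : ℂ => 1 - 2 * ν - z := by fun_prop
  refine eq_of_eventuallyEq_nhdsNE (continuousAt_subPolarPairing _ _ hR f (hne s hq) (hne' s hs))
    (ContinuousAt.comp (f := fun z : ℂ => 1 - 2 * ν - z) (x := s)
      (differentiableAt_mellin_tailSum hL₂ h₂ (pullback μ ν f).toTestR hk hs).continuousAt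
      hsub.continuousAt) ?_
  have hopen : ∀ᶠ z : ℂ in 𝓝 s, k < (1 - 2 * ν - z).re ∧ z.re < 0 :=
    ((continuous_re.comp hsub).continuousAt.eventually_const_lt hs).and
      (continuous_re.continuousAt.eventually_lt_const hq)
  filter_upwards [eventually_codiscrete_iff.1 hRX s, eventually_codiscrete_iff.1 hfe s,
    hopen.filter_mono nhdsWithin_le_nhds] with z hz hfz hz'
  have hr : r₂ + 1 < (1 - 2 * ν - z).re := hk.trans hz'.1
  have e : -z - 2 * ν + 1 = 1 - 2 * ν - z := by ring
  have e' : 2 * ν + 1 - (1 - (1 - 2 * ν - z)) = 1 - z := by ring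
  rw [subPolarPairing_eq _ _ _ _ _ _ (hne z hz'.2) (hne' z hz'.1), ← hz, regularized_eq,
    add_sub_cancel_right, hfz, e,
    hX.eq_completed r₂ h₂ _ hr (ne_neg_nat_of_re_pos (hpos _ hz'.1)),
    Function.comp_apply, mellin_tailSum hL₂ h₂ _ hr (hpos _ hz'.1), pair_pullback, e']

/-- Since `s · pair f (1 - s) v = pair (euler f) (1 - s) v`, boundedness of all pairings with `R`
in a strip makes each of them decay there once the polar part is removed. -/
theorem subPolarPairing_decay {a₁ a₂ : ℂ} {a b : ℝ}
    (hbound : ∀ f : TestRx, ∃ C : ℝ, ∀ s : ℂ, a ≤ s.re → s.re ≤ b → ‖pair f (1 - s) (R s)‖ ≤ C)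
    (f : TestRx) {ε : ℝ} (hε : 0 < ε) : ∃ T₀ : ℝ, ∀ s : ℂ, a ≤ s.re → s.re ≤ b → T₀ ≤ |s.im| →
      ‖subPolarPairing μ ν a₁ a₂ R f s‖ ≤ ε := by
  obtain ⟨C, hC⟩ := hbound (euler f)
  obtain ⟨M, -, hM⟩ := exists_norm_polarPart_le μ ν a₁ a₂
  obtain ⟨D, -, hD⟩ := exists_norm_pair_le (euler f) a b
  refine ⟨max (1 + 2 * ‖ν‖) ((C + D * M) / ε), fun s hsa hsb hs => ?_⟩
  obtain ⟨hn1, hn2⟩ := one_le_norm_of_abs_im ((le_max_left _ _).trans hs)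
  have hs0 : s ≠ 0 := by rintro rfl; simp at hn1; linarith
  have hs1 : s ≠ 1 - 2 * ν := by rintro rfl; simp at hn2; linarith
  have h1 : ‖s‖ * ‖subPolarPairing μ ν a₁ a₂ R f s‖ ≤ C + D * M := by
    rw [subPolarPairing_eq _ _ _ _ _ _ hs0 hs1, ← norm_mul, ← pair_euler, pair_sub]
    exact (norm_sub_le _ _).trans
      (add_le_add (hC s hsa hsb) (hD s hsa hsb _ _ (hM s hn1 hn2)))
  have h2 : (C + D * M) / ε ≤ ‖s‖ := ((le_max_right _ _).trans hs).trans (abs_im_le_norm s)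
  rw [div_le_iff₀ hε] at h2
  exact le_of_mul_le_mul_left (h1.trans h2) (by linarith)

/-- The converse: the analytic condition and the growth of `X₁` force the two Fourier series to
correspond under `f ↦ f_{μ,ν,∞}`. -/
theorem fourierSeries_eq_fourierSeries_pullback (hL₁ : IsShiftedLattice L₁)
    (hL₂ : IsShiftedLattice L₂) (h₁ : HasGrowth α₁ r₁) (h₂ : HasGrowth α₂ r₂)
    (hX : AnalyticCondition α₁ α₂ μ ν X₁ X₂) (hb : WeakStripBound X₁) (f : TestRx) :
    fourierSeries α₁ f.toTestR = fourierSeries α₂ (pullback μ ν f).toTestR := by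
  obtain ⟨R, hR, hRX⟩ := hX.entire
  obtain ⟨k, hk⟩ := exists_nat_gt (max (r₁ + 1) (r₂ + 1))
  have hk₁ : r₁ + 1 < k := (le_max_left _ _).trans_lt hk
  have hk₂ : r₂ + 1 < k := (le_max_right _ _).trans_lt hk
  have hk0 : (0 : ℝ) ≤ k := Nat.cast_nonneg k
  set q : ℂ := 1 - 2 * ν with hq
  -- Both lines `Re s = ± b` lie in the domains of absolute convergence and have both poles
  -- between them.
  set b : ℝ := k + 1 + ‖q‖ with hbdef
  have hq1 := abs_le.1 (abs_re_le_norm q)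
  have hqn : 0 ≤ ‖q‖ := norm_nonneg q
  have hb0 : 0 < b := by linarith
  have hright : ∀ (f : TestRx) (s : ℂ), s.re = b →
      subPolarPairing μ ν (valueAtZero α₁) (valueAtZero α₂) R f s =
        mellin (tailSum α₁ f.toTestR) s := fun f s hs =>
    subPolarPairing_eq_mellin hL₁ h₁ hX.continuation₁ hR hRX hk₁ f
      (by rw [hs]; linarith) (by rw [hs, ← hq]; linarith)
  have hleft : ∀ (f : TestRx) (s : ℂ), s.re = -b →
      subPolarPairing μ ν (valueAtZero α₁) (valueAtZero α₂) R f s =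
        mellin (tailSum α₂ (pullback μ ν f).toTestR) (q - s) := fun f s hs =>
    subPolarPairing_eq_mellin_pullback hL₂ h₂ hX.continuation₂ hR hRX hX.functional_equation hk₂ f
      (by rw [← hq, sub_re, hs]; linarith) (by linarith)
  have hbound : ∀ f : TestRx, ∃ C : ℝ, ∀ s : ℂ, -b ≤ s.re → s.re ≤ b →
      ‖pair f (1 - s) (R s)‖ ≤ C := by
    intro f
    obtain ⟨C₁, hC₁⟩ := exists_norm_mellin_tailSum_le α₁ f.toTestR b
    obtain ⟨C₂, hC₂⟩ := exists_norm_mellin_tailSum_le α₂ (pullback μ ν f).toTestR (q.re + b)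
    obtain ⟨M, -, hM⟩ := exists_norm_polarPart_le μ ν (valueAtZero α₁) (valueAtZero α₂)
    obtain ⟨D, -, hD⟩ := exists_norm_pair_le f (-b) b
    have hline : ∀ s : ℂ, |s.re| = b → ‖pair f (1 - s) (R s)‖ ≤
        ‖subPolarPairing μ ν (valueAtZero α₁) (valueAtZero α₂) R f s‖ + D * M := by
      intro s hs
      have hn : b ≤ ‖s‖ := hs ▸ abs_re_le_norm s
      have hn1 : 1 ≤ ‖s‖ := by linarith
      have e : s + 2 * ν - 1 = s - q := by rw [hq]; ring
      have hn2 : 1 ≤ ‖s + 2 * ν - 1‖ := by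
        rw [e]
        linarith [norm_sub_norm_le s q]
      have hs0 : s ≠ 0 := by rintro rfl; simp at hn1; linarith
      have hs1 : s ≠ 1 - 2 * ν := by rintro rfl; simp at hn2; linarith
      obtain ⟨hs2, hs3⟩ := abs_le.1 hs.le
      have h := subPolarPairing_eq μ ν (valueAtZero α₁) (valueAtZero α₂) R f hs0 hs1
      rw [pair_sub, eq_sub_iff_add_eq] at h
      rw [← h]
      exact (norm_add_le _ _).trans (add_le_add le_rfl (hD s hs2 hs3 _ _ (hM s hn1 hn2)))
    refine ⟨max C₁ C₂ + D * M, fun s hs hs' =>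
      norm_pair_le_of_weakStripBound hR hRX hb hb0 f (fun z hz => ?_) (fun z hz => ?_) hs hs'⟩
    · refine (hline z (by rw [hz, abs_neg, abs_of_pos hb0])).trans (add_le_add ?_ le_rfl)
      rw [hleft f z hz]
      exact (hC₂ _ (by rw [sub_re, hz, sub_neg_eq_add])).trans (le_max_right _ _)
    · refine (hline z (by rw [hz, abs_of_pos hb0])).trans (add_le_add ?_ le_rfl)
      rw [hright f z hz]
      exact (hC₁ _ hz).trans (le_max_left _ _)
  have hNb : ∀ y : ℝ, subPolarPairing μ ν (valueAtZero α₁) (valueAtZero α₂) R f (b + y * I) =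
      mellin (tailSum α₁ f.toTestR) (b + y * I) := fun y => hright f _ (by simp)
  have hNa : ∀ y : ℝ, subPolarPairing μ ν (valueAtZero α₁) (valueAtZero α₂) R f
      ((-b : ℝ) + y * I) = mellin (tailSum α₂ (pullback μ ν f).toTestR)
        ((q.re + b : ℝ) + (q.im - y : ℝ) * I) := fun y => by
    rw [hleft f _ (by simp)]
    congr 1
    apply Complex.ext <;> simp
  have hc : (k : ℝ) < q.re + b := by linarith
  have hib := verticalIntegrable_mellin_tailSum hL₁ h₁ hk₁ (by linarith : (k : ℝ) < b)
    (by linarith) f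
  have hia := verticalIntegrable_mellin_tailSum hL₂ h₂ hk₂ hc (by linarith) (pullback μ ν f)
  have hshift := integral_vertical_sub_eq (q := q)
    (Z := fun s => pair f (1 - s) (R s) -
      polarRest μ ν (valueAtZero α₁) (valueAtZero α₂) f s)
    ((differentiable_pair f hR).sub (differentiable_polarRest _ _ _ _ f)) (by linarith : -b < 0)
    hb0 (by linarith) (by linarith)
    (subPolarPairing μ ν (valueAtZero α₁) (valueAtZero α₂) R f) (fun s => rfl)
    (fun ε hε => subPolarPairing_decay hbound f hε)
    (by
      simp only [hNa]
      exact Integrable.comp_sub_left hia q.im)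
    (by
      simp only [hNb]
      exact hib)
  simp only [hNa, hNb] at hshift
  rw [integral_sub_left_eq_self
      (fun y : ℝ => mellin (tailSum α₂ (pullback μ ν f).toTestR) ((q.re + b : ℝ) + y * I))
      volume q.im,
    integral_mellin_tailSum hL₁ h₁ hk₁ (by linarith) (by linarith) f,
    integral_mellin_tailSum hL₂ h₂ hk₂ hc (by linarith) (pullback μ ν f), ← mul_sub] at hshift
  have hπ : (2 * Real.pi : ℂ) ≠ 0 := by simp [Real.pi_ne_zero]
  have h := mul_left_cancel₀ hπ hshift
  rw [fourierSeries_eq hL₁ h₁, fourierSeries_eq hL₂ h₂]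
  linear_combination h

end Converse

end AutomorphicDistribution

end

open AutomorphicDistribution in
theorem mainTheorem2 (L₁ L₂ : Set ℝ) (hL₁ : IsShiftedLattice L₁) (hL₂ : IsShiftedLattice L₂)
    (μ ν : ℂ) (α₁ : L₁ → ℂ) (α₂ : L₂ → ℂ) (hα₁ : PolyBounded α₁) (hα₂ : PolyBounded α₂) :
    ((fourierSeries α₁, fourierSeries α₂) ∈ automorphicPairsFor L₁ L₂ μ ν →
      ∃ X₁ X₂ : ℂ → Fin 2 → ℂ, AnalyticCondition α₁ α₂ μ ν X₁ X₂ ∧ StripBound X₁ ∧ StripBound X₂) ∧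
    ((∃ X₁ X₂ : ℂ → Fin 2 → ℂ, AnalyticCondition α₁ α₂ μ ν X₁ X₂ ∧ WeakStripBound X₁) →
      (fourierSeries α₁, fourierSeries α₂) ∈ automorphicPairsFor L₁ L₂ μ ν) := by
  obtain ⟨r₁, h₁⟩ := hα₁
  obtain ⟨r₂, h₂⟩ := hα₂
  refine ⟨fun h => exists_analyticCondition hL₁ hL₂ h₁ h₂ h.1.2.2, ?_⟩
  rintro ⟨X₁, X₂, hX, hb⟩
  exact ⟨⟨isDistribution_fourierSeries hL₁ h₁, isDistribution_fourierSeries hL₂ h₂,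
      fourierSeries_eq_fourierSeries_pullback hL₁ hL₂ h₁ h₂ hX hb⟩,
    fourierSeries_mem_quasiPeriodic hL₁ h₁, fourierSeries_mem_quasiPeriodic hL₂ h₂⟩
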